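/- Let $N\ge 4$, $\kappa>0$, $\epsilon\in\{1,-1\}$, $\Lambda\in\mathbb R$. Let $\hat g=\epsilon e^{2V(x)}dy^2+e^{-2V(x)}\hat h_{ij}(x)dx^idx^j$, with $x$ in a connected open set $U\subset\mathbb R^{N-1}$ and $V$, $\hat h$ smooth ($\hat h$ a pseudo-Riemannian metric), be a solution of the $N$-dimensional vacuum Einstein equations $R_{\mu\nu}[\hat g]=\frac{2}{N-2}\Lambda\,\hat g_{\mu\nu}$. An Einstein-scalar solution is a triple $(g,\phi,W)$ with $$R_{\mu\nu}[g]=\kappa\Big(\partial_\mu\phi\,\partial_\nu\phi+\tfrac{2}{N-2}g_{\mu\nu}W(\phi)\Big),\qquad \Box\phi=W'(\phi).$$ It is *derived from* $\hat g$ on $I\times U$ ($I$ an open interval) if $$g=e^{2\mu(y)}\big(\epsilon e^{2\alpha V}dy^2+e^{-2\alpha V-2\delta V}\hat h_{ij}dx^idx^j\big),\qquad \phi=\sigma V+\rho\mu(y)$$ with constants $\alpha,\delta,\sigma,\rho$ and smooth $\mu$, where $\delta=\frac{N-4}{N-3}(1-\alpha)$; this last relation is not imposed (it is then a consequence) if $\hat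 g$ is non-exceptional, i.e. if the Hessian of $V$ with respect to $\hat h$ is not of the form $f\hat h_{ij}+c\,\partial_iV\partial_jV$ on $U$ with a function $f$ and a constant $c$. The potential $W$ is arbitrary. The solution is of class $\mathcal S_N$ if $\mu=0$ and of class $\mathcal T_N$ if $\mu$ is not constant; $\mathcal T_N^0$ and $\mathcal T_N^\Lambda$ denote class $\mathcal T_N$ for $\Lambda=0$ and $\Lambda\ne0$, respectively. For $\varepsilon=\pm1$, $\lambda\in\mathbb R$, $q\ge0$ and $b^2\in\mathbb R$ (so $b\ge 0$, or $b$ imaginary), put $$\alpha=\frac{\varepsilon\lambda}{\sqrt{N-3+\lambda^2}},\quad \gamma=\alpha+\frac{N-4}{N-3}(1-\alpha),\quad k=\sqrt{\frac{\kappa}{N-2}}\,\lambda,\quad W_0=-\epsilon\frac{(N-2)(N-1-\lambda^2)}{2\kappa}q^2b^2,$$ $D(Y)=b^2e^{2(1-\lambda^2)qY}+1-b^2$, and, where $D(Y)>0$, $$ds^2=\epsilon\frac{e^{2(\alpha V+qY)}}{D(Y)}dY^2+e^{-2\gamma V+2qY}\hat h_{ij}dx^idx^j,\quad \phi=\sqrt{\frac{N-2}{\kappa}}\Big(\frac{\varepsilon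 V}{\sqrt{N-3+\lambda^2}}+\lambda qY\Big),\quad W[\phi]=W_0e^{-2k\phi},$$ and consider the relation $$(\ast)\qquad \Lambda=-\epsilon\frac{(N-2)(N-3)(N-1-\lambda^2)}{2(N-1-2\alpha)}q^2(b^2-1).$$ If $(\ast)$ holds and $q=0$, or $b^2=1$, or $\lambda=\varepsilon/\sqrt{N-1}$, then this triple is an Einstein-scalar solution. Moreover: * ($\mathcal S_N$) If $(\ast)$ holds with $q=0$, then $\Lambda=0$ and the triple is of class $\mathcal S_N$ (with $y=Y$). Conversely, if a solution of class $\mathcal S_N$ has non-constant $\phi$, then $\Lambda=0$ and it equals the triple with $q=0$ for some $\varepsilon$ and some $\lambda\in(-\infty,\infty)$. * ($\mathcal T_N^0$) If $(\ast)$ holds with $b=1$, $q>0$, $\lambda\in(-\infty,\infty)$, then $\Lambda=0$ and the triple on $\{D>0\}\times U$ is, after a change of coordinate $Y=Y(y)$, of class $\mathcal T_N^0$. Conversely, if $V$ is non-constant or zero, every solution of class $\mathcal T_N^0$ is of this form after a change of coordinate $Y=Y(y)$ on all of $I$, for some $\varepsilon$, $\lambda$ and $q>0$. * ($\mathcal T_N^\Lambda$)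 If $(\ast)$ holds with $b^2\neq1$, $q>0$, $\lambda=\varepsilon/\sqrt{N-1}$, then $\Lambda\ne0$ and the triple on $\{D>0\}\times U$ is, after a change of coordinate $Y=Y(y)$, of class $\mathcal T_N^\Lambda$. Conversely, every solution of class $\mathcal T_N^\Lambda$ comes from such parameters satisfying $(\ast)$, a smooth function $Y$ on $I$ whose derivative has at most one zero, and a constant $m\in\mathbb R$: with $Y=Y(y)$ it has the scalar field $\phi+\sqrt{(N-2)/\kappa}\,\lambda m$, the potential $e^{-2m}W\big[\,\cdot-\sqrt{(N-2)/\kappa}\,\lambda m\big]$ and, wherever $Y'(y)\ne0$ (there $D(Y)>0$), the metric $e^{2m}ds^2$. The parameters can be chosen such that $m=0$ or $b^2e^{-2(1-\lambda^2)m}\le b^2-1$. In the converse statements the potential is determined on the range of the scalar field. -/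

import Mathlib

open scoped ContDiff

noncomputable section

namespace EinsteinScalar

/-! Pseudo-Riemannian geometry in one chart: a metric is a matrix-valued function on `ι → ℝ`. -/

/-- The partial derivative `∂ᵢ f` at `x`. -/
def pd {ι : Type} [Fintype ι] [DecidableEq ι] (i : ι) (f : (ι → ℝ) → ℝ) (x : ι → ℝ) : ℝ :=
  fderiv ℝ f x (Pi.single i 1)

/-- The Christoffel symbol `Γᵏᵢⱼ` of the Levi-Civita connection of `g`. -/
def christoffel {ι : Type} [Fintype ι] [DecidableEq ι] (g : (ι → ℝ) → Matrix ι ι ℝ)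
    (k i j : ι) (x : ι → ℝ) : ℝ :=
  (1 / 2) * ∑ l, (g x)⁻¹ k l *
    (pd i (fun z => g z j l) x + pd j (fun z => g z i l) x - pd l (fun z => g z i j) x)

/-- The Ricci tensor
`Rᵢⱼ = ∂ₖ Γᵏᵢⱼ - ∂ⱼ Γᵏᵢₖ + Γᵏₖₗ Γˡᵢⱼ - Γᵏⱼₗ Γˡᵢₖ` (positive on round spheres). -/
def ricci {ι : Type} [Fintype ι] [DecidableEq ι] (g : (ι → ℝ) → Matrix ι ι ℝ)
    (i j : ι) (x : ι → ℝ) : ℝ :=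
  ∑ k, (pd k (christoffel g k i j) x - pd j (christoffel g k i k) x) +
    ∑ k, ∑ l, (christoffel g k k l x * christoffel g l i j x -
      christoffel g k j l x * christoffel g l i k x)

/-- The covariant Hessian `∇ᵢ∇ⱼ f`. -/
def hess {ι : Type} [Fintype ι] [DecidableEq ι] (g : (ι → ℝ) → Matrix ι ι ℝ)
    (f : (ι → ℝ) → ℝ) (i j : ι) (x : ι → ℝ) : ℝ :=
  pd i (pd j f) x - ∑ k, christoffel g k i j x * pd k f x

/-- The Laplace (d'Alembert) operator `□ f = gⁱʲ ∇ᵢ∇ⱼ f`. -/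
def box {ι : Type} [Fintype ι] [DecidableEq ι] (g : (ι → ℝ) → Matrix ι ι ℝ)
    (f : (ι → ℝ) → ℝ) (x : ι → ℝ) : ℝ :=
  ∑ i, ∑ j, (g x)⁻¹ i j * hess g f i j x

/-- `g` is a smooth pseudo-Riemannian metric (of any signature) on `Ω`. -/
structure IsMetricOn {ι : Type} [Fintype ι] [DecidableEq ι] (Ω : Set (ι → ℝ))
    (g : (ι → ℝ) → Matrix ι ι ℝ) : Prop where
  smooth : ∀ i j, ContDiffOn ℝ ∞ (fun x => g x i j) Ω
  symm : ∀ x ∈ Ω, (g x).IsSymm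
  nondeg : ∀ x ∈ Ω, (g x).det ≠ 0

/-- Vacuum Einstein equations with cosmological constant `Λ` in dimension `N`,
in the form `R_{μν} = 2/(N-2) Λ g_{μν}`. -/
structure IsVacuumSolution {N : ℕ} (Lam : ℝ) (Ω : Set (Fin N → ℝ))
    (g : (Fin N → ℝ) → Matrix (Fin N) (Fin N) ℝ) : Prop where
  metric : IsMetricOn Ω g
  einstein : ∀ p ∈ Ω, ∀ i j, ricci g i j p = 2 / ((N : ℝ) - 2) * Lam * g p i j

/-- The minimally coupled Einstein-scalar field equations in dimension `N` with (effective)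
potential `W`:  `R_{μν} = κ (∂_μ φ ∂_ν φ + 2/(N-2) g_{μν} W(φ))` and `□ φ = W'(φ)`. -/
structure IsScalarSolution {N : ℕ} (κ : ℝ) (Ω : Set (Fin N → ℝ))
    (g : (Fin N → ℝ) → Matrix (Fin N) (Fin N) ℝ) (φ : (Fin N → ℝ) → ℝ) (W : ℝ → ℝ) : Prop where
  metric : IsMetricOn Ω g
  smooth : ContDiffOn ℝ ∞ φ Ω
  einstein : ∀ p ∈ Ω, ∀ i j, ricci g i j p =
    κ * (pd i φ p * pd j φ p + 2 / ((N : ℝ) - 2) * g p i j * W (φ p))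
  scalar : ∀ p ∈ Ω, HasDerivAt W (box g φ p) (φ p)

/-! Orthogonal-symmetric metrics. A point of spacetime is `p : Fin (n+1) → ℝ`, with `p 0 = y`
and `Fin.tail p = x`; the dimension is `N = n + 1`. -/

/-- The block matrix of the line element `A dy² + Hᵢⱼ dxⁱ dxʲ`. -/
def orthMatrix {n : ℕ} (A : ℝ) (H : Matrix (Fin n) (Fin n) ℝ) :
    Matrix (Fin (n + 1)) (Fin (n + 1)) ℝ :=
  Matrix.of fun i j =>
    Fin.cases (Fin.cases A (fun _ => 0) j) (fun i' => Fin.cases 0 (fun j' => H i' j') j) i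

/-- The points `(y, x)` with `y ∈ I`, `x ∈ U`. -/
def slab {n : ℕ} (I : Set ℝ) (U : Set (Fin n → ℝ)) : Set (Fin (n + 1) → ℝ) :=
  {p | p 0 ∈ I ∧ Fin.tail p ∈ U}

/-- `g[V, h] = ε e^{2V(x)} dy² + e^{-2V(x)} hᵢⱼ dxⁱ dxʲ`. -/
def orthMetric {n : ℕ} (ε : ℝ) (V : (Fin n → ℝ) → ℝ)
    (h : (Fin n → ℝ) → Matrix (Fin n) (Fin n) ℝ) (p : Fin (n + 1) → ℝ) :
    Matrix (Fin (n + 1)) (Fin (n + 1)) ℝ :=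
  orthMatrix (ε * Real.exp (2 * V (Fin.tail p)))
    (Real.exp (-2 * V (Fin.tail p)) • h (Fin.tail p))

/-- An orthogonal-symmetric vacuum seed `g[V, ĥ]` over the connected open set `U`. -/
structure IsSeed {n : ℕ} (ε Lam : ℝ) (U : Set (Fin n → ℝ)) (V : (Fin n → ℝ) → ℝ)
    (h : (Fin n → ℝ) → Matrix (Fin n) (Fin n) ℝ) : Prop where
  isOpen : IsOpen U
  connected : IsConnected U
  smooth : ContDiffOn ℝ ∞ V U
  metric : IsMetricOn U h
  vacuum : IsVacuumSolution Lam (slab Set.univ U) (orthMetric ε V h)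

/-- The seed is non-exceptional: the Hessian of `V` with respect to `ĥ` is not of the form
`f(x) ĥᵢⱼ + c ∂ᵢV ∂ⱼV` with a function `f` and a constant `c`. -/
def IsGenericSeed {n : ℕ} (U : Set (Fin n → ℝ)) (V : (Fin n → ℝ) → ℝ)
    (h : (Fin n → ℝ) → Matrix (Fin n) (Fin n) ℝ) : Prop :=
  ¬ ∃ (c : ℝ) (f : (Fin n → ℝ) → ℝ), ∀ x ∈ U, ∀ i j,
    hess h V i j x = f x * h x i j + c * (pd i V x * pd j V x)

/-- The metric template
`e^{2μ(y)} (ε e^{2αV} dy² + e^{-2αV} e^{-2δV} ĥᵢⱼ dxⁱ dxʲ)`. -/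
def templateMetric {n : ℕ} (ε : ℝ) (V : (Fin n → ℝ) → ℝ)
    (h : (Fin n → ℝ) → Matrix (Fin n) (Fin n) ℝ) (α δ : ℝ) (μ : ℝ → ℝ)
    (p : Fin (n + 1) → ℝ) : Matrix (Fin (n + 1)) (Fin (n + 1)) ℝ :=
  Real.exp (2 * μ (p 0)) •
    orthMatrix (ε * Real.exp (2 * (α * V (Fin.tail p))))
      ((Real.exp (-2 * (α * V (Fin.tail p))) * Real.exp (-2 * (δ * V (Fin.tail p)))) •
        h (Fin.tail p))

/-- `(g, φ, W)` is an Einstein-scalar field solution on `I × U` derived from the seed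
`g[V, ĥ]` with conformal factor `e^{2μ(y)}`: the metric fits the template and
`φ = σ V(x) + ρ μ(y)`, where `δ = (N-4)/(N-3) (1-α)` unless the seed is non-exceptional
(in which case `δ` is left free). The potential `W` is arbitrary. -/
def IsDerived {n : ℕ} (κ ε : ℝ) (U : Set (Fin n → ℝ)) (V : (Fin n → ℝ) → ℝ)
    (h : (Fin n → ℝ) → Matrix (Fin n) (Fin n) ℝ) (I : Set ℝ) (μ : ℝ → ℝ)
    (g : (Fin (n + 1) → ℝ) → Matrix (Fin (n + 1)) (Fin (n + 1)) ℝ)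
    (φ : (Fin (n + 1) → ℝ) → ℝ) (W : ℝ → ℝ) : Prop :=
  ∃ α δ σ ρ : ℝ,
    (δ = ((n : ℝ) + 1 - 4) / ((n : ℝ) + 1 - 3) * (1 - α) ∨ IsGenericSeed U V h) ∧
    (∀ p ∈ slab I U, g p = templateMetric ε V h α δ μ p) ∧
    (∀ p ∈ slab I U, φ p = σ * V (Fin.tail p) + ρ * μ (p 0)) ∧
    IsScalarSolution κ (slab I U) g φ W

/-- Class `S`: orthogonal-symmetric derived solutions, `μ = 0`. -/
def IsClassS {n : ℕ} (κ ε : ℝ) (U : Set (Fin n → ℝ)) (V : (Fin n → ℝ) → ℝ)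
    (h : (Fin n → ℝ) → Matrix (Fin n) (Fin n) ℝ) (I : Set ℝ)
    (g : (Fin (n + 1) → ℝ) → Matrix (Fin (n + 1)) (Fin (n + 1)) ℝ)
    (φ : (Fin (n + 1) → ℝ) → ℝ) (W : ℝ → ℝ) : Prop :=
  IsDerived κ ε U V h I (fun _ => 0) g φ W

/-- Class `T`: conformally `y`-inflated derived solutions, `μ` not constant. -/
def IsClassT {n : ℕ} (κ ε : ℝ) (U : Set (Fin n → ℝ)) (V : (Fin n → ℝ) → ℝ)
    (h : (Fin n → ℝ) → Matrix (Fin n) (Fin n) ℝ) (I : Set ℝ)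
    (g : (Fin (n + 1) → ℝ) → Matrix (Fin (n + 1)) (Fin (n + 1)) ℝ)
    (φ : (Fin (n + 1) → ℝ) → ℝ) (W : ℝ → ℝ) : Prop :=
  ∃ μ : ℝ → ℝ, ContDiffOn ℝ ∞ μ I ∧ (∃ y ∈ I, ∃ y' ∈ I, μ y ≠ μ y') ∧
    IsDerived κ ε U V h I μ g φ W

/-! The general form. `N` is the dimension, `s = ±1` is the sign `ε` (varepsilon) of the
scalar field, and `β` stands for `b²`. -/

/-- `α = s λ / √(N-3+λ²)`. -/
def alphaOf (N s lam : ℝ) : ℝ := s * (lam / Real.sqrt (N - 3 + lam ^ 2))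

/-- `γ = α + (N-4)/(N-3) (1-α)`. -/
def gammaOf (N s lam : ℝ) : ℝ :=
  alphaOf N s lam + (N - 4) / (N - 3) * (1 - alphaOf N s lam)

/-- `k = √(κ/(N-2)) λ`. -/
def kOf (N κ lam : ℝ) : ℝ := Real.sqrt (κ / (N - 2)) * lam

/-- `W₀ = -ε (N-2)(N-1-λ²)/(2κ) q² b²`. -/
def W0Of (N κ ε lam q β : ℝ) : ℝ :=
  -ε * ((N - 2) * (N - 1 - lam ^ 2) / (2 * κ)) * (q ^ 2 * β)

/-- `Λ = -ε (N-2)(N-3)(N-1-λ²)/(2(N-1-2α)) q² (b²-1)`. -/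
def LambdaOf (N ε s lam q β : ℝ) : ℝ :=
  -ε * ((N - 2) * (N - 3) * (N - 1 - lam ^ 2) / (2 * (N - 1 - 2 * alphaOf N s lam))) *
    (q ^ 2 * (β - 1))

/-- `b² e^{2(1-λ²)qY} + 1 - b²`. -/
def denom (lam q β Y : ℝ) : ℝ := β * Real.exp (2 * (1 - lam ^ 2) * (q * Y)) + 1 - β

/-- `ε e^{2(αV+qY)} / (b² e^{2(1-λ²)qY} + 1 - b²) dY² + e^{-2γV+2qY} ĥᵢⱼ dxⁱ dxʲ`. -/
def genMetric {n : ℕ} (ε : ℝ) (V : (Fin n → ℝ) → ℝ)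
    (h : (Fin n → ℝ) → Matrix (Fin n) (Fin n) ℝ) (s lam q β : ℝ)
    (p : Fin (n + 1) → ℝ) : Matrix (Fin (n + 1)) (Fin (n + 1)) ℝ :=
  orthMatrix
    (ε * (Real.exp (2 * (alphaOf ((n : ℝ) + 1) s lam * V (Fin.tail p) + q * p 0)) /
      denom lam q β (p 0)))
    (Real.exp (-2 * (gammaOf ((n : ℝ) + 1) s lam * V (Fin.tail p)) + 2 * (q * p 0)) •
      h (Fin.tail p))

/-- `φ = √((N-2)/κ) (s V / √(N-3+λ²) + λ q Y)`. -/
def genField {n : ℕ} (κ : ℝ) (V : (Fin n → ℝ) → ℝ) (s lam q : ℝ)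
    (p : Fin (n + 1) → ℝ) : ℝ :=
  Real.sqrt (((n : ℝ) + 1 - 2) / κ) *
    (s * (1 / Real.sqrt ((n : ℝ) + 1 - 3 + lam ^ 2)) * V (Fin.tail p) + lam * (q * p 0))

/-- `W[φ] = W₀ e^{-2kφ}`. -/
def genPotential (N κ ε lam q β t : ℝ) : ℝ :=
  W0Of N κ ε lam q β * Real.exp (-2 * kOf N κ lam * t)

/-- The map `(y, x) ↦ (Y(y), x)`. -/
def changeY {n : ℕ} (Y : ℝ → ℝ) (p : Fin (n + 1) → ℝ) : Fin (n + 1) → ℝ :=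
  Fin.cons (Y (p 0)) (Fin.tail p)

/-- The pull-back of the metric `G` under `(y, x) ↦ (Y(y), x)`, whose Jacobian matrix is
diagonal with entries `Y'(y), 1, …, 1`. -/
def pullY {n : ℕ} (Y : ℝ → ℝ) (G : (Fin (n + 1) → ℝ) → Matrix (Fin (n + 1)) (Fin (n + 1)) ℝ)
    (p : Fin (n + 1) → ℝ) : Matrix (Fin (n + 1)) (Fin (n + 1)) ℝ :=
  Matrix.diagonal (Fin.cons (deriv Y (p 0)) (fun _ => 1)) * G (changeY Y p) *
    Matrix.diagonal (Fin.cons (deriv Y (p 0)) (fun _ => 1))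

/-- `Y` is a smooth change of coordinate (diffeomorphism) from the open interval `I` onto `J`. -/
structure IsCoordChange (Y : ℝ → ℝ) (I J : Set ℝ) : Prop where
  isOpen : IsOpen I
  interval : I.OrdConnected
  smooth : ContDiffOn ℝ ∞ Y I
  bij : Set.BijOn Y I J
  deriv_ne : ∀ y ∈ I, deriv Y y ≠ 0

end EinsteinScalar

end

/-! The seed, the template and the general form are all instances of the metric
`ε e^{2(aV + P(y))} dy² + e^{2cV + 2R(y)} h` (`twisted`), so that a single curvature computation
serves both directions. That metric is a warped product over the conformally rescaled metric
`e^{2cV} h`: its Ricci tensor and Laplacian follow from those of `warped`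
(`IsWarpData.ricci_zero_zero`, `IsWarpData.ricci_succ_succ`, `IsWarpData.box_eq`) and the behaviour
of `ricci`, `hess` and `box` under a conformal change (`ricci_conformal`, `box_conformal`). Write
`n = N - 1`. The vacuum equations of the seed express `Δ_h V` and `Ric(h)` through `Hess V`,
`dV ⊗ dV` and `Λ e^{-2V} h` (`IsSeed.box_eq`, `IsSeed.ricci_eq`). With `a = α`, `c = -γ` the Hessian
of `V` then enters the Ricci tensor with the coefficient `α + n - 3 - (n - 2) γ`. This is zero by
the relation between `δ` and `α`, or because the seed is non-exceptional (`gamma_eq_of_generic`),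
and what is left are exponentials in `V` times functions of `y` (`ricci_derived_zero_zero`,
`ricci_derived_succ_succ`).

For the members of the family the remaining equations follow from the first integral
`R'² e^{2(R - P)} = q² D` and its derivative (`isScalarSolution_twisted`). The terms with `Λ` have to
cancel those with `q² (1 - b²)`; both vanish if `q = 0` or `b² = 1`, and otherwise their dependence
on `V` agrees because of `λ = s/√(N-1)` (`Lambda_balance`). A coordinate with `Y'² = D(Y)` brings
a member into the template with `μ = qY`; it is the inverse of a primitive of `1/√D`
(`exists_isCoordChange`, `exists_isClassT`).

Conversely, let a derived solution be given. As `h` has rank at least two, the `dxⁱ dxʲ` equations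
split into `κσ² = (n - 1)(1 - α²)/(n - 2)`, if `V` is not constant, and an expression for the
potential (`sigma_sq_of_nonconstant`, `reduced_trace`); the `dy dxⁱ` equations give
`(n - 1) α = κσρ` if `μ` and `V` are not constant (`mixed_of_nonconstant`). These two relations are
solved by exactly the constants of the family (`recover_parameters`). Eliminating the potential
between the `dy²` and the `dxⁱ dxʲ` equations leaves an ordinary differential equation for `μ`
(`reduced_ode`). For `μ = 0` it forces `Λ = 0` (`classS_converse`). In class `T` it reads
`μ'' = (1 - λ²)(μ'² - c)`, with `c = 0` for `Λ = 0`; for `Λ ≠ 0` its dependence on `V` forces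
`λ = s/√(N-1)` (`special_of_Lambda_ne_zero`), and then `c` is a multiple of `Λ`. Its energy integral
`μ'² = M e^{2(1 - λ²)μ} + c` (`exists_first_integral`) is the equation `Y'² = D(Y)` for
`Y = (μ - m)/q`, `q² = M e^{2(1 - λ²)m} + c`, where the shift `m` is needed only if `M + c ≤ 0`
(`classT_flat`, `classT_Lambda`). -/

namespace EinsteinScalar

open Filter Topology

/-! ### Partial derivatives -/

section PartialDerivatives

variable {ι : Type} [Fintype ι] [DecidableEq ι] {U : Set (ι → ℝ)} {f g : (ι → ℝ) → ℝ} {x : ι → ℝ}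

lemma pd_congr (h : f =ᶠ[𝓝 x] g) (i : ι) : pd i f x = pd i g x := by
  unfold pd; rw [h.fderiv_eq]

lemma eventuallyEq_pd (h : f =ᶠ[𝓝 x] g) (i : ι) : pd i f =ᶠ[𝓝 x] pd i g :=
  h.eventually_nhds.mono fun _ hz => pd_congr hz i

@[simp] lemma pd_const (i : ι) (c : ℝ) : pd i (fun _ => c) x = 0 := by simp [pd]

lemma pd_add (i : ι) (hf : DifferentiableAt ℝ f x) (hg : DifferentiableAt ℝ g x) :
    pd i (fun z => f z + g z) x = pd i f x + pd i g x := by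
  simp [pd, fderiv_fun_add hf hg]

lemma pd_sub (i : ι) (hf : DifferentiableAt ℝ f x) (hg : DifferentiableAt ℝ g x) :
    pd i (fun z => f z - g z) x = pd i f x - pd i g x := by
  simp [pd, fderiv_fun_sub hf hg]

lemma pd_mul (i : ι) (hf : DifferentiableAt ℝ f x) (hg : DifferentiableAt ℝ g x) :
    pd i (fun z => f z * g z) x = pd i f x * g x + f x * pd i g x := by
  simp [pd, fderiv_fun_mul hf hg]; ring

lemma pd_const_mul (i : ι) (c : ℝ) (f : (ι → ℝ) → ℝ) :
    pd i (fun z => c * f z) x = c * pd i f x := by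
  have : (fun z => c * f z) = c • f := rfl
  simp [pd, this, fderiv_const_smul_field]

lemma pd_exp (i : ι) (hf : DifferentiableAt ℝ f x) :
    pd i (fun z => Real.exp (f z)) x = Real.exp (f x) * pd i f x := by
  simp [pd, fderiv_exp hf]

lemma pd_sum {κ : Type} (s : Finset κ) (i : ι) {F : κ → (ι → ℝ) → ℝ}
    (hF : ∀ k ∈ s, DifferentiableAt ℝ (F k) x) :
    pd i (fun z => ∑ k ∈ s, F k z) x = ∑ k ∈ s, pd i (F k) x := by
  simp [pd, fderiv_fun_sum hF]

lemma pd_sum_mul {κ : Type} [Fintype κ] (i : ι) {F G : κ → (ι → ℝ) → ℝ}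
    (hF : ∀ k, DifferentiableAt ℝ (F k) x) (hG : ∀ k, DifferentiableAt ℝ (G k) x) :
    pd i (fun z => ∑ k, F k z * G k z) x
      = ∑ k, pd i (F k) x * G k x + ∑ k, F k x * pd i (G k) x := by
  rw [pd_sum (F := fun k z => F k z * G k z) _ _ fun k _ => (hF k).mul (hG k),
    ← Finset.sum_add_distrib]
  exact Finset.sum_congr rfl fun k _ => pd_mul i (hF k) (hG k)

lemma pd_ite (i : ι) (p : Prop) [Decidable p] (f : (ι → ℝ) → ℝ) :
    pd i (fun z => if p then f z else 0) x = if p then pd i f x else 0 := by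
  split_ifs <;> simp

omit [DecidableEq ι] in
lemma differentiableAt_of_smooth (hU : IsOpen U) (hf : ContDiffOn ℝ ∞ f U) (hx : x ∈ U) :
    DifferentiableAt ℝ f x :=
  (hf.contDiffAt (hU.mem_nhds hx)).differentiableAt (by simp)

lemma contDiffOn_pd (hU : IsOpen U) (hf : ContDiffOn ℝ ∞ f U) (i : ι) :
    ContDiffOn ℝ ∞ (pd i f) U :=
  (hf.fderiv_of_isOpen hU (by simp)).clm_apply contDiffOn_const

lemma pd_comm (hU : IsOpen U) (hf : ContDiffOn ℝ ∞ f U) (hx : x ∈ U) (i j : ι) :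
    pd i (pd j f) x = pd j (pd i f) x := by
  have hs : IsSymmSndFDerivAt ℝ f x :=
    (hf.contDiffAt (hU.mem_nhds hx)).isSymmSndFDerivAt (by
      simpa using (mod_cast le_top : ((2 : ℕ∞) : WithTop ℕ∞) ≤ ((⊤ : ℕ∞) : WithTop ℕ∞)))
  have hd : DifferentiableAt ℝ (fderiv ℝ f) x :=
    ((hf.fderiv_of_isOpen hU (m := ∞) (by simp)).contDiffAt (hU.mem_nhds hx)).differentiableAt
      (by simp)
  have key : ∀ a b : ι, pd a (pd b f) x
      = fderiv ℝ (fderiv ℝ f) x (Pi.single a 1) (Pi.single b 1) := by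
    intro a b
    unfold pd
    rw [fderiv_clm_apply hd (differentiableAt_const _)]
    simp
  rw [key, key, hs.eq]

end PartialDerivatives

/-! ### The Levi-Civita connection of a metric in a chart -/

section LeviCivita

variable {ι : Type} [Fintype ι] [DecidableEq ι] {U : Set (ι → ℝ)}
  {g g' : (ι → ℝ) → Matrix ι ι ℝ} {f f' : (ι → ℝ) → ℝ} {x : ι → ℝ}

lemma christoffel_congr (h : g =ᶠ[𝓝 x] g') (k i j : ι) :
    christoffel g k i j x = christoffel g' k i j x := by
  have e : ∀ a b : ι, (fun z => g z a b) =ᶠ[𝓝 x] fun z => g' z a b := fun a b =>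
    h.mono fun z hz => by simp only [hz]
  simp only [christoffel, h.eq_of_nhds, pd_congr (e _ _)]

lemma eventuallyEq_christoffel (h : g =ᶠ[𝓝 x] g') (k i j : ι) :
    christoffel g k i j =ᶠ[𝓝 x] christoffel g' k i j :=
  h.eventually_nhds.mono fun _ hz => christoffel_congr hz k i j

lemma ricci_congr (h : g =ᶠ[𝓝 x] g') (i j : ι) : ricci g i j x = ricci g' i j x := by
  simp only [ricci, christoffel_congr h, pd_congr (eventuallyEq_christoffel h _ _ _)]

lemma hess_congr (h : g =ᶠ[𝓝 x] g') (hf : f =ᶠ[𝓝 x] f') (i j : ι) :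
    hess g f i j x = hess g' f' i j x := by
  simp only [hess, christoffel_congr h, pd_congr hf, pd_congr (eventuallyEq_pd hf _)]

lemma box_congr (h : g =ᶠ[𝓝 x] g') (hf : f =ᶠ[𝓝 x] f') : box g f x = box g' f' x := by
  simp only [box, hess_congr h hf, h.eq_of_nhds]

/-- The pairing `gⁱʲ ∂ᵢf ∂ⱼf'` of two gradients. -/
noncomputable def gradInner (g : (ι → ℝ) → Matrix ι ι ℝ) (f f' : (ι → ℝ) → ℝ) (x : ι → ℝ) : ℝ :=
  ∑ i, ∑ j, (g x)⁻¹ i j * (pd i f x * pd j f' x)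

/-- The component `gᵏˡ ∂ₗf` of the gradient. -/
noncomputable def gradUp (g : (ι → ℝ) → Matrix ι ι ℝ) (f : (ι → ℝ) → ℝ) (k : ι) (x : ι → ℝ) : ℝ :=
  ∑ l, (g x)⁻¹ k l * pd l f x

lemma contDiffOn_det {A : (ι → ℝ) → Matrix ι ι ℝ}
    (hA : ∀ i j, ContDiffOn ℝ ∞ (fun z => A z i j) U) : ContDiffOn ℝ ∞ (fun z => (A z).det) U := by
  simp only [Matrix.det_apply]
  refine ContDiffOn.sum fun σ _ => ?_
  refine ContDiffOn.const_smul _ ?_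
  exact contDiffOn_prod fun i _ => hA _ _

namespace IsMetricOn

variable (hg : IsMetricOn U g) (hU : IsOpen U) (hx : x ∈ U)
include hg

lemma isUnit_det {z : ι → ℝ} (hz : z ∈ U) : IsUnit (g z).det := (hg.nondeg z hz).isUnit

lemma inv_mul_entry {z : ι → ℝ} (hz : z ∈ U) (i j : ι) :
    ∑ k, (g z)⁻¹ i k * g z k j = if i = j then 1 else 0 := by
  have := congrFun (congrFun (Matrix.nonsing_inv_mul (g z) (hg.isUnit_det hz)) i) j
  rwa [Matrix.mul_apply, Matrix.one_apply] at this

lemma mul_inv_entry {z : ι → ℝ} (hz : z ∈ U) (i j : ι) :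
    ∑ k, g z i k * (g z)⁻¹ k j = if i = j then 1 else 0 := by
  have := congrFun (congrFun (Matrix.mul_nonsing_inv (g z) (hg.isUnit_det hz)) i) j
  rwa [Matrix.mul_apply, Matrix.one_apply] at this

lemma inv_symm {z : ι → ℝ} (hz : z ∈ U) (i j : ι) : (g z)⁻¹ i j = (g z)⁻¹ j i := by
  have h := Matrix.transpose_nonsing_inv (g z)
  rw [(hg.symm z hz).eq] at h
  exact congrFun (congrFun h j) i

lemma entry_symm {z : ι → ℝ} (hz : z ∈ U) (i j : ι) : g z i j = g z j i :=
  (hg.symm z hz).apply j i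

lemma smooth_inv (i j : ι) : ContDiffOn ℝ ∞ (fun z => (g z)⁻¹ i j) U := by
  have h1 : ContDiffOn ℝ ∞ (fun z => (g z).adjugate i j) U := by
    simp only [Matrix.adjugate_apply]
    refine contDiffOn_det fun a b => ?_
    simp only [Matrix.updateRow_apply]
    split_ifs
    · exact contDiffOn_const
    · exact hg.smooth a b
  have h2 : ContDiffOn ℝ ∞ (fun z => ((g z).det)⁻¹) U :=
    (contDiffOn_det hg.smooth).inv fun z hz => hg.nondeg z hz
  refine (h2.mul h1).congr fun z hz => ?_
  simp [Matrix.inv_def]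

lemma smooth_gradUp (hU : IsOpen U) (hf : ContDiffOn ℝ ∞ f U) (k : ι) :
    ContDiffOn ℝ ∞ (gradUp g f k) U :=
  ContDiffOn.sum fun l _ => (hg.smooth_inv k l).mul (contDiffOn_pd hU hf l)

lemma lower_gradUp {z : ι → ℝ} (hz : z ∈ U) (f : (ι → ℝ) → ℝ) (i : ι) :
    ∑ k, g z i k * gradUp g f k z = pd i f z := by
  simp only [gradUp, Finset.mul_sum]
  rw [Finset.sum_comm]
  simp only [← mul_assoc, ← Finset.sum_mul, hg.mul_inv_entry hz]
  simp

/-- Christoffel symbols of the first kind. -/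
lemma lower_christoffel {x : ι → ℝ} (hx : x ∈ U) (m i j : ι) : ∑ k, g x m k * christoffel g k i j x =
    (1 / 2) * (pd i (fun z => g z j m) x + pd j (fun z => g z i m) x
      - pd m (fun z => g z i j) x) := by
  simp only [christoffel, mul_left_comm _ (1 / 2 : ℝ), Finset.mul_sum]
  rw [Finset.sum_comm]
  simp only [← Finset.mul_sum]
  simp only [← mul_assoc]
  simp only [mul_assoc]
  congr 1
  simp only [← mul_assoc, ← Finset.sum_mul, hg.mul_inv_entry hx]
  simp

include hU

lemma smooth_christoffel (k i j : ι) : ContDiffOn ℝ ∞ (christoffel g k i j) U :=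
  contDiffOn_const.mul <| ContDiffOn.sum fun l _ => (hg.smooth_inv k l).mul
    (((contDiffOn_pd hU (hg.smooth _ _) _).add (contDiffOn_pd hU (hg.smooth _ _) _)).sub
      (contDiffOn_pd hU (hg.smooth _ _) _))

include hx

lemma pd_entry_symm (k i j : ι) : pd k (fun z => g z i j) x = pd k (fun z => g z j i) x :=
  pd_congr (Filter.eventuallyEq_of_mem (hU.mem_nhds hx) fun _ hz => hg.entry_symm hz i j) k

lemma christoffel_symm (k i j : ι) : christoffel g k i j x = christoffel g k j i x := by
  simp only [christoffel]
  congr 1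
  refine Finset.sum_congr rfl fun l _ => ?_
  rw [hg.pd_entry_symm hU hx l i j]; ring

/-- The metric is covariantly constant. -/
lemma pd_metric (k i j : ι) : pd k (fun z => g z i j) x =
    ∑ m, g x j m * christoffel g m k i x + ∑ m, g x i m * christoffel g m k j x := by
  rw [hg.lower_christoffel hx, hg.lower_christoffel hx, hg.pd_entry_symm hU hx k j i,
    hg.pd_entry_symm hU hx i k j, hg.pd_entry_symm hU hx j k i]
  ring

/-- The inverse metric is covariantly constant. -/
lemma pd_inv (k i j : ι) : pd k (fun z => (g z)⁻¹ i j) x =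
    -(∑ m, christoffel g i k m x * (g x)⁻¹ m j) - ∑ m, christoffel g j k m x * (g x)⁻¹ i m := by
  have hd : ∀ a b, DifferentiableAt ℝ (fun z => g z a b) x := fun a b =>
    differentiableAt_of_smooth hU (hg.smooth a b) hx
  have hdi : ∀ a b, DifferentiableAt ℝ (fun z => (g z)⁻¹ a b) x := fun a b =>
    differentiableAt_of_smooth hU (hg.smooth_inv a b) hx
  have h1 : ∀ b, ∑ m, pd k (fun z => (g z)⁻¹ i m) x * g x m b
      = -∑ m, (g x)⁻¹ i m * pd k (fun z => g z m b) x := by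
    intro b
    have e : pd k (fun z => ∑ m, (g z)⁻¹ i m * g z m b) x = 0 := by
      rw [pd_congr (Filter.eventuallyEq_of_mem (hU.mem_nhds hx)
        fun z hz => hg.inv_mul_entry hz i b) k]
      simp
    rw [pd_sum_mul k (F := fun m z => (g z)⁻¹ i m) (G := fun m z => g z m b)
      (fun m => hdi i m) fun m => hd m b] at e
    linarith
  have h2 : pd k (fun z => (g z)⁻¹ i j) x
      = ∑ b, (∑ m, pd k (fun z => (g z)⁻¹ i m) x * g x m b) * (g x)⁻¹ b j := by
    simp only [Finset.sum_mul]
    rw [Finset.sum_comm]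
    simp only [mul_assoc, ← Finset.mul_sum, hg.mul_inv_entry hx]
    simp
  have h3 : ∀ b, ∑ m, (g x)⁻¹ i m * pd k (fun z => g z m b) x
      = (∑ l, g x b l * ∑ m, christoffel g l k m x * (g x)⁻¹ i m) + christoffel g i k b x := by
    intro b
    simp only [hg.pd_metric hU hx, mul_add, Finset.sum_add_distrib]
    congr 1
    · simp only [Finset.mul_sum]
      rw [Finset.sum_comm]
      refine Finset.sum_congr rfl fun l _ => Finset.sum_congr rfl fun m _ => by ring
    · simp only [Finset.mul_sum]
      rw [Finset.sum_comm]
      simp only [← mul_assoc, ← Finset.sum_mul, hg.inv_mul_entry hx]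
      simp
  rw [h2]
  simp only [h1, h3, neg_mul, Finset.sum_neg_distrib, add_mul, Finset.sum_add_distrib]
  have h4 : ∑ b, (∑ l, g x b l * ∑ m, christoffel g l k m x * (g x)⁻¹ i m) * (g x)⁻¹ b j
      = ∑ m, christoffel g j k m x * (g x)⁻¹ i m := by
    simp only [Finset.sum_mul]
    rw [Finset.sum_comm]
    have : ∀ l, ∑ b, g x b l * (∑ m, christoffel g l k m x * (g x)⁻¹ i m) * (g x)⁻¹ b j
        = (if l = j then 1 else 0) * ∑ m, christoffel g l k m x * (g x)⁻¹ i m := by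
      intro l
      rw [← hg.mul_inv_entry hx l j, Finset.sum_mul]
      refine Finset.sum_congr rfl fun b _ => ?_
      rw [hg.entry_symm hx b l]; ring
    simp only [this]
    simp
  rw [h4]; ring

/-- The divergence of the gradient is the Laplacian. -/
lemma div_gradUp (hf : ContDiffOn ℝ ∞ f U) :
    ∑ k, pd k (gradUp g f k) x
      = box g f x - ∑ l, (∑ k, christoffel g k k l x) * gradUp g f l x := by
  have hdi : ∀ a b, DifferentiableAt ℝ (fun z => (g z)⁻¹ a b) x := fun a b =>
    differentiableAt_of_smooth hU (hg.smooth_inv a b) hx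
  have hdf : ∀ a, DifferentiableAt ℝ (pd a f) x := fun a =>
    differentiableAt_of_smooth hU (contDiffOn_pd hU hf a) hx
  have e : ∀ k, pd k (gradUp g f k) x = ∑ l, ((g x)⁻¹ k l * pd k (pd l f) x) -
      ∑ l, (∑ m, christoffel g l k m x * (g x)⁻¹ k m) * pd l f x
      - ∑ m, christoffel g k k m x * gradUp g f m x := by
    intro k
    show pd k (fun z => ∑ l, (g z)⁻¹ k l * pd l f z) x = _
    rw [pd_sum_mul k (F := fun l z => (g z)⁻¹ k l) (G := fun l => pd l f)
      (fun l => hdi k l) hdf]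
    simp only [hg.pd_inv hU hx, sub_mul, neg_mul,
      Finset.sum_sub_distrib, Finset.sum_neg_distrib]
    have : ∑ l, (∑ m, christoffel g k k m x * (g x)⁻¹ m l) * pd l f x
        = ∑ m, christoffel g k k m x * gradUp g f m x := by
      simp only [gradUp, Finset.sum_mul, Finset.mul_sum]
      rw [Finset.sum_comm]
      simp only [mul_assoc]
    rw [this]; ring
  simp only [e, Finset.sum_sub_distrib, box, hess, mul_sub]
  congr 1
  · congr 1
    refine Finset.sum_congr rfl fun k _ => ?_
    simp only [Finset.sum_mul, Finset.mul_sum]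
    rw [Finset.sum_comm]
    refine Finset.sum_congr rfl fun m _ => Finset.sum_congr rfl fun l _ => by ring
  · rw [Finset.sum_comm]
    simp only [Finset.sum_mul]

end IsMetricOn

end LeviCivita

/-! ### Conformal change of the metric -/

section Conformal

variable {ι : Type} [Fintype ι] [DecidableEq ι] {U : Set (ι → ℝ)}
  {h : (ι → ℝ) → Matrix ι ι ℝ} {w f : (ι → ℝ) → ℝ} {x : ι → ℝ}

/-- The conformally rescaled metric `e^{2w} h`. -/
noncomputable def conformal (w : (ι → ℝ) → ℝ) (h : (ι → ℝ) → Matrix ι ι ℝ) (x : ι → ℝ) :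
    Matrix ι ι ℝ := Real.exp (2 * w x) • h x

lemma inv_smul_of_ne {c : ℝ} (hc : c ≠ 0) {A : Matrix ι ι ℝ} (hA : A.det ≠ 0) :
    (c • A)⁻¹ = c⁻¹ • A⁻¹ := by
  have := invertibleOfNonzero hc
  rw [Matrix.inv_smul A c hA.isUnit, invOf_eq_inv]

/-- Kronecker-delta contractions in the quadratic part of the Ricci tensor of `e^{2w} h`:
`G` stands for the Christoffel symbols of `h = H`, `v` for `dw` and `u` for its gradient. -/
lemma conformal_quadratic (G : ι → ι → ι → ℝ) (H : ι → ι → ℝ) (u v : ι → ℝ) {T : ι → ι → ι → ℝ}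
    (hT : ∀ k i j, T k i j =
      G k i j + (if k = i then v j else 0) + (if k = j then v i else 0) - H i j * u k)
    (hG : ∀ k i j, G k i j = G k j i) (hH : ∀ i j, H i j = H j i)
    (hu : ∀ i, ∑ k, H i k * u k = v i) (i j : ι) :
    ∑ k, ∑ l, (T k k l * T l i j - T k j l * T l i k) =
      ∑ k, ∑ l, (G k k l * G l i j - G k j l * G l i k) +
      ((Fintype.card ι : ℝ) - 2) * (∑ l, G l i j * v l + v i * v j - H i j * ∑ k, u k * v k)
      - H i j * ∑ l, (∑ k, G k k l) * u l
      + ∑ k, u k * ∑ m, H j m * G m k i + ∑ k, u k * ∑ m, H i m * G m k j := by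
  have hu' : ∀ i, ∑ k, u k * H i k = v i := fun i => by simp only [mul_comm (u _), hu]
  have trace : ∀ l, ∑ k, T k k l = ∑ k, G k k l + Fintype.card ι * v l := by
    intro l
    simp only [hT, Finset.sum_add_distrib, Finset.sum_sub_distrib]
    simp only [hH _ l, hu]
    simp
  have first : ∑ k, ∑ l, T k k l * T l i j =
      ∑ k, ∑ l, G k k l * G l i j + Fintype.card ι * ∑ l, G l i j * v l
      + 2 * Fintype.card ι * (v i * v j) - H i j * Fintype.card ι * ∑ k, u k * v k
      + (∑ k, G k k i) * v j + (∑ k, G k k j) * v i - H i j * ∑ l, (∑ k, G k k l) * u l := by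
    rw [Finset.sum_comm]
    rw [Finset.sum_comm (f := fun k l => G k k l * G l i j)]
    simp only [← Finset.sum_mul, trace]
    simp only [hT, mul_add, mul_sub, add_mul, Finset.sum_add_distrib, Finset.sum_sub_distrib,
      mul_ite, mul_zero, Finset.sum_ite_eq', Finset.mem_univ, if_true, Finset.mul_sum]
    have e1 : ∀ l, (Fintype.card ι : ℝ) * v l * G l i j = Fintype.card ι * (G l i j * v l) :=
      fun l => by ring
    have e2 : ∀ l, (Fintype.card ι : ℝ) * v l * (H i j * u l)
      = H i j * Fintype.card ι * (u l * v l) := fun l => by ring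
    have e3 : ∀ l, (∑ k, G k k l) * (H i j * u l) = H i j * ((∑ k, G k k l) * u l) :=
      fun l => by ring
    simp only [e1, e2, e3]
    ring
  have stepA : ∀ X : ι → ι → ℝ, ∑ k, ∑ l, X k l * T l i k = ∑ k, ∑ l, X k l * G l i k
      + ∑ k, X k i * v k + (∑ k, X k k) * v i - ∑ l, (∑ k, H i k * X k l) * u l := by
    intro X
    have e : ∀ k, ∑ l, X k l * T l i k
        = ∑ l, X k l * G l i k + X k i * v k + X k k * v i - ∑ l, H i k * X k l * u l := by
      intro k
      simp only [hT, mul_add, mul_sub, Finset.sum_add_distrib, Finset.sum_sub_distrib, mul_ite,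
        mul_zero, Finset.sum_ite_eq', Finset.mem_univ, if_true]
      congr 1
      exact Finset.sum_congr rfl fun l _ => by ring
    simp only [e, Finset.sum_add_distrib, Finset.sum_sub_distrib, Finset.sum_mul]
    congr 1
    exact Finset.sum_comm
  have b1 : ∑ k, ∑ l, T k j l * G l i k = ∑ k, ∑ l, G k j l * G l i k + ∑ l, G l i j * v l
      + (∑ k, G k k i) * v j - ∑ k, u k * ∑ m, H j m * G m k i := by
    have e : ∀ k, ∑ l, T k j l * G l i k = ∑ l, G k j l * G l i k
        + (if k = j then ∑ l, G l i j * v l else 0) + G k k i * v j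
        - u k * ∑ m, H j m * G m k i := by
      intro k
      simp only [hT, add_mul, sub_mul, Finset.sum_add_distrib, Finset.sum_sub_distrib, ite_mul,
        zero_mul, Finset.sum_ite_eq, Finset.mem_univ, if_true]
      congr 1
      · congr 1
        · congr 1
          split_ifs with hk
          · subst hk
            exact Finset.sum_congr rfl fun l _ => mul_comm _ _
          · simp
        · rw [hG k i k, mul_comm]
      · rw [Finset.mul_sum]
        exact Finset.sum_congr rfl fun l _ => by rw [hG l i k]; ring
    simp only [e, Finset.sum_add_distrib, Finset.sum_sub_distrib, Finset.sum_mul,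
      Finset.sum_ite_eq', Finset.mem_univ, if_true]
  have b2 : ∑ k, T k j i * v k = ∑ l, G l i j * v l + 2 * (v i * v j)
      - H i j * ∑ k, u k * v k := by
    simp only [hT, add_mul, sub_mul, Finset.sum_add_distrib, Finset.sum_sub_distrib, ite_mul,
        zero_mul, Finset.sum_ite_eq', Finset.mem_univ, if_true, Finset.mul_sum, hG _ j i, hH j i,
        mul_assoc]
    ring
  have b3 : ∑ k, T k j k = ∑ k, G k k j + Fintype.card ι * v j := by
    simp only [hT, Finset.sum_add_distrib, Finset.sum_sub_distrib, hu]
    simp only [hG _ j]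
    simp
    ring
  have b4 : ∑ l, (∑ k, H i k * T k j l) * u l = ∑ k, u k * ∑ m, H i m * G m k j
      + H i j * ∑ k, u k * v k := by
    have e : ∀ l, (∑ k, H i k * T k j l) * u l = u l * ∑ m, H i m * G m l j
        + H i j * (u l * v l) + H i l * u l * v j - v i * (H j l * u l) := by
      intro l
      have : ∑ k, H i k * T k j l = ∑ m, H i m * G m l j + H i j * v l + H i l * v j
          - (∑ k, H i k * u k) * H j l := by
        simp only [hT, mul_add, mul_sub, Finset.sum_add_distrib, Finset.sum_sub_distrib, mul_ite,
          mul_zero, Finset.sum_ite_eq', Finset.mem_univ, if_true, Finset.sum_mul, hG _ j l]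
        congr 1
        exact Finset.sum_congr rfl fun k _ => by ring
      rw [this, hu]; ring
    simp only [e, Finset.sum_add_distrib, Finset.sum_sub_distrib, ← Finset.mul_sum,
      ← Finset.sum_mul, hu]
    ring
  simp only [Finset.sum_sub_distrib, first, stepA, b1, b2, b3, b4]
  ring

variable (hh : IsMetricOn U h) (hU : IsOpen U) (hw : ContDiffOn ℝ ∞ w U) (hx : x ∈ U)
include hh hU hw

omit hU in
lemma isMetricOn_conformal : IsMetricOn U (conformal w h) where
  smooth i j := by
    simp only [conformal, Matrix.smul_apply, smul_eq_mul]
    exact ((contDiffOn_const.mul hw).exp).mul (hh.smooth i j)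
  symm z hz := by
    simp only [conformal]
    exact (hh.symm z hz).smul _
  nondeg z hz := by
    simp only [conformal, Matrix.det_smul]
    exact mul_ne_zero (pow_ne_zero _ (Real.exp_pos _).ne') (hh.nondeg z hz)

omit hU hw in
lemma conformal_inv {z : ι → ℝ} (hz : z ∈ U) (i j : ι) :
    (conformal w h z)⁻¹ i j = Real.exp (-2 * w z) * (h z)⁻¹ i j := by
  rw [conformal, inv_smul_of_ne (Real.exp_pos _).ne' (hh.nondeg z hz), ← Real.exp_neg]
  simp

include hx

lemma christoffel_conformal (k i j : ι) : christoffel (conformal w h) k i j x =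
    christoffel h k i j x + (if k = i then pd j w x else 0) + (if k = j then pd i w x else 0)
      - h x i j * gradUp h w k x := by
  have hwd : DifferentiableAt ℝ w x := differentiableAt_of_smooth hU hw hx
  have hd : ∀ a b, DifferentiableAt ℝ (fun z => h z a b) x := fun a b =>
    differentiableAt_of_smooth hU (hh.smooth a b) hx
  have e : ∀ a b c, pd a (fun z => conformal w h z b c) x
      = Real.exp (2 * w x) * (2 * pd a w x * h x b c + pd a (fun z => h z b c) x) := by
    intro a b c
    simp only [conformal, Matrix.smul_apply, smul_eq_mul]
    rw [pd_mul _ (by fun_prop) (hd b c), pd_exp _ (by fun_prop), pd_const_mul]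
    ring
  have hexp : Real.exp (-2 * w x) * Real.exp (2 * w x) = 1 := by
    rw [← Real.exp_add]; simp
  have hsum : ∀ l, (conformal w h x)⁻¹ k l * (pd i (fun z => conformal w h z j l) x
        + pd j (fun z => conformal w h z i l) x - pd l (fun z => conformal w h z i j) x)
      = (h x)⁻¹ k l * (pd i (fun z => h z j l) x + pd j (fun z => h z i l) x
          - pd l (fun z => h z i j) x)
        + 2 * ((h x)⁻¹ k l * h x l j) * pd i w x + 2 * ((h x)⁻¹ k l * h x l i) * pd j w x
        - 2 * (h x i j * ((h x)⁻¹ k l * pd l w x)) := by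
    intro l
    rw [conformal_inv hh hx, e, e, e, hh.entry_symm hx l j, hh.entry_symm hx l i]
    linear_combination ((h x)⁻¹ k l * (2 * pd i w x * h x j l + pd i (fun z => h z j l) x
      + (2 * pd j w x * h x i l + pd j (fun z => h z i l) x)
      - (2 * pd l w x * h x i j + pd l (fun z => h z i j) x))) * hexp
  simp only [christoffel, hsum, Finset.sum_add_distrib, Finset.sum_sub_distrib,
    ← Finset.sum_mul, ← Finset.mul_sum, hh.inv_mul_entry hx, gradUp]
  split_ifs <;> ring

lemma hess_conformal (f : (ι → ℝ) → ℝ) (i j : ι) : hess (conformal w h) f i j x =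
    hess h f i j x - (pd i w x * pd j f x + pd j w x * pd i f x)
      + h x i j * gradInner h w f x := by
  have e : ∑ k, gradUp h w k x * pd k f x = gradInner h w f x := by
    simp only [gradUp, gradInner, Finset.sum_mul]
    rw [Finset.sum_comm]
    refine Finset.sum_congr rfl fun i _ => Finset.sum_congr rfl fun j _ => ?_
    rw [hh.inv_symm hx j i]; ring
  simp only [hess, christoffel_conformal hh hU hw hx, add_mul, sub_mul, Finset.sum_add_distrib,
    Finset.sum_sub_distrib, ite_mul, zero_mul, Finset.sum_ite_eq', Finset.mem_univ, if_true,
    mul_assoc, ← Finset.mul_sum, e]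
  ring

omit hU hw in
lemma gradInner_conformal (f f' : (ι → ℝ) → ℝ) : gradInner (conformal w h) f f' x =
    Real.exp (-2 * w x) * gradInner h f f' x := by
  simp only [gradInner, conformal_inv hh hx, Finset.mul_sum, mul_assoc]

lemma box_conformal (f : (ι → ℝ) → ℝ) : box (conformal w h) f x =
    Real.exp (-2 * w x) *
      (box h f x + ((Fintype.card ι : ℝ) - 2) * gradInner h w f x) := by
  have e1 : ∑ i, ∑ j, (h x)⁻¹ i j * h x i j = Fintype.card ι := by
    have : ∀ i, ∑ j, (h x)⁻¹ i j * h x i j = 1 := fun i => by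
      rw [← (if_pos rfl : (if i = i then (1 : ℝ) else 0) = 1), ← hh.inv_mul_entry hx i i]
      exact Finset.sum_congr rfl fun j _ => by rw [hh.entry_symm hx i j]
    simp [this]
  have e2 : ∑ i, ∑ j, (h x)⁻¹ i j * (pd j w x * pd i f x) = gradInner h w f x := by
    rw [gradInner, Finset.sum_comm]
    refine Finset.sum_congr rfl fun i _ => Finset.sum_congr rfl fun j _ => ?_
    rw [hh.inv_symm hx j i]
  have e3 : ∑ i, ∑ j, (h x)⁻¹ i j * (pd i w x * pd j f x) = gradInner h w f x := rfl
  have e : ∀ i j, (conformal w h x)⁻¹ i j * hess (conformal w h) f i j x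
      = Real.exp (-2 * w x) * ((h x)⁻¹ i j * hess h f i j x
        - (h x)⁻¹ i j * (pd i w x * pd j f x) - (h x)⁻¹ i j * (pd j w x * pd i f x)
        + (h x)⁻¹ i j * h x i j * gradInner h w f x) := by
    intro i j
    rw [hess_conformal hh hU hw hx, conformal_inv hh hx]; ring
  simp only [box, e, ← Finset.mul_sum, Finset.sum_add_distrib, Finset.sum_sub_distrib,
    ← Finset.sum_mul, e1, e2, e3]
  ring

lemma ricci_conformal (i j : ι) : ricci (conformal w h) i j x =
    ricci h i j x - ((Fintype.card ι : ℝ) - 2) * (hess h w i j x - pd i w x * pd j w x)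
      - h x i j * (box h w x + ((Fintype.card ι : ℝ) - 2) * gradInner h w w x) := by
  have hUx := hU.mem_nhds hx
  have hmem : ∀ᶠ z in 𝓝 x, z ∈ U := hUx
  have hdv : ∀ a, DifferentiableAt ℝ (pd a w) x := fun a =>
    differentiableAt_of_smooth hU (contDiffOn_pd hU hw a) hx
  have hdu : ∀ a, DifferentiableAt ℝ (gradUp h w a) x := fun a =>
    differentiableAt_of_smooth hU (hh.smooth_gradUp hU hw a) hx
  have hd : ∀ a b, DifferentiableAt ℝ (fun z => h z a b) x := fun a b =>
    differentiableAt_of_smooth hU (hh.smooth a b) hx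
  have hdG : ∀ a b c, DifferentiableAt ℝ (christoffel h a b c) x := fun a b c =>
    differentiableAt_of_smooth hU (hh.smooth_christoffel hU a b c) hx
  have hdT : ∀ a b c, DifferentiableAt ℝ (christoffel (conformal w h) a b c) x := fun a b c =>
    differentiableAt_of_smooth hU
      ((isMetricOn_conformal hh hw).smooth_christoffel hU a b c) hx
  have hdite : ∀ (p : Prop) [Decidable p] (a : ι),
      DifferentiableAt ℝ (fun z => if p then pd a w z else 0) x := by
    intro p _ a; split_ifs <;> simp [hdv]
  have hdiv : ∑ k, pd k (christoffel (conformal w h) k i j) x =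
      ∑ k, pd k (christoffel h k i j) x + 2 * pd j (pd i w) x
      - ∑ k, pd k (fun z => h z i j) x * gradUp h w k x
      - h x i j * ∑ k, pd k (gradUp h w k) x := by
    have e : ∀ k, pd k (christoffel (conformal w h) k i j) x = pd k (christoffel h k i j) x
        + (if k = i then pd k (pd j w) x else 0) + (if k = j then pd k (pd i w) x else 0)
        - pd k (fun z => h z i j) x * gradUp h w k x - h x i j * pd k (gradUp h w k) x := by
      intro k
      rw [pd_congr (hmem.mono fun z hz => christoffel_conformal hh hU hw hz k i j) k,
        pd_sub _ (((hdG _ _ _).fun_add (hdite _ _)).fun_add (hdite _ _)) ((hd _ _).fun_mul (hdu _)),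
        pd_add _ ((hdG _ _ _).fun_add (hdite _ _)) (hdite _ _), pd_add _ (hdG _ _ _) (hdite _ _),
        pd_mul _ (hd _ _) (hdu _), pd_ite, pd_ite]
      ring
    simp only [e, Finset.sum_add_distrib, Finset.sum_sub_distrib, ← Finset.mul_sum,
      Finset.sum_ite_eq', Finset.mem_univ, if_true]
    rw [pd_comm hU hw hx i j]; ring
  have htr : ∑ k, pd j (christoffel (conformal w h) k i k) x =
      ∑ k, pd j (christoffel h k i k) x + Fintype.card ι * pd j (pd i w) x := by
    rw [← pd_sum _ _ fun k _ => hdT k i k, ← pd_sum _ _ fun k _ => hdG k i k, ← pd_const_mul,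
      ← pd_add _ (DifferentiableAt.fun_sum fun k _ => hdG k i k) ((hdv i).const_mul _)]
    refine pd_congr (hmem.mono fun z hz => ?_) j
    simp only [christoffel_conformal hh hU hw hz, Finset.sum_add_distrib, Finset.sum_sub_distrib,
      hh.lower_gradUp hz]
    simp
    ring
  have hq := conformal_quadratic (fun k i j => christoffel h k i j x) (fun i j => h x i j)
    (fun k => gradUp h w k x) (fun k => pd k w x)
    (christoffel_conformal hh hU hw hx) (hh.christoffel_symm hU hx) (hh.entry_symm hx)
    (hh.lower_gradUp hx w) i j
  have hgi : ∑ k, gradUp h w k x * pd k w x = gradInner h w w x := by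
    simp only [gradUp, gradInner, Finset.sum_mul]
    refine Finset.sum_congr rfl fun i _ => Finset.sum_congr rfl fun j _ => by ring
  have hmet : ∑ k, pd k (fun z => h z i j) x * gradUp h w k x =
      ∑ k, gradUp h w k x * ∑ m, h x j m * christoffel h m k i x
      + ∑ k, gradUp h w k x * ∑ m, h x i m * christoffel h m k j x := by
    simp only [hh.pd_metric hU hx, add_mul, Finset.sum_add_distrib, mul_comm (gradUp _ _ _ _)]
  simp only [ricci, Finset.sum_sub_distrib] at hq ⊢
  simp only [hgi] at hq
  rw [hdiv, htr, hmet, hh.div_gradUp hU hx hw, hess, pd_comm hU hw hx i j]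
  linear_combination hq

end Conformal

/-! ### Block-diagonal metrics -/

section Block

variable {n : ℕ}

@[simp] lemma orthMatrix_zero_zero (A : ℝ) (H : Matrix (Fin n) (Fin n) ℝ) :
    orthMatrix A H 0 0 = A := rfl

@[simp] lemma orthMatrix_zero_succ (A : ℝ) (H : Matrix (Fin n) (Fin n) ℝ) (j : Fin n) :
    orthMatrix A H 0 j.succ = 0 := rfl

@[simp] lemma orthMatrix_succ_zero (A : ℝ) (H : Matrix (Fin n) (Fin n) ℝ) (i : Fin n) :
    orthMatrix A H i.succ 0 = 0 := rfl

@[simp] lemma orthMatrix_succ_succ (A : ℝ) (H : Matrix (Fin n) (Fin n) ℝ) (i j : Fin n) :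
    orthMatrix A H i.succ j.succ = H i j := rfl

lemma orthMatrix_mul_inv {A : ℝ} {H : Matrix (Fin n) (Fin n) ℝ} (hA : A ≠ 0) (hH : H.det ≠ 0) :
    orthMatrix A H * orthMatrix A⁻¹ H⁻¹ = 1 := by
  have e := Matrix.mul_nonsing_inv H hH.isUnit
  ext i j
  rw [Matrix.mul_apply, Fin.sum_univ_succ]
  refine Fin.cases ?_ (fun i => ?_) i <;> refine Fin.cases ?_ (fun j => ?_) j
  · simp [hA]
  · simp [(Fin.succ_ne_zero j).symm]
  · simp [Fin.succ_ne_zero]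
  · have := congrFun (congrFun e i) j
    rw [Matrix.mul_apply] at this
    simp [this, Matrix.one_apply]

lemma orthMatrix_inv {A : ℝ} {H : Matrix (Fin n) (Fin n) ℝ} (hA : A ≠ 0) (hH : H.det ≠ 0) :
    (orthMatrix A H)⁻¹ = orthMatrix A⁻¹ H⁻¹ :=
  Matrix.inv_eq_right_inv (orthMatrix_mul_inv hA hH)

lemma isOpen_slab {I : Set ℝ} {U : Set (Fin n → ℝ)} (hI : IsOpen I) (hU : IsOpen U) :
    IsOpen (slab I U) := by
  refine (hI.preimage (continuous_apply 0)).inter (hU.preimage ?_)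
  exact continuous_pi fun i => continuous_apply i.succ

/-- The projection `(y, x) ↦ x` as a continuous linear map. -/
def tailL (n : ℕ) : (Fin (n + 1) → ℝ) →L[ℝ] (Fin n → ℝ) :=
  ContinuousLinearMap.pi fun i => ContinuousLinearMap.proj i.succ

lemma tailL_apply (p : Fin (n + 1) → ℝ) : tailL n p = Fin.tail p := rfl

lemma contDiffOn_comp_tail {I : Set ℝ} {U : Set (Fin n → ℝ)} {w : (Fin n → ℝ) → ℝ}
    (hw : ContDiffOn ℝ ∞ w U) : ContDiffOn ℝ ∞ (fun p => w (Fin.tail p)) (slab I U) :=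
  hw.comp (tailL n).contDiff.contDiffOn fun _ hp => hp.2

lemma contDiffOn_comp_zero {I : Set ℝ} {U : Set (Fin n → ℝ)} {u : ℝ → ℝ}
    (hu : ContDiffOn ℝ ∞ u I) :
    ContDiffOn ℝ ∞ (fun p : Fin (n + 1) → ℝ => u (p 0)) (slab I U) :=
  hu.comp (contDiff_apply ℝ ℝ (0 : Fin (n + 1))).contDiffOn fun _ hp => hp.1

section Separated

variable {u : ℝ → ℝ} {w : (Fin n → ℝ) → ℝ} {p : Fin (n + 1) → ℝ}

lemma hasFDerivAt_comp_zero (hu : DifferentiableAt ℝ u (p 0)) :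
    HasFDerivAt (fun q : Fin (n + 1) → ℝ => u (q 0))
      (deriv u (p 0) • (ContinuousLinearMap.proj 0 : (Fin (n + 1) → ℝ) →L[ℝ] ℝ)) p :=
  hu.hasDerivAt.comp_hasFDerivAt (f := fun q : Fin (n + 1) → ℝ => q 0) p
    (ContinuousLinearMap.proj (R := ℝ) (φ := fun _ : Fin (n + 1) => ℝ) 0).hasFDerivAt

lemma hasFDerivAt_comp_tail (hw : DifferentiableAt ℝ w (Fin.tail p)) :
    HasFDerivAt (fun q : Fin (n + 1) → ℝ => w (Fin.tail q))
      ((fderiv ℝ w (Fin.tail p)).comp (tailL n)) p :=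
  HasFDerivAt.comp (g := w) (f := tailL n) p hw.hasFDerivAt (tailL n).hasFDerivAt

lemma tail_single_zero : Fin.tail (Pi.single (0 : Fin (n + 1)) (1 : ℝ) : Fin (n + 1) → ℝ) = 0 := by
  ext i; simp [Fin.tail]

lemma tail_single_succ (i : Fin n) :
    Fin.tail (Pi.single (i.succ : Fin (n + 1)) (1 : ℝ) : Fin (n + 1) → ℝ) = Pi.single i 1 := by
  ext j; simp [Fin.tail, Pi.single_apply]

lemma pd_zero_comp_zero (hu : DifferentiableAt ℝ u (p 0)) :
    pd 0 (fun q : Fin (n + 1) → ℝ => u (q 0)) p = deriv u (p 0) := by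
  simp [pd, (hasFDerivAt_comp_zero hu).fderiv]

lemma pd_succ_comp_zero (hu : DifferentiableAt ℝ u (p 0)) (i : Fin n) :
    pd i.succ (fun q : Fin (n + 1) → ℝ => u (q 0)) p = 0 := by
  simp [pd, (hasFDerivAt_comp_zero hu).fderiv]

lemma pd_zero_comp_tail (hw : DifferentiableAt ℝ w (Fin.tail p)) :
    pd 0 (fun q : Fin (n + 1) → ℝ => w (Fin.tail q)) p = 0 := by
  simp [pd, (hasFDerivAt_comp_tail hw).fderiv, tailL_apply, tail_single_zero]

lemma pd_succ_comp_tail (hw : DifferentiableAt ℝ w (Fin.tail p)) (i : Fin n) :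
    pd i.succ (fun q : Fin (n + 1) → ℝ => w (Fin.tail q)) p = pd i w (Fin.tail p) := by
  simp [pd, (hasFDerivAt_comp_tail hw).fderiv, tailL_apply, tail_single_succ]

lemma pd_zero_separated (hu : DifferentiableAt ℝ u (p 0))
    (hw : DifferentiableAt ℝ w (Fin.tail p)) :
    pd 0 (fun q : Fin (n + 1) → ℝ => u (q 0) * w (Fin.tail q)) p
      = deriv u (p 0) * w (Fin.tail p) := by
  rw [pd_mul _ (hasFDerivAt_comp_zero hu).differentiableAt
    (hasFDerivAt_comp_tail hw).differentiableAt, pd_zero_comp_zero hu, pd_zero_comp_tail hw]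
  ring

lemma pd_succ_separated (hu : DifferentiableAt ℝ u (p 0))
    (hw : DifferentiableAt ℝ w (Fin.tail p)) (i : Fin n) :
    pd i.succ (fun q : Fin (n + 1) → ℝ => u (q 0) * w (Fin.tail q)) p
      = u (p 0) * pd i w (Fin.tail p) := by
  rw [pd_mul _ (hasFDerivAt_comp_zero hu).differentiableAt
    (hasFDerivAt_comp_tail hw).differentiableAt, pd_succ_comp_zero hu, pd_succ_comp_tail hw]
  ring

end Separated

end Block

lemma differentiableAt_of_smooth_real {I : Set ℝ} {u : ℝ → ℝ} {y : ℝ} (hI : IsOpen I)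
    (hu : ContDiffOn ℝ ∞ u I) (hy : y ∈ I) : DifferentiableAt ℝ u y :=
  (hu.contDiffAt (hI.mem_nhds hy)).differentiableAt (by simp)

lemma contDiffOn_deriv {I : Set ℝ} {u : ℝ → ℝ} (hI : IsOpen I) (hu : ContDiffOn ℝ ∞ u I) :
    ContDiffOn ℝ ∞ (deriv u) I :=
  hu.deriv_of_isOpen hI (by simp)

/-! ### Curvature of a warped metric -/

section Warped

variable {n : ℕ}

/-- The metric `ε e^{2(F(x) + P(y))} dy² + e^{2R(y)} Hᵢⱼ(x) dxⁱ dxʲ`. -/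
noncomputable def warped (ε : ℝ) (F : (Fin n → ℝ) → ℝ) (H : (Fin n → ℝ) → Matrix (Fin n) (Fin n) ℝ)
    (P R : ℝ → ℝ) (p : Fin (n + 1) → ℝ) : Matrix (Fin (n + 1)) (Fin (n + 1)) ℝ :=
  orthMatrix (ε * Real.exp (2 * (F (Fin.tail p) + P (p 0))))
    (Real.exp (2 * R (p 0)) • H (Fin.tail p))

/-- Smoothness and sign assumptions on the ingredients of `warped ε F H P R` over `I × U`. -/
structure IsWarpData (ε : ℝ) (I : Set ℝ) (U : Set (Fin n → ℝ)) (F : (Fin n → ℝ) → ℝ)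
    (H : (Fin n → ℝ) → Matrix (Fin n) (Fin n) ℝ) (P R : ℝ → ℝ) : Prop where
  sign : ε * ε = 1
  isOpen_base : IsOpen I
  isOpen : IsOpen U
  lapse : ContDiffOn ℝ ∞ F U
  metric : IsMetricOn U H
  smooth_left : ContDiffOn ℝ ∞ P I
  smooth_right : ContDiffOn ℝ ∞ R I

namespace IsWarpData

variable {ε : ℝ} {I : Set ℝ} {U : Set (Fin n → ℝ)} {F f : (Fin n → ℝ) → ℝ}
  {H : (Fin n → ℝ) → Matrix (Fin n) (Fin n) ℝ} {P R u : ℝ → ℝ} {p : Fin (n + 1) → ℝ}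
  (D : IsWarpData ε I U F H P R)
include D

lemma sign_ne : ε ≠ 0 := fun h0 => by simpa [h0] using D.sign

lemma sign_inv : ε⁻¹ = ε := inv_eq_of_mul_eq_one_left D.sign

lemma det_ne (y : ℝ) {x : Fin n → ℝ} (hx : x ∈ U) : (Real.exp (2 * R y) • H x).det ≠ 0 := by
  rw [Matrix.det_smul]
  exact mul_ne_zero (pow_ne_zero _ (Real.exp_pos _).ne') (D.metric.nondeg x hx)

lemma lapse_ne (p : Fin (n + 1) → ℝ) :
    ε * Real.exp (2 * (F (Fin.tail p) + P (p 0))) ≠ 0 :=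
  mul_ne_zero D.sign_ne (Real.exp_pos _).ne'

lemma inv_eq (hp : p ∈ slab I U) : (warped ε F H P R p)⁻¹ =
    orthMatrix (ε * Real.exp (-2 * (F (Fin.tail p) + P (p 0))))
      (Real.exp (-2 * R (p 0)) • (H (Fin.tail p))⁻¹) := by
  rw [warped, orthMatrix_inv (D.lapse_ne p) (D.det_ne _ hp.2),
    inv_smul_of_ne (Real.exp_pos _).ne' (D.metric.nondeg _ hp.2), mul_inv, D.sign_inv,
    ← Real.exp_neg, ← Real.exp_neg]
  simp only [neg_mul]

lemma isMetricOn : IsMetricOn (slab I U) (warped ε F H P R) where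
  smooth i j := by
    refine Fin.cases ?_ (fun i => ?_) i <;> refine Fin.cases ?_ (fun j => ?_) j <;>
      simp only [warped, orthMatrix_zero_zero, orthMatrix_zero_succ, orthMatrix_succ_zero,
        orthMatrix_succ_succ, Matrix.smul_apply, smul_eq_mul]
    · exact contDiffOn_const.mul (contDiffOn_const.mul
        ((contDiffOn_comp_tail D.lapse).add (contDiffOn_comp_zero D.smooth_left))).exp
    · exact contDiffOn_const
    · exact contDiffOn_const
    · exact (contDiffOn_const.mul (contDiffOn_comp_zero D.smooth_right)).exp.mul
        (contDiffOn_comp_tail (D.metric.smooth i j))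
  symm p hp := by
    refine Matrix.IsSymm.ext fun i j => ?_
    refine Fin.cases ?_ (fun i => ?_) i <;> refine Fin.cases ?_ (fun j => ?_) j
    · rfl
    · rfl
    · rfl
    · simp only [warped, orthMatrix_succ_succ, Matrix.smul_apply, smul_eq_mul,
        D.metric.entry_symm hp.2 i j]
  nondeg p hp := (Matrix.isUnit_det_of_right_inverse
    (orthMatrix_mul_inv (D.lapse_ne p) (D.det_ne _ hp.2))).ne_zero

lemma isOpen_slab : IsOpen (slab I U) := EinsteinScalar.isOpen_slab D.isOpen_base D.isOpen

lemma differentiableAt_left (hp : p ∈ slab I U) : DifferentiableAt ℝ P (p 0) :=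
  differentiableAt_of_smooth_real D.isOpen_base D.smooth_left hp.1

lemma differentiableAt_right (hp : p ∈ slab I U) : DifferentiableAt ℝ R (p 0) :=
  differentiableAt_of_smooth_real D.isOpen_base D.smooth_right hp.1

lemma differentiableAt_deriv_left (hp : p ∈ slab I U) : DifferentiableAt ℝ (deriv P) (p 0) :=
  differentiableAt_of_smooth_real D.isOpen_base (contDiffOn_deriv D.isOpen_base D.smooth_left) hp.1

lemma differentiableAt_deriv_right (hp : p ∈ slab I U) : DifferentiableAt ℝ (deriv R) (p 0) :=
  differentiableAt_of_smooth_real D.isOpen_base (contDiffOn_deriv D.isOpen_base D.smooth_right) hp.1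

lemma differentiableAt_lapse (hp : p ∈ slab I U) : DifferentiableAt ℝ F (Fin.tail p) :=
  differentiableAt_of_smooth D.isOpen D.lapse hp.2

lemma differentiableAt_pd_lapse (hp : p ∈ slab I U) (i : Fin n) :
    DifferentiableAt ℝ (pd i F) (Fin.tail p) :=
  differentiableAt_of_smooth D.isOpen (contDiffOn_pd D.isOpen D.lapse i) hp.2

lemma differentiableAt_metric (hp : p ∈ slab I U) (i j : Fin n) :
    DifferentiableAt ℝ (fun z => H z i j) (Fin.tail p) :=
  differentiableAt_of_smooth D.isOpen (D.metric.smooth i j) hp.2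

lemma pd_zero_entry_zero (hp : p ∈ slab I U) :
    pd 0 (fun q => warped ε F H P R q 0 0) p = 2 * deriv P (p 0) * warped ε F H P R p 0 0 := by
  have hP := D.differentiableAt_left hp
  have hF := D.differentiableAt_lapse hp
  simp only [warped, orthMatrix_zero_zero]
  have e : ∀ q : Fin (n + 1) → ℝ, ε * Real.exp (2 * (F (Fin.tail q) + P (q 0)))
      = Real.exp (2 * P (q 0)) * (ε * Real.exp (2 * F (Fin.tail q))) := fun q => by
    rw [mul_add, Real.exp_add]; ring
  simp only [e]
  rw [pd_zero_separated (u := fun y => Real.exp (2 * P y))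
    (w := fun x => ε * Real.exp (2 * F x)) (by fun_prop) (by fun_prop),
    (hP.hasDerivAt.const_mul 2).exp.deriv]
  ring

lemma pd_succ_entry_zero (hp : p ∈ slab I U) (i : Fin n) :
    pd i.succ (fun q => warped ε F H P R q 0 0) p
      = 2 * pd i F (Fin.tail p) * warped ε F H P R p 0 0 := by
  have hP := D.differentiableAt_left hp
  have hF := D.differentiableAt_lapse hp
  simp only [warped, orthMatrix_zero_zero]
  have e : ∀ q : Fin (n + 1) → ℝ, ε * Real.exp (2 * (F (Fin.tail q) + P (q 0)))
      = (ε * Real.exp (2 * P (q 0))) * Real.exp (2 * F (Fin.tail q)) := fun q => by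
    rw [mul_add, Real.exp_add]; ring
  simp only [e]
  rw [pd_succ_separated (u := fun y => ε * Real.exp (2 * P y))
    (w := fun x => Real.exp (2 * F x)) (by fun_prop) (by fun_prop),
    pd_exp _ (by fun_prop), pd_const_mul]
  ring

lemma pd_zero_entry_succ (hp : p ∈ slab I U) (i j : Fin n) :
    pd 0 (fun q => warped ε F H P R q i.succ j.succ) p
      = 2 * deriv R (p 0) * Real.exp (2 * R (p 0)) * H (Fin.tail p) i j := by
  have hR := D.differentiableAt_right hp
  simp only [warped, orthMatrix_succ_succ, Matrix.smul_apply, smul_eq_mul]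
  rw [pd_zero_separated (u := fun y => Real.exp (2 * R y))
    (w := fun x => H x i j) (by fun_prop) (D.differentiableAt_metric hp i j),
    (hR.hasDerivAt.const_mul 2).exp.deriv]
  ring

lemma pd_succ_entry_succ (hp : p ∈ slab I U) (k i j : Fin n) :
    pd k.succ (fun q => warped ε F H P R q i.succ j.succ) p
      = Real.exp (2 * R (p 0)) * pd k (fun z => H z i j) (Fin.tail p) := by
  have hR := D.differentiableAt_right hp
  simp only [warped, orthMatrix_succ_succ, Matrix.smul_apply, smul_eq_mul]
  rw [pd_succ_separated (u := fun y => Real.exp (2 * R y))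
    (w := fun x => H x i j) (by fun_prop) (D.differentiableAt_metric hp i j)]

omit D in
lemma pd_entry_zero_succ (k : Fin (n + 1)) (j : Fin n) :
    pd k (fun q => warped ε F H P R q 0 j.succ) p = 0 := by
  simp [warped]

omit D in
lemma pd_entry_succ_zero (k : Fin (n + 1)) (j : Fin n) :
    pd k (fun q => warped ε F H P R q j.succ 0) p = 0 := by
  simp [warped]

lemma inv_zero_mul (hp : p ∈ slab I U) :
    (warped ε F H P R p)⁻¹ 0 0 * warped ε F H P R p 0 0 = 1 := by
  rw [D.inv_eq hp, warped, orthMatrix_zero_zero, orthMatrix_zero_zero,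
    mul_mul_mul_comm, D.sign, ← Real.exp_add]
  simp

lemma inv_zero_zero (hp : p ∈ slab I U) : (warped ε F H P R p)⁻¹ 0 0 =
    ε * Real.exp (-2 * (F (Fin.tail p) + P (p 0))) := by
  rw [D.inv_eq hp, orthMatrix_zero_zero]

lemma inv_zero_succ (hp : p ∈ slab I U) (i : Fin n) :
    (warped ε F H P R p)⁻¹ 0 i.succ = 0 := by
  rw [D.inv_eq hp, orthMatrix_zero_succ]

lemma inv_succ_zero (hp : p ∈ slab I U) (i : Fin n) :
    (warped ε F H P R p)⁻¹ i.succ 0 = 0 := by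
  rw [D.inv_eq hp, orthMatrix_succ_zero]

lemma inv_succ_succ (hp : p ∈ slab I U) (i j : Fin n) :
    (warped ε F H P R p)⁻¹ i.succ j.succ
      = Real.exp (-2 * R (p 0)) * (H (Fin.tail p))⁻¹ i j := by
  rw [D.inv_eq hp, orthMatrix_succ_succ, Matrix.smul_apply, smul_eq_mul]

lemma christoffel_zero_zero_zero (hp : p ∈ slab I U) :
    christoffel (warped ε F H P R) 0 0 0 p = deriv P (p 0) := by
  rw [christoffel, Fin.sum_univ_succ]
  simp only [D.inv_zero_succ hp, zero_mul, Finset.sum_const_zero, D.pd_zero_entry_zero hp]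
  linear_combination (deriv P (p 0)) * D.inv_zero_mul hp

lemma christoffel_zero_zero_succ (hp : p ∈ slab I U) (i : Fin n) :
    christoffel (warped ε F H P R) 0 0 i.succ p = pd i F (Fin.tail p) := by
  rw [christoffel, Fin.sum_univ_succ]
  simp only [D.inv_zero_succ hp, zero_mul, Finset.sum_const_zero, D.pd_succ_entry_zero hp,
    pd_entry_succ_zero, pd_entry_zero_succ]
  linear_combination (pd i F (Fin.tail p)) * D.inv_zero_mul hp

lemma christoffel_zero_succ_succ (hp : p ∈ slab I U) (i j : Fin n) :
    christoffel (warped ε F H P R) 0 i.succ j.succ p =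
      (-ε * (deriv R (p 0) * Real.exp (2 * (R (p 0) - P (p 0))))) *
        (Real.exp (-2 * F (Fin.tail p)) * H (Fin.tail p) i j) := by
  rw [christoffel, Fin.sum_univ_succ]
  simp only [D.inv_zero_succ hp, zero_mul, Finset.sum_const_zero, D.inv_zero_zero hp,
    pd_entry_succ_zero, D.pd_zero_entry_succ hp]
  rw [show -2 * (F (Fin.tail p) + P (p 0)) = -2 * F (Fin.tail p) + -2 * P (p 0) by ring,
    show 2 * (R (p 0) - P (p 0)) = 2 * R (p 0) + -2 * P (p 0) by ring, Real.exp_add, Real.exp_add]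
  ring

lemma christoffel_succ_zero_zero (hp : p ∈ slab I U) (k : Fin n) :
    christoffel (warped ε F H P R) k.succ 0 0 p =
      (-ε * Real.exp (2 * (P (p 0) - R (p 0)))) *
        (Real.exp (2 * F (Fin.tail p)) * gradUp H F k (Fin.tail p)) := by
  rw [christoffel, Fin.sum_univ_succ]
  simp only [D.inv_succ_zero hp, zero_mul, D.inv_succ_succ hp,
    pd_entry_zero_succ, D.pd_succ_entry_zero hp, gradUp, Finset.mul_sum]
  rw [zero_add, Finset.mul_sum]
  refine Finset.sum_congr rfl fun l _ => ?_
  rw [warped, orthMatrix_zero_zero,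
    show 2 * (F (Fin.tail p) + P (p 0)) = 2 * F (Fin.tail p) + 2 * P (p 0) by ring,
    show 2 * (P (p 0) - R (p 0)) = 2 * P (p 0) + -2 * R (p 0) by ring, Real.exp_add, Real.exp_add]
  ring

omit D in
lemma exp_cancel (r : ℝ) : Real.exp (-2 * r) * Real.exp (2 * r) = 1 := by
  rw [← Real.exp_add]; simp

lemma christoffel_succ_zero_succ (hp : p ∈ slab I U) (k i : Fin n) :
    christoffel (warped ε F H P R) k.succ 0 i.succ p =
      if k = i then deriv R (p 0) else 0 := by
  rw [christoffel, Fin.sum_univ_succ]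
  simp only [D.inv_succ_zero hp, zero_mul, D.inv_succ_succ hp, pd_entry_zero_succ,
    D.pd_zero_entry_succ hp]
  have e : ∀ l, Real.exp (-2 * R (p 0)) * (H (Fin.tail p))⁻¹ k l *
      (2 * deriv R (p 0) * Real.exp (2 * R (p 0)) * H (Fin.tail p) i l + 0 - 0)
      = 2 * deriv R (p 0) * ((H (Fin.tail p))⁻¹ k l * H (Fin.tail p) l i) := by
    intro l
    rw [D.metric.entry_symm hp.2 l i]
    linear_combination (2 * deriv R (p 0) * ((H (Fin.tail p))⁻¹ k l * H (Fin.tail p) i l))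
      * exp_cancel (R (p 0))
  rw [Finset.sum_congr rfl fun l _ => e l, ← Finset.mul_sum, D.metric.inv_mul_entry hp.2]
  split_ifs <;> ring

lemma christoffel_succ_succ_succ (hp : p ∈ slab I U) (k i j : Fin n) :
    christoffel (warped ε F H P R) k.succ i.succ j.succ p = christoffel H k i j (Fin.tail p) := by
  rw [christoffel, Fin.sum_univ_succ]
  simp only [D.inv_succ_zero hp, zero_mul, D.inv_succ_succ hp, D.pd_succ_entry_succ hp, zero_add,
    christoffel]
  congr 1
  refine Finset.sum_congr rfl fun l _ => ?_
  linear_combination ((H (Fin.tail p))⁻¹ k l * (pd i (fun z => H z j l) (Fin.tail p)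
    + pd j (fun z => H z i l) (Fin.tail p) - pd l (fun z => H z i j) (Fin.tail p)))
      * exp_cancel (R (p 0))

lemma christoffel_zero_succ_zero (hp : p ∈ slab I U) (i : Fin n) :
    christoffel (warped ε F H P R) 0 i.succ 0 p = pd i F (Fin.tail p) := by
  rw [D.isMetricOn.christoffel_symm D.isOpen_slab hp, D.christoffel_zero_zero_succ hp]

lemma christoffel_succ_succ_zero (hp : p ∈ slab I U) (k i : Fin n) :
    christoffel (warped ε F H P R) k.succ i.succ 0 p =
      if k = i then deriv R (p 0) else 0 := by
  rw [D.isMetricOn.christoffel_symm D.isOpen_slab hp, D.christoffel_succ_zero_succ hp]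

/-- A contracted Christoffel symbol as the derivative of the volume density. -/
lemma trace_zero (hp : p ∈ slab I U) : ∑ k, christoffel (warped ε F H P R) k k 0 p
    = deriv P (p 0) + n * deriv R (p 0) := by
  rw [Fin.sum_univ_succ]
  simp [D.christoffel_zero_zero_zero hp, D.christoffel_succ_succ_zero hp]

lemma trace_succ (hp : p ∈ slab I U) (l : Fin n) :
    ∑ k, christoffel (warped ε F H P R) k k l.succ p
      = pd l F (Fin.tail p) + ∑ k, christoffel H k k l (Fin.tail p) := by
  rw [Fin.sum_univ_succ]
  simp [D.christoffel_zero_zero_succ hp, D.christoffel_succ_succ_succ hp]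

/-- Equalities of functions that hold on the slab may be differentiated. -/
lemma pd_eq_of_eqOn (hp : p ∈ slab I U) {f f' : (Fin (n + 1) → ℝ) → ℝ}
    (he : ∀ q ∈ slab I U, f q = f' q) (k : Fin (n + 1)) : pd k f p = pd k f' p :=
  pd_congr (Filter.eventuallyEq_of_mem (D.isOpen_slab.mem_nhds hp) he) k

lemma differentiableAt_gradUp (hp : p ∈ slab I U) (k : Fin n) :
    DifferentiableAt ℝ (gradUp H F k) (Fin.tail p) :=
  differentiableAt_of_smooth D.isOpen (D.metric.smooth_gradUp D.isOpen D.lapse k) hp.2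

lemma differentiableAt_christoffel (hp : p ∈ slab I U) (k i j : Fin n) :
    DifferentiableAt ℝ (christoffel H k i j) (Fin.tail p) :=
  differentiableAt_of_smooth D.isOpen (D.metric.smooth_christoffel D.isOpen k i j) hp.2

omit D in
lemma sum_gradUp_mul (f f' : (Fin n → ℝ) → ℝ) (x : Fin n → ℝ) :
    ∑ k, gradUp H f k x * pd k f' x = ∑ k, ∑ l, (H x)⁻¹ k l * (pd l f x * pd k f' x) := by
  simp only [gradUp, Finset.sum_mul, mul_assoc]

omit D in
lemma sum_gradUp_mul_self (f : (Fin n → ℝ) → ℝ) (x : Fin n → ℝ) :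
    ∑ k, gradUp H f k x * pd k f x = gradInner H f f x := by
  rw [sum_gradUp_mul, gradInner]
  exact Finset.sum_congr rfl fun k _ => Finset.sum_congr rfl fun l _ => by ring

/-- The index sums of the Ricci tensor, split into the `y`-direction and the `x`-directions. -/
lemma ricci_split (hp : p ∈ slab I U) (i j : Fin (n + 1)) : ricci (warped ε F H P R) i j p =
    pd 0 (christoffel (warped ε F H P R) 0 i j) p - pd j (christoffel (warped ε F H P R) 0 i 0) p
    + ∑ k : Fin n, (pd k.succ (christoffel (warped ε F H P R) k.succ i j) p
      - pd j (christoffel (warped ε F H P R) k.succ i k.succ) p)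
    + (deriv P (p 0) + n * deriv R (p 0)) * christoffel (warped ε F H P R) 0 i j p
    + ∑ l : Fin n, (pd l F (Fin.tail p) + ∑ k, christoffel H k k l (Fin.tail p)) *
        christoffel (warped ε F H P R) l.succ i j p
    - christoffel (warped ε F H P R) 0 j 0 p * christoffel (warped ε F H P R) 0 i 0 p
    - ∑ l : Fin n, christoffel (warped ε F H P R) 0 j l.succ p
        * christoffel (warped ε F H P R) l.succ i 0 p
    - ∑ k : Fin n, christoffel (warped ε F H P R) k.succ j 0 p
        * christoffel (warped ε F H P R) 0 i k.succ p
    - ∑ k : Fin n, ∑ l : Fin n, christoffel (warped ε F H P R) k.succ j l.succ p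
        * christoffel (warped ε F H P R) l.succ i k.succ p := by
  have e : ∑ k, ∑ l, christoffel (warped ε F H P R) k k l p * christoffel (warped ε F H P R) l i j p
      = (deriv P (p 0) + n * deriv R (p 0)) * christoffel (warped ε F H P R) 0 i j p
        + ∑ l : Fin n, (pd l F (Fin.tail p) + ∑ k, christoffel H k k l (Fin.tail p)) *
          christoffel (warped ε F H P R) l.succ i j p := by
    rw [Finset.sum_comm]
    simp only [← Finset.sum_mul]
    rw [Fin.sum_univ_succ, D.trace_zero hp]
    simp only [D.trace_succ hp]
  have e' : ∑ k, ∑ l, christoffel (warped ε F H P R) k j l p * christoffel (warped ε F H P R) l i k p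
      = christoffel (warped ε F H P R) 0 j 0 p * christoffel (warped ε F H P R) 0 i 0 p
    + ∑ l : Fin n, christoffel (warped ε F H P R) 0 j l.succ p
        * christoffel (warped ε F H P R) l.succ i 0 p
    + (∑ k : Fin n, christoffel (warped ε F H P R) k.succ j 0 p
        * christoffel (warped ε F H P R) 0 i k.succ p
    + ∑ k : Fin n, ∑ l : Fin n, christoffel (warped ε F H P R) k.succ j l.succ p
        * christoffel (warped ε F H P R) l.succ i k.succ p) := by
    simp only [Fin.sum_univ_succ (n := n), Finset.sum_add_distrib]
  have e'' := Fin.sum_univ_succ fun k => pd k (christoffel (warped ε F H P R) k i j) p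
      - pd j (christoffel (warped ε F H P R) k i k) p
  rw [ricci, e'']
  simp only [Finset.sum_sub_distrib] at *
  rw [e, e']
  ring

lemma ricci_zero_zero (hp : p ∈ slab I U) : ricci (warped ε F H P R) 0 0 p =
    -ε * Real.exp (2 * (P (p 0) - R (p 0))) * Real.exp (2 * F (Fin.tail p)) *
        (box H F (Fin.tail p) + gradInner H F F (Fin.tail p))
      - n * (deriv (deriv R) (p 0) + deriv R (p 0) ^ 2 - deriv P (p 0) * deriv R (p 0)) := by
  have hP := D.differentiableAt_left hp
  have hR := D.differentiableAt_right hp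
  have hF := D.differentiableAt_lapse hp
  have hG := D.differentiableAt_gradUp hp
  have e1 : ∀ k : Fin n, pd k.succ (christoffel (warped ε F H P R) k.succ 0 0) p =
      (-ε * Real.exp (2 * (P (p 0) - R (p 0)))) * Real.exp (2 * F (Fin.tail p)) *
        (2 * (gradUp H F k (Fin.tail p) * pd k F (Fin.tail p))
          + pd k (gradUp H F k) (Fin.tail p)) := by
    intro k
    rw [D.pd_eq_of_eqOn hp (fun q hq => D.christoffel_succ_zero_zero hq k),
      pd_succ_separated (u := fun y => -ε * Real.exp (2 * (P y - R y)))
        (w := fun x => Real.exp (2 * F x) * gradUp H F k x) (by fun_prop)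
        (DifferentiableAt.fun_mul (by fun_prop) (hG k)),
      pd_mul _ (by fun_prop) (hG k), pd_exp _ (by fun_prop), pd_const_mul]
    ring
  have e2 : ∀ k : Fin n, pd 0 (christoffel (warped ε F H P R) k.succ 0 k.succ) p
      = deriv (deriv R) (p 0) := by
    intro k
    rw [D.pd_eq_of_eqOn hp (fun q hq => by
      rw [D.christoffel_succ_zero_succ hq k k, if_pos rfl]) (f' := fun q => deriv R (q 0)),
      pd_zero_comp_zero (D.differentiableAt_deriv_right hp)]
  have hdiv := D.metric.div_gradUp D.isOpen hp.2 D.lapse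
  have hgi := sum_gradUp_mul_self (H := H) F (Fin.tail p)
  set K := (-ε * Real.exp (2 * (P (p 0) - R (p 0)))) * Real.exp (2 * F (Fin.tail p)) with hK
  have e3 : ∑ l, (pd l F (Fin.tail p) + ∑ k, christoffel H k k l (Fin.tail p)) *
      (-ε * Real.exp (2 * (P (p 0) - R (p 0))) *
        (Real.exp (2 * F (Fin.tail p)) * gradUp H F l (Fin.tail p)))
      = K * (gradInner H F F (Fin.tail p)
        + ∑ l, (∑ k, christoffel H k k l (Fin.tail p)) * gradUp H F l (Fin.tail p)) := by
    rw [← hgi, ← Finset.sum_add_distrib, Finset.mul_sum]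
    exact Finset.sum_congr rfl fun l _ => by rw [hK]; ring
  have e4 : ∑ l, pd l F (Fin.tail p) * (-ε * Real.exp (2 * (P (p 0) - R (p 0))) *
        (Real.exp (2 * F (Fin.tail p)) * gradUp H F l (Fin.tail p)))
      = K * gradInner H F F (Fin.tail p) := by
    rw [← hgi, Finset.mul_sum]
    exact Finset.sum_congr rfl fun l _ => by rw [hK]; ring
  have e5 : ∑ l, (-ε * Real.exp (2 * (P (p 0) - R (p 0))) *
        (Real.exp (2 * F (Fin.tail p)) * gradUp H F l (Fin.tail p))) * pd l F (Fin.tail p)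
      = K * gradInner H F F (Fin.tail p) := by
    rw [← e4]
    exact Finset.sum_congr rfl fun l _ => mul_comm _ _
  rw [D.ricci_split hp]
  simp only [e1, e2, D.christoffel_zero_zero_zero hp, D.christoffel_zero_zero_succ hp,
    D.christoffel_succ_zero_zero hp, D.christoffel_succ_zero_succ hp, Finset.sum_sub_distrib,
    Finset.sum_add_distrib, ← Finset.mul_sum, hgi, hdiv, e4, e5]
  simp only [e3]
  simp
  ring

lemma sum_mixed (hp : p ∈ slab I U) (j : Fin n) :
    ∑ l, -ε * Real.exp (2 * (P (p 0) - R (p 0))) *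
        (Real.exp (2 * F (Fin.tail p)) * gradUp H F l (Fin.tail p)) *
      (-ε * (deriv R (p 0) * Real.exp (2 * (R (p 0) - P (p 0)))) *
      (Real.exp (-2 * F (Fin.tail p)) * H (Fin.tail p) j l))
      = deriv R (p 0) * pd j F (Fin.tail p) := by
  rw [← D.metric.lower_gradUp hp.2 F j, Finset.mul_sum]
  refine Finset.sum_congr rfl fun l _ => ?_
  have c1 := exp_cancel (F (Fin.tail p))
  have c2 : Real.exp (2 * (R (p 0) - P (p 0))) * Real.exp (2 * (P (p 0) - R (p 0))) = 1 := by
    rw [← Real.exp_add]; ring_nf; exact Real.exp_zero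
  calc _ = (ε * ε) * (Real.exp (-2 * F (Fin.tail p)) * Real.exp (2 * F (Fin.tail p))) *
        (Real.exp (2 * (R (p 0) - P (p 0))) * Real.exp (2 * (P (p 0) - R (p 0)))) *
        (deriv R (p 0) * (H (Fin.tail p) j l * gradUp H F l (Fin.tail p))) := by ring
    _ = _ := by rw [D.sign, c1, c2]; ring

lemma ricci_zero_succ (hp : p ∈ slab I U) (j : Fin n) : ricci (warped ε F H P R) 0 j.succ p =
    (n - 1) * deriv R (p 0) * pd j F (Fin.tail p) := by
  have hdP := D.differentiableAt_deriv_left hp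
  have hdR := D.differentiableAt_deriv_right hp
  have hdF := D.differentiableAt_pd_lapse hp
  have e1 : pd 0 (christoffel (warped ε F H P R) 0 0 j.succ) p = 0 := by
    rw [D.pd_eq_of_eqOn hp (fun q hq => D.christoffel_zero_zero_succ hq j),
      pd_zero_comp_tail (hdF j)]
  have e2 : pd j.succ (christoffel (warped ε F H P R) 0 0 0) p = 0 := by
    rw [D.pd_eq_of_eqOn hp (fun q hq => D.christoffel_zero_zero_zero hq),
      pd_succ_comp_zero hdP]
  have e3 : ∀ k l m : Fin n, pd m.succ (christoffel (warped ε F H P R) k.succ 0 l.succ) p = 0 := by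
    intro k l m
    rw [D.pd_eq_of_eqOn hp (fun q hq => D.christoffel_succ_zero_succ hq k l), pd_ite,
      pd_succ_comp_zero hdR, ite_self]
  rw [D.ricci_split hp]
  simp only [e1, e2, e3, D.christoffel_zero_zero_zero hp, D.christoffel_zero_zero_succ hp,
    D.christoffel_zero_succ_zero hp, D.christoffel_zero_succ_succ hp,
    D.christoffel_succ_succ_zero hp, D.christoffel_succ_succ_succ hp,
    D.christoffel_succ_zero_zero hp, D.christoffel_succ_zero_succ hp]
  have e4 := D.sum_mixed hp j
  simp only [mul_comm (-ε * Real.exp (2 * (P (p 0) - R (p 0))) * _)] at e4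
  rw [e4]
  have e5 : ∑ k, christoffel H k j k (Fin.tail p) = ∑ k, christoffel H k k j (Fin.tail p) :=
    Finset.sum_congr rfl fun k _ => D.metric.christoffel_symm D.isOpen hp.2 k j k
  simp [← Finset.sum_mul, e5]
  ring

lemma ricci_succ_zero (hp : p ∈ slab I U) (j : Fin n) : ricci (warped ε F H P R) j.succ 0 p =
    (n - 1) * deriv R (p 0) * pd j F (Fin.tail p) := by
  have hdR := D.differentiableAt_deriv_right hp
  have hdF := D.differentiableAt_pd_lapse hp
  have hdG := D.differentiableAt_christoffel hp
  have e3 : ∀ k : Fin n, pd k.succ (christoffel (warped ε F H P R) k.succ j.succ 0) p = 0 := by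
    intro k
    rw [D.pd_eq_of_eqOn hp (fun q hq => D.christoffel_succ_succ_zero hq k j), pd_ite,
      pd_succ_comp_zero hdR, ite_self]
  have e4 : ∀ k : Fin n, pd 0 (christoffel (warped ε F H P R) k.succ j.succ k.succ) p = 0 := by
    intro k
    rw [D.pd_eq_of_eqOn hp (fun q hq => D.christoffel_succ_succ_succ hq k j k),
      pd_zero_comp_tail (hdG k j k)]
  have e5 : pd 0 (christoffel (warped ε F H P R) 0 j.succ 0) p
      - pd 0 (christoffel (warped ε F H P R) 0 j.succ 0) p = 0 := sub_self _
  rw [D.ricci_split hp, e5]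
  simp only [e3, e4, D.christoffel_zero_zero_zero hp, D.christoffel_zero_zero_succ hp,
    D.christoffel_zero_succ_zero hp, D.christoffel_zero_succ_succ hp,
    D.christoffel_succ_succ_zero hp, D.christoffel_succ_succ_succ hp,
    D.christoffel_succ_zero_zero hp, D.christoffel_succ_zero_succ hp]
  rw [D.sum_mixed hp]
  have e6 : ∑ k, christoffel H k j k (Fin.tail p) = ∑ k, christoffel H k k j (Fin.tail p) :=
    Finset.sum_congr rfl fun k _ => D.metric.christoffel_symm D.isOpen hp.2 k j k
  simp [← Finset.mul_sum, e6]
  ring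

lemma ricci_succ_succ (hp : p ∈ slab I U) (i j : Fin n) :
    ricci (warped ε F H P R) i.succ j.succ p =
      ricci H i j (Fin.tail p) - hess H F i j (Fin.tail p)
        - pd i F (Fin.tail p) * pd j F (Fin.tail p)
        - ε * Real.exp (2 * (R (p 0) - P (p 0))) * Real.exp (-2 * F (Fin.tail p)) *
          H (Fin.tail p) i j *
          (deriv (deriv R) (p 0) + n * deriv R (p 0) ^ 2 - deriv P (p 0) * deriv R (p 0)) := by
  have hP := D.differentiableAt_left hp
  have hR := D.differentiableAt_right hp
  have hF := D.differentiableAt_lapse hp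
  have hdR := D.differentiableAt_deriv_right hp
  have hdF := D.differentiableAt_pd_lapse hp
  have hdG := D.differentiableAt_christoffel hp
  have e1 : pd 0 (christoffel (warped ε F H P R) 0 i.succ j.succ) p =
      -ε * Real.exp (2 * (R (p 0) - P (p 0))) * Real.exp (-2 * F (Fin.tail p)) *
          H (Fin.tail p) i j * (deriv (deriv R) (p 0) + 2 * deriv R (p 0) ^ 2
            - 2 * deriv P (p 0) * deriv R (p 0)) := by
    rw [D.pd_eq_of_eqOn hp (fun q hq => D.christoffel_zero_succ_succ hq i j),
      pd_zero_separated (u := fun y => -ε * (deriv R y * Real.exp (2 * (R y - P y))))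
        (w := fun x => Real.exp (-2 * F x) * H x i j) (by fun_prop)
        (DifferentiableAt.fun_mul (by fun_prop) (D.differentiableAt_metric hp i j)),
      ((hdR.hasDerivAt.fun_mul
        ((hR.hasDerivAt.fun_sub hP.hasDerivAt).const_mul 2).exp).const_mul (-ε)).deriv]
    ring
  have e2 : pd j.succ (christoffel (warped ε F H P R) 0 i.succ 0) p
      = pd i (pd j F) (Fin.tail p) := by
    rw [D.pd_eq_of_eqOn hp (fun q hq => D.christoffel_zero_succ_zero hq i),
      pd_succ_comp_tail (hdF i), pd_comm D.isOpen D.lapse hp.2]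
  have e3 : ∀ k l m r : Fin n, pd r.succ (christoffel (warped ε F H P R) k.succ l.succ m.succ) p
      = pd r (christoffel H k l m) (Fin.tail p) := by
    intro k l m r
    rw [D.pd_eq_of_eqOn hp (fun q hq => D.christoffel_succ_succ_succ hq k l m),
      pd_succ_comp_tail (hdG k l m)]
  rw [D.ricci_split hp]
  simp only [e1, e2, e3, D.christoffel_zero_succ_zero hp, D.christoffel_zero_succ_succ hp,
    D.christoffel_succ_succ_zero hp, D.christoffel_succ_succ_succ hp]
  have e4 : ∑ k, ∑ l, christoffel H k k l (Fin.tail p) * christoffel H l i j (Fin.tail p)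
      = ∑ l, (∑ k, christoffel H k k l (Fin.tail p)) * christoffel H l i j (Fin.tail p) := by
    rw [Finset.sum_comm]
    simp only [Finset.sum_mul]
  have e5 : ∑ l, christoffel H l i j (Fin.tail p) * pd l F (Fin.tail p)
      = ∑ l, pd l F (Fin.tail p) * christoffel H l i j (Fin.tail p) :=
    Finset.sum_congr rfl fun l _ => mul_comm _ _
  simp only [ricci, hess, Finset.sum_sub_distrib, e4, e5, add_mul, Finset.sum_add_distrib]
  simp [D.metric.entry_symm hp.2 j i]
  ring

/-- The Laplacian of `f(x) + u(y)` for the warped metric. -/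
lemma box_eq (hp : p ∈ slab I U) (hf : ContDiffOn ℝ ∞ f U) (hu : ContDiffOn ℝ ∞ u I) :
    box (warped ε F H P R) (fun q => f (Fin.tail q) + u (q 0)) p =
      ε * Real.exp (-2 * (F (Fin.tail p) + P (p 0))) *
        (deriv (deriv u) (p 0) + deriv u (p 0) * (n * deriv R (p 0) - deriv P (p 0)))
      + Real.exp (-2 * R (p 0)) *
        (box H f (Fin.tail p) + gradInner H F f (Fin.tail p)) := by
  have hfd : ∀ q ∈ slab I U, DifferentiableAt ℝ f (Fin.tail q) := fun q hq =>
    differentiableAt_of_smooth D.isOpen hf hq.2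
  have hud : ∀ q ∈ slab I U, DifferentiableAt ℝ u (q 0) := fun q hq =>
    differentiableAt_of_smooth_real D.isOpen_base hu hq.1
  have hdu : DifferentiableAt ℝ (deriv u) (p 0) :=
    differentiableAt_of_smooth_real D.isOpen_base (contDiffOn_deriv D.isOpen_base hu) hp.1
  have hdf : ∀ i, DifferentiableAt ℝ (pd i f) (Fin.tail p) := fun i =>
    differentiableAt_of_smooth D.isOpen (contDiffOn_pd D.isOpen hf i) hp.2
  have d0 : ∀ q ∈ slab I U, pd 0 (fun q => f (Fin.tail q) + u (q 0)) q = deriv u (q 0) := by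
    intro q hq
    rw [pd_add _ (hasFDerivAt_comp_tail (hfd q hq)).differentiableAt
      (hasFDerivAt_comp_zero (hud q hq)).differentiableAt, pd_zero_comp_tail (hfd q hq),
      pd_zero_comp_zero (hud q hq), zero_add]
  have d1 : ∀ (i : Fin n), ∀ q ∈ slab I U,
      pd i.succ (fun q => f (Fin.tail q) + u (q 0)) q = pd i f (Fin.tail q) := by
    intro i q hq
    rw [pd_add _ (hasFDerivAt_comp_tail (hfd q hq)).differentiableAt
      (hasFDerivAt_comp_zero (hud q hq)).differentiableAt, pd_succ_comp_tail (hfd q hq),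
      pd_succ_comp_zero (hud q hq), add_zero]
  have e00 : hess (warped ε F H P R) (fun q => f (Fin.tail q) + u (q 0)) 0 0 p =
      deriv (deriv u) (p 0) - deriv P (p 0) * deriv u (p 0)
        + ε * Real.exp (2 * (P (p 0) - R (p 0))) * Real.exp (2 * F (Fin.tail p)) *
          gradInner H F f (Fin.tail p) := by
    have hgi : ∑ k, gradUp H F k (Fin.tail p) * pd k f (Fin.tail p)
        = gradInner H F f (Fin.tail p) := by
      rw [sum_gradUp_mul, gradInner, Finset.sum_comm]
      exact Finset.sum_congr rfl fun k _ => Finset.sum_congr rfl fun l _ => by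
        rw [D.metric.inv_symm hp.2 l k]
    rw [hess, D.pd_eq_of_eqOn hp d0, pd_zero_comp_zero hdu, Fin.sum_univ_succ, d0 p hp,
      D.christoffel_zero_zero_zero hp, ← hgi, Finset.mul_sum, ← sub_sub, sub_eq_add_neg _ (∑ _, _),
      ← Finset.sum_neg_distrib]
    congr 1
    refine Finset.sum_congr rfl fun k _ => ?_
    rw [d1 k p hp, D.christoffel_succ_zero_zero hp]
    ring
  have eij : ∀ i j : Fin n,
      hess (warped ε F H P R) (fun q => f (Fin.tail q) + u (q 0)) i.succ j.succ p =
      hess H f i j (Fin.tail p) + ε * (deriv R (p 0) * Real.exp (2 * (R (p 0) - P (p 0)))) *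
        Real.exp (-2 * F (Fin.tail p)) * H (Fin.tail p) i j * deriv u (p 0) := by
    intro i j
    rw [hess, D.pd_eq_of_eqOn hp (d1 j), pd_succ_comp_tail (hdf j), Fin.sum_univ_succ, d0 p hp,
      D.christoffel_zero_succ_succ hp, hess]
    simp only [d1 _ p hp, D.christoffel_succ_succ_succ hp]
    ring
  have etr : ∑ i, ∑ j, (H (Fin.tail p))⁻¹ i j * H (Fin.tail p) i j = n := by
    have : ∀ i, ∑ j, (H (Fin.tail p))⁻¹ i j * H (Fin.tail p) i j = 1 := fun i => by
      rw [← (if_pos rfl : (if i = i then (1 : ℝ) else 0) = 1), ← D.metric.inv_mul_entry hp.2 i i]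
      exact Finset.sum_congr rfl fun j _ => by rw [D.metric.entry_symm hp.2 i j]
    simp [this]
  rw [box, Fin.sum_univ_succ]
  simp only [Fin.sum_univ_succ (n := n), D.inv_zero_succ hp, D.inv_succ_zero hp, zero_mul,
    Finset.sum_const_zero, add_zero, zero_add, e00, eij, D.inv_succ_succ hp, D.inv_zero_zero hp]
  have esum : ∑ i, ∑ j, Real.exp (-2 * R (p 0)) * (H (Fin.tail p))⁻¹ i j *
      (hess H f i j (Fin.tail p) + ε * (deriv R (p 0) * Real.exp (2 * (R (p 0) - P (p 0)))) *
        Real.exp (-2 * F (Fin.tail p)) * H (Fin.tail p) i j * deriv u (p 0))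
      = Real.exp (-2 * R (p 0)) * box H f (Fin.tail p)
        + Real.exp (-2 * R (p 0)) * (ε * (deriv R (p 0) * Real.exp (2 * (R (p 0) - P (p 0)))) *
        Real.exp (-2 * F (Fin.tail p)) * deriv u (p 0)) * n := by
    rw [← etr, box]
    simp only [Finset.mul_sum, ← Finset.sum_add_distrib]
    exact Finset.sum_congr rfl fun i _ => Finset.sum_congr rfl fun j _ => by ring
  rw [esum]
  have c1 := exp_cancel (R (p 0))
  have c2 : Real.exp (-2 * (F (Fin.tail p) + P (p 0))) * (Real.exp (2 * (P (p 0) - R (p 0))) *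
      Real.exp (2 * F (Fin.tail p))) = Real.exp (-2 * R (p 0)) := by
    rw [← Real.exp_add, ← Real.exp_add]; ring_nf
  have c3 : Real.exp (-2 * R (p 0)) * (Real.exp (2 * (R (p 0) - P (p 0))) *
      Real.exp (-2 * F (Fin.tail p))) = Real.exp (-2 * (F (Fin.tail p) + P (p 0))) := by
    rw [← Real.exp_add, ← Real.exp_add]; ring_nf
  linear_combination (ε * ε * gradInner H F f (Fin.tail p)) * c2
    + (Real.exp (-2 * R (p 0)) * gradInner H F f (Fin.tail p)) * D.sign
    + (ε * deriv R (p 0) * deriv u (p 0) * n) * c3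

end IsWarpData

end Warped

/-! ### Metrics derived from a seed -/

section Scaling

variable {ι : Type} [Fintype ι] [DecidableEq ι] {h : (ι → ℝ) → Matrix ι ι ℝ} {x : ι → ℝ}

lemma hess_const_mul (c : ℝ) (f : (ι → ℝ) → ℝ) (i j : ι) :
    hess h (fun z => c * f z) i j x = c * hess h f i j x := by
  have e : pd j (fun z => c * f z) = fun z => c * pd j f z := funext fun z => pd_const_mul j c f
  simp only [hess, e, pd_const_mul, mul_sub, Finset.mul_sum, mul_left_comm c]

lemma box_const_mul (c : ℝ) (f : (ι → ℝ) → ℝ) :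
    box h (fun z => c * f z) x = c * box h f x := by
  simp only [box, hess_const_mul, Finset.mul_sum, mul_left_comm c]

lemma gradInner_const_mul (a b : ℝ) (f f' : (ι → ℝ) → ℝ) :
    gradInner h (fun z => a * f z) (fun z => b * f' z) x = a * b * gradInner h f f' x := by
  simp only [gradInner, pd_const_mul, Finset.mul_sum]
  exact Finset.sum_congr rfl fun i _ => Finset.sum_congr rfl fun j _ => by ring

end Scaling

section Twisted

variable {n : ℕ}

/-- The metric `ε e^{2(aV(x) + P(y))} dy² + e^{2cV(x) + 2R(y)} hᵢⱼ(x) dxⁱ dxʲ`, of which the seed,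
the template and the general form of the solutions are special cases. -/
noncomputable def twisted (ε a c : ℝ) (V : (Fin n → ℝ) → ℝ)
    (h : (Fin n → ℝ) → Matrix (Fin n) (Fin n) ℝ) (P R : ℝ → ℝ) :
    (Fin (n + 1) → ℝ) → Matrix (Fin (n + 1)) (Fin (n + 1)) ℝ :=
  warped ε (fun x => a * V x) (conformal (fun x => c * V x) h) P R

lemma twisted_zero_zero (ε a c : ℝ) (V : (Fin n → ℝ) → ℝ)
    (h : (Fin n → ℝ) → Matrix (Fin n) (Fin n) ℝ) (P R : ℝ → ℝ) (p : Fin (n + 1) → ℝ) :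
    twisted ε a c V h P R p 0 0 = ε * Real.exp (2 * (a * V (Fin.tail p) + P (p 0))) := rfl

lemma twisted_zero_succ (ε a c : ℝ) (V : (Fin n → ℝ) → ℝ)
    (h : (Fin n → ℝ) → Matrix (Fin n) (Fin n) ℝ) (P R : ℝ → ℝ) (p : Fin (n + 1) → ℝ) (j : Fin n) :
    twisted ε a c V h P R p 0 j.succ = 0 := rfl

lemma twisted_succ_zero (ε a c : ℝ) (V : (Fin n → ℝ) → ℝ)
    (h : (Fin n → ℝ) → Matrix (Fin n) (Fin n) ℝ) (P R : ℝ → ℝ) (p : Fin (n + 1) → ℝ) (j : Fin n) :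
    twisted ε a c V h P R p j.succ 0 = 0 := rfl

lemma twisted_succ_succ (ε a c : ℝ) (V : (Fin n → ℝ) → ℝ)
    (h : (Fin n → ℝ) → Matrix (Fin n) (Fin n) ℝ) (P R : ℝ → ℝ) (p : Fin (n + 1) → ℝ)
    (i j : Fin n) : twisted ε a c V h P R p i.succ j.succ =
      Real.exp (2 * (c * V (Fin.tail p)) + 2 * R (p 0)) * h (Fin.tail p) i j := by
  simp only [twisted, warped, orthMatrix_succ_succ, conformal, Matrix.smul_apply, smul_eq_mul]
  rw [Real.exp_add]; ring

variable {ε a c : ℝ} {I : Set ℝ} {U : Set (Fin n → ℝ)} {V : (Fin n → ℝ) → ℝ}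
  {h : (Fin n → ℝ) → Matrix (Fin n) (Fin n) ℝ} {P R u : ℝ → ℝ} {p : Fin (n + 1) → ℝ}

lemma isWarpData_twisted (hε : ε * ε = 1) (hI : IsOpen I) (hU : IsOpen U)
    (hV : ContDiffOn ℝ ∞ V U) (hh : IsMetricOn U h) (hP : ContDiffOn ℝ ∞ P I)
    (hR : ContDiffOn ℝ ∞ R I) (a c : ℝ) :
    IsWarpData ε I U (fun x => a * V x) (conformal (fun x => c * V x) h) P R where
  sign := hε
  isOpen_base := hI
  isOpen := hU
  lapse := contDiffOn_const.mul hV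
  metric := isMetricOn_conformal hh (contDiffOn_const.mul hV)
  smooth_left := hP
  smooth_right := hR

variable (D : IsWarpData ε I U (fun x => a * V x) (conformal (fun x => c * V x) h) P R)
  (hh : IsMetricOn U h) (hV : ContDiffOn ℝ ∞ V U) (hp : p ∈ slab I U)
include D hh hV hp

lemma ricci_twisted_zero_zero : ricci (twisted ε a c V h P R) 0 0 p =
    -ε * Real.exp (2 * ((a - c) * V (Fin.tail p)) + 2 * (P (p 0) - R (p 0))) *
      (a * (box h V (Fin.tail p) + (a + ((n : ℝ) - 2) * c) * gradInner h V V (Fin.tail p)))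
      - n * (deriv (deriv R) (p 0) + deriv R (p 0) ^ 2 - deriv P (p 0) * deriv R (p 0)) := by
  have hcV : ContDiffOn ℝ ∞ (fun x => c * V x) U := contDiffOn_const.mul hV
  have e : Real.exp (2 * ((a - c) * V (Fin.tail p)) + 2 * (P (p 0) - R (p 0)))
      = Real.exp (2 * (P (p 0) - R (p 0))) * Real.exp (2 * (a * V (Fin.tail p)))
        * Real.exp (-2 * (c * V (Fin.tail p))) := by
    rw [← Real.exp_add, ← Real.exp_add]; ring_nf
  rw [twisted, D.ricci_zero_zero hp, box_conformal hh D.isOpen hcV hp.2,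
    gradInner_conformal hh hp.2, box_const_mul, gradInner_const_mul, gradInner_const_mul, e]
  simp only [Fintype.card_fin]
  ring

lemma ricci_twisted_succ_succ (i j : Fin n) :
    ricci (twisted ε a c V h P R) i.succ j.succ p = ricci h i j (Fin.tail p)
      - (a + ((n : ℝ) - 2) * c) * hess h V i j (Fin.tail p)
      + (((n : ℝ) - 2) * c ^ 2 + 2 * a * c - a ^ 2) *
        (pd i V (Fin.tail p) * pd j V (Fin.tail p))
      - h (Fin.tail p) i j * (c * (box h V (Fin.tail p)
        + (a + ((n : ℝ) - 2) * c) * gradInner h V V (Fin.tail p)))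
      - ε * Real.exp (2 * ((c - a) * V (Fin.tail p)) + 2 * (R (p 0) - P (p 0))) *
          h (Fin.tail p) i j *
        (deriv (deriv R) (p 0) + n * deriv R (p 0) ^ 2 - deriv P (p 0) * deriv R (p 0)) := by
  have hcV : ContDiffOn ℝ ∞ (fun x => c * V x) U := contDiffOn_const.mul hV
  have e : Real.exp (2 * ((c - a) * V (Fin.tail p)) + 2 * (R (p 0) - P (p 0)))
      = Real.exp (2 * (R (p 0) - P (p 0))) * Real.exp (-2 * (a * V (Fin.tail p)))
        * Real.exp (2 * (c * V (Fin.tail p))) := by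
    rw [← Real.exp_add, ← Real.exp_add]; ring_nf
  rw [twisted, D.ricci_succ_succ hp, ricci_conformal hh D.isOpen hcV hp.2,
    hess_conformal hh D.isOpen hcV hp.2, hess_const_mul, hess_const_mul, box_const_mul,
    gradInner_const_mul, gradInner_const_mul, e]
  simp only [Fintype.card_fin, pd_const_mul, conformal, Matrix.smul_apply, smul_eq_mul]
  ring

omit hh hV in
lemma ricci_twisted_zero_succ (j : Fin n) : ricci (twisted ε a c V h P R) 0 j.succ p =
    (n - 1) * deriv R (p 0) * (a * pd j V (Fin.tail p)) := by
  rw [twisted, D.ricci_zero_succ hp, pd_const_mul]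

omit hh hV in
lemma ricci_twisted_succ_zero (j : Fin n) : ricci (twisted ε a c V h P R) j.succ 0 p =
    (n - 1) * deriv R (p 0) * (a * pd j V (Fin.tail p)) := by
  rw [twisted, D.ricci_succ_zero hp, pd_const_mul]

lemma box_twisted (σ : ℝ) (hu : ContDiffOn ℝ ∞ u I) :
    box (twisted ε a c V h P R) (fun q => σ * V (Fin.tail q) + u (q 0)) p =
      ε * Real.exp (-2 * (a * V (Fin.tail p) + P (p 0))) *
        (deriv (deriv u) (p 0) + deriv u (p 0) * (n * deriv R (p 0) - deriv P (p 0)))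
      + Real.exp (-2 * (c * V (Fin.tail p)) - 2 * R (p 0)) * (σ *
        (box h V (Fin.tail p) + (a + ((n : ℝ) - 2) * c) * gradInner h V V (Fin.tail p))) := by
  have hcV : ContDiffOn ℝ ∞ (fun x => c * V x) U := contDiffOn_const.mul hV
  have e : Real.exp (-2 * (c * V (Fin.tail p)) - 2 * R (p 0))
      = Real.exp (-2 * R (p 0)) * Real.exp (-2 * (c * V (Fin.tail p))) := by
    rw [← Real.exp_add]; ring_nf
  rw [twisted, D.box_eq (f := fun x => σ * V x) hp (contDiffOn_const.mul hV) hu,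
    box_conformal hh D.isOpen hcV hp.2,
    gradInner_conformal hh hp.2, box_const_mul, gradInner_const_mul, gradInner_const_mul, e]
  simp only [Fintype.card_fin]
  ring

omit hh hV in
lemma pd_zero_field (σ : ℝ) (hV : ContDiffOn ℝ ∞ V U) (hu : ContDiffOn ℝ ∞ u I) :
    pd 0 (fun q => σ * V (Fin.tail q) + u (q 0)) p = deriv u (p 0) := by
  have h1 : DifferentiableAt ℝ (fun x => σ * V x) (Fin.tail p) :=
    (differentiableAt_of_smooth D.isOpen hV hp.2).const_mul σ
  have h2 := differentiableAt_of_smooth_real D.isOpen_base hu hp.1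
  rw [pd_add _ (hasFDerivAt_comp_tail h1).differentiableAt
    (hasFDerivAt_comp_zero h2).differentiableAt, pd_zero_comp_tail h1, pd_zero_comp_zero h2,
    zero_add]

omit hh hV in
lemma pd_succ_field (σ : ℝ) (hV : ContDiffOn ℝ ∞ V U) (hu : ContDiffOn ℝ ∞ u I) (i : Fin n) :
    pd i.succ (fun q => σ * V (Fin.tail q) + u (q 0)) p = σ * pd i V (Fin.tail p) := by
  have h1 : DifferentiableAt ℝ (fun x => σ * V x) (Fin.tail p) :=
    (differentiableAt_of_smooth D.isOpen hV hp.2).const_mul σ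
  have h2 := differentiableAt_of_smooth_real D.isOpen_base hu hp.1
  rw [pd_add _ (hasFDerivAt_comp_tail h1).differentiableAt
    (hasFDerivAt_comp_zero h2).differentiableAt, pd_succ_comp_tail h1, pd_succ_comp_zero h2,
    pd_const_mul, add_zero]

end Twisted

section Seed

variable {n : ℕ} {ε Lam : ℝ} {U : Set (Fin n → ℝ)} {V : (Fin n → ℝ) → ℝ}
  {h : (Fin n → ℝ) → Matrix (Fin n) (Fin n) ℝ} {x : Fin n → ℝ}

lemma orthMetric_eq_twisted : orthMetric ε V h = twisted ε 1 (-1) V h (fun _ => 0) fun _ => 0 := by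
  funext p
  ext i j
  refine Fin.cases ?_ (fun i => ?_) i <;> refine Fin.cases ?_ (fun j => ?_) j
  · simp [twisted_zero_zero, orthMetric]
  · rfl
  · rfl
  · simp [twisted_succ_succ, orthMetric]

variable (hs : IsSeed ε Lam U V h) (hε : ε * ε = 1)
include hs hε

lemma IsSeed.warpData : IsWarpData ε Set.univ U (fun x => 1 * V x)
    (conformal (fun x => -1 * V x) h) (fun _ => 0) (fun _ => 0) :=
  isWarpData_twisted hε isOpen_univ hs.isOpen hs.smooth hs.metric contDiffOn_const
    contDiffOn_const 1 (-1)

/-- The `dy²` component of the vacuum equations. -/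
lemma IsSeed.box_eq (hn : 3 ≤ n) (hx : x ∈ U) :
    box h V x + (3 - (n : ℝ)) * gradInner h V V x = -(2 * Lam / (n - 1)) * Real.exp (-2 * V x) := by
  have hn' : (3 : ℝ) ≤ n := by exact_mod_cast hn
  have D := hs.warpData hε
  have hp : (Fin.cons 0 x : Fin (n + 1) → ℝ) ∈ slab Set.univ U := ⟨trivial, by simpa using hx⟩
  have e := hs.vacuum.einstein _ hp 0 0
  rw [orthMetric_eq_twisted, ricci_twisted_zero_zero D hs.metric hs.smooth hp,
    twisted_zero_zero] at e
  simp only [Fin.tail_cons, deriv_const', deriv_const] at e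
  have e1 : Real.exp (2 * ((1 - -1) * V x) + 2 * (0 - 0))
      = Real.exp (2 * (1 * V x + 0)) * Real.exp (2 * V x) := by
    rw [← Real.exp_add]; ring_nf
  have e2 := IsWarpData.exp_cancel (V x)
  rw [e1] at e
  have hpos := (Real.exp_pos (2 * (1 * V x + 0))).ne'
  have e3 : Real.exp (2 * V x) * (box h V x + (3 - (n : ℝ)) * gradInner h V V x)
      = - (2 * Lam / (n - 1)) := by
    have : (n : ℝ) - 1 ≠ 0 := by linarith
    refine mul_left_cancel₀ (mul_ne_zero D.sign_ne hpos) ?_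
    have e4 : 2 / (((n + 1 : ℕ) : ℝ) - 2) * Lam = 2 * Lam / (n - 1) := by
      push_cast; rw [show (n : ℝ) + 1 - 2 = n - 1 by ring]; ring
    rw [e4] at e
    linear_combination -e
  rw [← e3]
  linear_combination -(box h V x + (3 - (n : ℝ)) * gradInner h V V x) * e2

/-- The `dxⁱ dxʲ` components of the vacuum equations, simplified by means of the `dy²`
component. -/
lemma IsSeed.ricci_eq (hn : 3 ≤ n) (hx : x ∈ U) (i j : Fin n) :
    ricci h i j x = (3 - (n : ℝ)) * hess h V i j x + (5 - n) * (pd i V x * pd j V x)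
      + 4 * Lam / (n - 1) * Real.exp (-2 * V x) * h x i j := by
  have D := hs.warpData hε
  have hp : (Fin.cons 0 x : Fin (n + 1) → ℝ) ∈ slab Set.univ U := ⟨trivial, by simpa using hx⟩
  have e := hs.vacuum.einstein _ hp i.succ j.succ
  rw [orthMetric_eq_twisted, ricci_twisted_succ_succ D hs.metric hs.smooth hp,
    twisted_succ_succ] at e
  simp only [Fin.tail_cons, deriv_const', deriv_const] at e
  have e4 : 2 / (((n + 1 : ℕ) : ℝ) - 2) * Lam = 2 * Lam / (n - 1) := by
    push_cast; rw [show (n : ℝ) + 1 - 2 = n - 1 by ring]; ring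
  rw [e4, show 2 * (-1 * V x) + 2 * 0 = -2 * V x by ring] at e
  have e5 := hs.box_eq hε hn hx
  linear_combination e - h x i j * e5

end Seed

section Derived

variable {n : ℕ} {ε Lam α γ : ℝ} {I : Set ℝ} {U : Set (Fin n → ℝ)} {V : (Fin n → ℝ) → ℝ}
  {h : (Fin n → ℝ) → Matrix (Fin n) (Fin n) ℝ} {P R : ℝ → ℝ} {p : Fin (n + 1) → ℝ}
  (hs : IsSeed ε Lam U V h) (hε : ε * ε = 1) (hn : 3 ≤ n) (hI : IsOpen I)
  (hP : ContDiffOn ℝ ∞ P I) (hR : ContDiffOn ℝ ∞ R I)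
  (hγ : ((n : ℝ) - 2) * γ = α + (n - 3)) (hp : p ∈ slab I U)
include hs hε hn hI hP hR hγ hp

/-- For a derived metric the Hessian of `V` drops out of the `dy²` component of the Ricci
tensor. -/
lemma ricci_derived_zero_zero : ricci (twisted ε α (-γ) V h P R) 0 0 p =
    ε * Real.exp (2 * (α * V (Fin.tail p) + P (p 0))) *
      (2 * α * Lam / (n - 1) * Real.exp (-2 * ((1 - γ) * V (Fin.tail p)) - 2 * R (p 0))
        - n * (ε * Real.exp (-2 * (α * V (Fin.tail p) + P (p 0)))) *
          (deriv (deriv R) (p 0) + deriv R (p 0) ^ 2 - deriv P (p 0) * deriv R (p 0))) := by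
  have D := isWarpData_twisted hε hI hs.isOpen hs.smooth hs.metric hP hR α (-γ)
  rw [ricci_twisted_zero_zero D hs.metric hs.smooth hp]
  have e1 : α + ((n : ℝ) - 2) * -γ = 3 - n := by linear_combination -hγ
  have e2 : Real.exp (2 * ((α - -γ) * V (Fin.tail p)) + 2 * (P (p 0) - R (p 0))) *
      Real.exp (-2 * V (Fin.tail p)) = Real.exp (2 * (α * V (Fin.tail p) + P (p 0))) *
      Real.exp (-2 * ((1 - γ) * V (Fin.tail p)) - 2 * R (p 0)) := by
    rw [← Real.exp_add, ← Real.exp_add]; ring_nf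
  have e3 := IsWarpData.exp_cancel (α * V (Fin.tail p) + P (p 0))
  rw [e1, hs.box_eq hε hn hp.2]
  linear_combination (ε * α * (2 * Lam / (n - 1))) * e2 +
    (n * (deriv (deriv R) (p 0) + deriv R (p 0) ^ 2 - deriv P (p 0) * deriv R (p 0))) *
      (D.sign + ε * ε * e3)

/-- For a derived metric the Hessian of `V` drops out of the `dxⁱ dxʲ` components of the Ricci
tensor. -/
lemma ricci_derived_succ_succ (i j : Fin n) :
    ricci (twisted ε α (-γ) V h P R) i.succ j.succ p =
    ((n : ℝ) - 1) * (1 - α ^ 2) / (n - 2) * (pd i V (Fin.tail p) * pd j V (Fin.tail p)) +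
    Real.exp (2 * (-γ * V (Fin.tail p)) + 2 * R (p 0)) * h (Fin.tail p) i j *
      (2 * (2 - γ) * Lam / (n - 1) * Real.exp (-2 * ((1 - γ) * V (Fin.tail p)) - 2 * R (p 0))
        - ε * Real.exp (-2 * (α * V (Fin.tail p) + P (p 0))) *
          (deriv (deriv R) (p 0) + n * deriv R (p 0) ^ 2 - deriv P (p 0) * deriv R (p 0))) := by
  have hn' : (3 : ℝ) ≤ n := by exact_mod_cast hn
  have hn2 : (n : ℝ) - 2 ≠ 0 := by linarith
  have D := isWarpData_twisted hε hI hs.isOpen hs.smooth hs.metric hP hR α (-γ)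
  rw [ricci_twisted_succ_succ D hs.metric hs.smooth hp]
  have e1 : α + ((n : ℝ) - 2) * -γ = 3 - n := by linear_combination -hγ
  have e2 : Real.exp (2 * (-γ * V (Fin.tail p)) + 2 * R (p 0)) *
      Real.exp (-2 * ((1 - γ) * V (Fin.tail p)) - 2 * R (p 0)) =
      Real.exp (-2 * V (Fin.tail p)) := by
    rw [← Real.exp_add]; ring_nf
  have e3 : Real.exp (2 * (-γ * V (Fin.tail p)) + 2 * R (p 0)) *
      Real.exp (-2 * (α * V (Fin.tail p) + P (p 0))) =
      Real.exp (2 * ((-γ - α) * V (Fin.tail p)) + 2 * (R (p 0) - P (p 0))) := by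
    rw [← Real.exp_add]; ring_nf
  have e4 : ((n : ℝ) - 1) * (1 - α ^ 2) / (n - 2)
      = (5 - n) + (((n : ℝ) - 2) * (-γ) ^ 2 + 2 * α * (-γ) - α ^ 2) := by
    rw [div_eq_iff hn2]
    linear_combination -(((n : ℝ) - 2) * γ - α + n - 3) * hγ
  rw [e1, hs.box_eq hε hn hp.2, hs.ricci_eq hε hn hp.2, e4, ← e3]
  linear_combination (-h (Fin.tail p) i j * (2 * (2 - γ) * Lam / (n - 1))) * e2

end Derived

/-! ### The parameters of the family -/

section Parameters

variable {n : ℕ} {κ ε s lam q β Lam : ℝ}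

/-- The coefficient `√((N-2)/κ) s / √(N-3+λ²)` of `V` in the scalar field. -/
noncomputable def sigmaOf (n : ℕ) (κ s lam : ℝ) : ℝ :=
  Real.sqrt (((n : ℝ) + 1 - 2) / κ) * (s * (1 / Real.sqrt ((n : ℝ) + 1 - 3 + lam ^ 2)))

/-- The coefficient `√((N-2)/κ) λ` of `q Y` in the scalar field. -/
noncomputable def rhoOf (n : ℕ) (κ lam : ℝ) : ℝ := Real.sqrt (((n : ℝ) + 1 - 2) / κ) * lam

lemma sqrt_param_pos (hn : 3 ≤ n) (lam : ℝ) : 0 < Real.sqrt ((n : ℝ) + 1 - 3 + lam ^ 2) := by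
  have hn' : (3 : ℝ) ≤ n := by exact_mod_cast hn
  exact Real.sqrt_pos.2 (by nlinarith [sq_nonneg lam])

lemma sqrt_param_sq (hn : 3 ≤ n) (lam : ℝ) :
    Real.sqrt ((n : ℝ) + 1 - 3 + lam ^ 2) ^ 2 = n - 2 + lam ^ 2 := by
  have hn' : (3 : ℝ) ≤ n := by exact_mod_cast hn
  rw [Real.sq_sqrt (by nlinarith [sq_nonneg lam])]; ring

lemma sqrt_coupling_sq (hn : 3 ≤ n) (hκ : 0 < κ) :
    κ * Real.sqrt (((n : ℝ) + 1 - 2) / κ) ^ 2 = n - 1 := by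
  have hn' : (3 : ℝ) ≤ n := by exact_mod_cast hn
  rw [Real.sq_sqrt (div_nonneg (by linarith) hκ.le)]; field_simp; ring

lemma sqrt_coupling_pos (hn : 3 ≤ n) (hκ : 0 < κ) : 0 < Real.sqrt (((n : ℝ) + 1 - 2) / κ) := by
  have hn' : (3 : ℝ) ≤ n := by exact_mod_cast hn
  exact Real.sqrt_pos.2 (div_pos (by linarith) hκ)

lemma sqrt_coupling_mul (hn : 3 ≤ n) (hκ : 0 < κ) :
    Real.sqrt (κ / ((n : ℝ) + 1 - 2)) * Real.sqrt (((n : ℝ) + 1 - 2) / κ) = 1 := by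
  have hn' : (3 : ℝ) ≤ n := by exact_mod_cast hn
  have h1 : (n : ℝ) + 1 - 2 ≠ 0 := by linarith
  rw [← Real.sqrt_mul (div_nonneg hκ.le (by linarith)), div_mul_div_comm, mul_comm κ,
    div_self (mul_ne_zero h1 hκ.ne'), Real.sqrt_one]

lemma sign_mul_self (hs : s = 1 ∨ s = -1) : s * s = 1 := by rcases hs with rfl | rfl <;> norm_num

lemma alphaOf_sq (hn : 3 ≤ n) (hs : s = 1 ∨ s = -1) :
    alphaOf ((n : ℝ) + 1) s lam ^ 2 * (n - 2 + lam ^ 2) = lam ^ 2 := by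
  rw [← sqrt_param_sq hn lam, alphaOf, mul_pow, div_pow, pow_two s, sign_mul_self hs]
  have := (sqrt_param_pos hn lam).ne'
  field_simp

lemma one_sub_alphaOf_sq (hn : 3 ≤ n) (hs : s = 1 ∨ s = -1) :
    (1 - alphaOf ((n : ℝ) + 1) s lam ^ 2) * (n - 2 + lam ^ 2) = n - 2 := by
  linear_combination -alphaOf_sq (lam := lam) hn hs

lemma alphaOf_lt_one (hn : 3 ≤ n) (hs : s = 1 ∨ s = -1) : alphaOf ((n : ℝ) + 1) s lam < 1 := by
  have hn' : (3 : ℝ) ≤ n := by exact_mod_cast hn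
  have h := one_sub_alphaOf_sq (lam := lam) hn hs
  have h2 : 0 < (n : ℝ) - 2 + lam ^ 2 := by nlinarith [sq_nonneg lam]
  have h3 : 0 < 1 - alphaOf ((n : ℝ) + 1) s lam ^ 2 := by
    by_contra hc
    push Not at hc
    nlinarith
  nlinarith

lemma gammaOf_eq (hn : 3 ≤ n) (s lam : ℝ) : ((n : ℝ) - 2) * gammaOf ((n : ℝ) + 1) s lam =
    alphaOf ((n : ℝ) + 1) s lam + (n - 3) := by
  have hn' : (3 : ℝ) ≤ n := by exact_mod_cast hn
  have h1 : (n : ℝ) + 1 - 3 ≠ 0 := by linarith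
  rw [gammaOf]
  field_simp
  ring

lemma sigmaOf_sq (hn : 3 ≤ n) (hκ : 0 < κ) (hs : s = 1 ∨ s = -1) :
    κ * sigmaOf n κ s lam ^ 2 =
      ((n : ℝ) - 1) * (1 - alphaOf ((n : ℝ) + 1) s lam ^ 2) / (n - 2) := by
  have hn' : (3 : ℝ) ≤ n := by exact_mod_cast hn
  have h1 : (n : ℝ) - 2 ≠ 0 := by linarith
  have h2 := (sqrt_param_pos hn lam).ne'
  have h3 := one_sub_alphaOf_sq (lam := lam) hn hs
  rw [← sqrt_param_sq hn lam] at h3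
  have h4 : κ * sigmaOf n κ s lam ^ 2 * Real.sqrt ((n : ℝ) + 1 - 3 + lam ^ 2) ^ 2 = n - 1 := by
    rw [← sqrt_coupling_sq hn hκ, sigmaOf, mul_pow, mul_pow, pow_two s, sign_mul_self hs]
    field_simp
  rw [eq_div_iff h1]
  refine mul_right_cancel₀ (pow_ne_zero 2 h2) ?_
  linear_combination ((n : ℝ) - 2) * h4 - (n - 1) * h3

lemma sigmaOf_mul_rhoOf (hn : 3 ≤ n) (hκ : 0 < κ) :
    κ * (sigmaOf n κ s lam * rhoOf n κ lam) = (n - 1) * alphaOf ((n : ℝ) + 1) s lam := by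
  rw [← sqrt_coupling_sq hn hκ, sigmaOf, rhoOf, alphaOf]; ring

lemma rhoOf_sq (hn : 3 ≤ n) (hκ : 0 < κ) : κ * rhoOf n κ lam ^ 2 = (n - 1) * lam ^ 2 := by
  rw [← sqrt_coupling_sq hn hκ, rhoOf]; ring

lemma kOf_mul_sigmaOf (hn : 3 ≤ n) (hκ : 0 < κ) :
    kOf ((n : ℝ) + 1) κ lam * sigmaOf n κ s lam = alphaOf ((n : ℝ) + 1) s lam := by
  have := sqrt_coupling_mul hn hκ
  rw [kOf, sigmaOf, alphaOf]
  linear_combination (lam * (s * (1 / Real.sqrt ((n : ℝ) + 1 - 3 + lam ^ 2)))) * this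

lemma kOf_mul_rhoOf (hn : 3 ≤ n) (hκ : 0 < κ) :
    kOf ((n : ℝ) + 1) κ lam * rhoOf n κ lam = lam ^ 2 := by
  have := sqrt_coupling_mul hn hκ
  rw [kOf, rhoOf]
  linear_combination lam ^ 2 * this

lemma kOf_eq (hn : 3 ≤ n) (hκ : 0 < κ) :
    (n - 1) * kOf ((n : ℝ) + 1) κ lam = κ * rhoOf n κ lam := by
  have := sqrt_coupling_mul hn hκ
  rw [← sqrt_coupling_sq hn hκ, kOf, rhoOf]
  linear_combination (κ * Real.sqrt (((n : ℝ) + 1 - 2) / κ) * lam) * this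

lemma genPotential_eq (hn : 3 ≤ n) (hκ : 0 < κ) (v r : ℝ) :
    genPotential ((n : ℝ) + 1) κ ε lam q β (sigmaOf n κ s lam * v + rhoOf n κ lam * r) =
      W0Of ((n : ℝ) + 1) κ ε lam q β *
        Real.exp (-2 * (alphaOf ((n : ℝ) + 1) s lam * v) - 2 * (lam ^ 2 * r)) := by
  rw [genPotential, ← kOf_mul_sigmaOf hn hκ, ← kOf_mul_rhoOf hn hκ]
  congr 2
  ring

lemma W0Of_eq (hκ : 0 < κ) : 2 * κ * W0Of ((n : ℝ) + 1) κ ε lam q β =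
    -ε * ((n - 1) * (n - lam ^ 2)) * (q ^ 2 * β) := by
  rw [W0Of]; field_simp; ring

/-- The distinguished coupling `λ = s/√(N-1)`, at which a seed with `Λ ≠ 0` is admitted. -/
lemma special_lam_sq (hn : 3 ≤ n) (hs : s = 1 ∨ s = -1)
    (hlam : lam = s / Real.sqrt ((n : ℝ) + 1 - 1)) : n * lam ^ 2 = 1 := by
  have hn' : (3 : ℝ) ≤ n := by exact_mod_cast hn
  rw [hlam, div_pow, Real.sq_sqrt (by linarith), pow_two, sign_mul_self hs,
    show (n : ℝ) + 1 - 1 = n by ring]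
  field_simp

lemma special_alphaOf (hn : 3 ≤ n) (hs : s = 1 ∨ s = -1)
    (hlam : lam = s / Real.sqrt ((n : ℝ) + 1 - 1)) :
    (n - 1) * alphaOf ((n : ℝ) + 1) s lam = 1 := by
  have hn' : (3 : ℝ) ≤ n := by exact_mod_cast hn
  have h1 := alphaOf_sq (lam := lam) hn hs
  have h2 := special_lam_sq hn hs hlam
  have h3 : ((n - 1) * alphaOf ((n : ℝ) + 1) s lam) ^ 2 = 1 := by
    linear_combination (n : ℝ) * h1 + (1 - alphaOf ((n : ℝ) + 1) s lam ^ 2) * h2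
  have h4 : 0 ≤ alphaOf ((n : ℝ) + 1) s lam := by
    have : s * lam = s * s / Real.sqrt ((n : ℝ) + 1 - 1) := by rw [hlam]; ring
    rw [alphaOf, ← mul_div_assoc, this, sign_mul_self hs]
    positivity
  have h5 : 0 ≤ (n - 1) * alphaOf ((n : ℝ) + 1) s lam := mul_nonneg (by linarith) h4
  nlinarith

lemma LambdaOf_of_mul_eq_zero (N : ℝ) (h : q ^ 2 * (β - 1) = 0) : LambdaOf N ε s lam q β = 0 := by
  rw [LambdaOf, h, mul_zero]

lemma special_LambdaOf (hn : 3 ≤ n) (hs : s = 1 ∨ s = -1)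
    (hlam : lam = s / Real.sqrt ((n : ℝ) + 1 - 1)) :
    2 * n * LambdaOf ((n : ℝ) + 1) ε s lam q β = ε * (n - 1) ^ 3 * (q ^ 2 * (1 - β)) := by
  have hn' : (3 : ℝ) ≤ n := by exact_mod_cast hn
  have h1 := special_alphaOf hn hs hlam
  have h2 := special_lam_sq hn hs hlam
  have ha : alphaOf ((n : ℝ) + 1) s lam = 1 / (n - 1) := by
    rw [eq_div_iff (by linarith)]; linarith
  have hl : lam ^ 2 = 1 / n := by rw [eq_div_iff (by linarith)]; linarith
  rw [LambdaOf, ha, hl]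
  have h3 : (n : ℝ) + 1 - 1 - 2 * (1 / (n - 1)) = (n - 2) * (n + 1) / (n - 1) := by
    have : (n : ℝ) - 1 ≠ 0 := by linarith
    field_simp; ring
  rw [h3]
  have h4 : (n : ℝ) - 1 ≠ 0 := by linarith
  have h5 : (n : ℝ) - 2 ≠ 0 := by linarith
  have h6 : (n : ℝ) + 1 ≠ 0 := by linarith
  have h7 : (n : ℝ) ≠ 0 := by linarith
  field_simp
  ring

/-- The relation between `Λ` and the parameters makes the `Λ`-dependent terms of the field
equations balance the terms with `1 - b²`. -/
lemma Lambda_balance (hn : 3 ≤ n) (κ : ℝ) (hs : s = 1 ∨ s = -1)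
    (hpar : q = 0 ∨ β = 1 ∨ lam = s / Real.sqrt ((n : ℝ) + 1 - 1))
    (hLam : Lam = LambdaOf ((n : ℝ) + 1) ε s lam q β) (v r : ℝ) :
    (2 * alphaOf ((n : ℝ) + 1) s lam * Lam / (n - 1) *
        Real.exp (-2 * ((1 - gammaOf ((n : ℝ) + 1) s lam) * v) - 2 * r) =
      ε * (n - 1) * lam ^ 2 * (q ^ 2 * (1 - β)) *
        Real.exp (-2 * (alphaOf ((n : ℝ) + 1) s lam * v) - 2 * r)) ∧
    (2 * (2 - gammaOf ((n : ℝ) + 1) s lam) * Lam / (n - 1) *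
        Real.exp (-2 * ((1 - gammaOf ((n : ℝ) + 1) s lam) * v) - 2 * r) =
      ε * (n - 1) * (q ^ 2 * (1 - β)) *
        Real.exp (-2 * (alphaOf ((n : ℝ) + 1) s lam * v) - 2 * r)) ∧
    (2 * sigmaOf n κ s lam * Lam / (n - 1) *
        Real.exp (-2 * ((1 - gammaOf ((n : ℝ) + 1) s lam) * v) - 2 * r) =
      ε * (n - 1) * rhoOf n κ lam * (q ^ 2 * (1 - β)) *
        Real.exp (-2 * (alphaOf ((n : ℝ) + 1) s lam * v) - 2 * r)) := by
  have hn' : (3 : ℝ) ≤ n := by exact_mod_cast hn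
  have trivial_case : q ^ 2 * (1 - β) = 0 → Lam = 0 := fun h0 => by
    rw [hLam, LambdaOf_of_mul_eq_zero _ (by linarith)]
  by_cases hz : q ^ 2 * (1 - β) = 0
  · rw [hz, trivial_case hz]; simp
  have hlam : lam = s / Real.sqrt ((n : ℝ) + 1 - 1) := by
    rcases hpar with h0 | h0 | h0
    · simp [h0] at hz
    · simp [h0] at hz
    · exact h0
  have ha := special_alphaOf hn hs hlam
  have hl := special_lam_sq hn hs hlam
  have hL := special_LambdaOf (ε := ε) (q := q) (β := β) hn hs hlam
  rw [← hLam] at hL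
  have hg := gammaOf_eq hn s lam
  have h4 : (n : ℝ) - 1 ≠ 0 := by linarith
  have h7 : (n : ℝ) ≠ 0 := by linarith
  have h8 : (n : ℝ) - 2 ≠ 0 := by linarith
  have hg' : 1 - gammaOf ((n : ℝ) + 1) s lam = alphaOf ((n : ℝ) + 1) s lam := by
    refine mul_left_cancel₀ h8 ?_
    linear_combination -hg - ha
  have hσ : sigmaOf n κ s lam * (n - 1) = n * rhoOf n κ lam := by
    have h9 : alphaOf ((n : ℝ) + 1) s lam * lam = lam ^ 2 *
        (s * (1 / Real.sqrt ((n : ℝ) + 1 - 3 + lam ^ 2))) := by rw [alphaOf]; ring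
    rw [sigmaOf, rhoOf]
    have h10 : s * (1 / Real.sqrt ((n : ℝ) + 1 - 3 + lam ^ 2)) * (n - 1) = n * lam := by
      linear_combination (-(n : ℝ) * (n - 1)) * h9 + n * lam * ha
        - (s * (1 / Real.sqrt ((n : ℝ) + 1 - 3 + lam ^ 2)) * (n - 1)) * hl
    linear_combination Real.sqrt (((n : ℝ) + 1 - 2) / κ) * h10
  have hγ2 : 2 - gammaOf ((n : ℝ) + 1) s lam = 1 + alphaOf ((n : ℝ) + 1) s lam := by linarith
  rw [hγ2, hg']
  refine ⟨?_, ?_, ?_⟩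
  · congr 1
    rw [div_eq_iff h4]
    refine mul_left_cancel₀ h7 ?_
    linear_combination alphaOf ((n : ℝ) + 1) s lam * hL +
      (ε * (n - 1) ^ 2 * (q ^ 2 * (1 - β))) * (ha - hl)
  · congr 1
    rw [div_eq_iff h4]
    refine mul_left_cancel₀ h7 ?_
    linear_combination (1 + alphaOf ((n : ℝ) + 1) s lam) * hL +
      (ε * (n - 1) ^ 2 * (q ^ 2 * (1 - β))) * ha
  · congr 1
    rw [div_eq_iff h4]
    refine mul_left_cancel₀ h7 ?_
    linear_combination sigmaOf n κ s lam * hL + (ε * (n - 1) ^ 2 * (q ^ 2 * (1 - β))) * hσ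

end Parameters

/-! ### Members of the family solve the field equations -/

section Forward

lemma IsScalarSolution.congr {N : ℕ} {κ : ℝ} {Ω : Set (Fin N → ℝ)}
    {g g' : (Fin N → ℝ) → Matrix (Fin N) (Fin N) ℝ} {φ φ' : (Fin N → ℝ) → ℝ} {W : ℝ → ℝ}
    (h : IsScalarSolution κ Ω g φ W) (hΩ : IsOpen Ω) (hg : ∀ p ∈ Ω, g' p = g p)
    (hφ : ∀ p ∈ Ω, φ' p = φ p) : IsScalarSolution κ Ω g' φ' W := by
  have eg : ∀ p ∈ Ω, g' =ᶠ[𝓝 p] g := fun p hp =>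
    Filter.eventuallyEq_of_mem (hΩ.mem_nhds hp) hg
  have eφ : ∀ p ∈ Ω, φ' =ᶠ[𝓝 p] φ := fun p hp =>
    Filter.eventuallyEq_of_mem (hΩ.mem_nhds hp) hφ
  exact
    { metric :=
      { smooth := fun i j => (h.metric.smooth i j).congr fun p hp => by rw [hg p hp]
        symm := fun p hp => by rw [hg p hp]; exact h.metric.symm p hp
        nondeg := fun p hp => by rw [hg p hp]; exact h.metric.nondeg p hp }
      smooth := h.smooth.congr hφ
      einstein := fun p hp i j => by
        rw [ricci_congr (eg p hp), pd_congr (eφ p hp), pd_congr (eφ p hp), hg p hp, hφ p hp]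
        exact h.einstein p hp i j
      scalar := fun p hp => by
        rw [box_congr (eg p hp) (eφ p hp), hφ p hp]
        exact h.scalar p hp }

variable {n : ℕ} {κ ε s lam q β Lam : ℝ} {I : Set ℝ} {U : Set (Fin n → ℝ)}
  {V : (Fin n → ℝ) → ℝ} {h : (Fin n → ℝ) → Matrix (Fin n) (Fin n) ℝ} {P R : ℝ → ℝ}

/-- The field equations reduce to the first integral `R'² e^{2(R-P)} = q² D` and its derivative,
in whatever way the coordinate `y` is chosen. -/
theorem isScalarSolution_twisted (hseed : IsSeed ε Lam U V h) (hε : ε * ε = 1) (hn : 3 ≤ n)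
    (hκ : 0 < κ) (hs : s = 1 ∨ s = -1)
    (hpar : q = 0 ∨ β = 1 ∨ lam = s / Real.sqrt ((n : ℝ) + 1 - 1))
    (hLam : Lam = LambdaOf ((n : ℝ) + 1) ε s lam q β) (hI : IsOpen I)
    (hP : ContDiffOn ℝ ∞ P I) (hR : ContDiffOn ℝ ∞ R I)
    (h1 : ∀ y ∈ I, deriv R y ^ 2 * Real.exp (2 * (R y - P y)) =
      q ^ 2 * (β * Real.exp (2 * ((1 - lam ^ 2) * R y)) + 1 - β))
    (h2 : ∀ y ∈ I, (deriv (deriv R) y + deriv R y ^ 2 - deriv P y * deriv R y) *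
      Real.exp (2 * (R y - P y)) =
        (1 - lam ^ 2) * (q ^ 2 * β) * Real.exp (2 * ((1 - lam ^ 2) * R y))) :
    IsScalarSolution κ (slab I U)
      (twisted ε (alphaOf ((n : ℝ) + 1) s lam) (-gammaOf ((n : ℝ) + 1) s lam) V h P R)
      (fun p => sigmaOf n κ s lam * V (Fin.tail p) + rhoOf n κ lam * R (p 0))
      (genPotential ((n : ℝ) + 1) κ ε lam q β) := by
  have hn' : (3 : ℝ) ≤ n := by exact_mod_cast hn
  have hn1 : (n : ℝ) - 1 ≠ 0 := by linarith
  set α := alphaOf ((n : ℝ) + 1) s lam with hα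
  set γ := gammaOf ((n : ℝ) + 1) s lam with hγd
  set σ := sigmaOf n κ s lam with hσ
  set ρ := rhoOf n κ lam with hρ
  have hγ : ((n : ℝ) - 2) * γ = α + (n - 3) := gammaOf_eq hn s lam
  have D := isWarpData_twisted hε hI hseed.isOpen hseed.smooth hseed.metric hP hR α (-γ)
  have hu : ContDiffOn ℝ ∞ (fun y => ρ * R y) I := contDiffOn_const.mul hR
  have hW0 := W0Of_eq (n := n) (ε := ε) (lam := lam) (q := q) (β := β) hκ
  have hW1 : κ * (2 / ((n : ℝ) - 1)) * W0Of ((n : ℝ) + 1) κ ε lam q β =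
      -ε * (n - lam ^ 2) * (q ^ 2 * β) := by
    refine mul_left_cancel₀ hn1 ?_
    rw [← sub_eq_zero]
    field_simp
    linear_combination hW0
  have hN : 2 / (((n + 1 : ℕ) : ℝ) - 2) = 2 / (n - 1) := by
    push_cast; rw [show (n : ℝ) + 1 - 2 = n - 1 by ring]
  have hdu : ∀ y ∈ I, deriv (fun y => ρ * R y) y = ρ * deriv R y := fun y hy =>
    deriv_const_mul _ (differentiableAt_of_smooth_real hI hR hy)
  have hddu : ∀ y ∈ I, deriv (deriv fun y => ρ * R y) y = ρ * deriv (deriv R) y := fun y hy => by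
    rw [Filter.EventuallyEq.deriv_eq (Filter.eventuallyEq_of_mem (hI.mem_nhds hy) hdu),
      deriv_const_mul _ (differentiableAt_of_smooth_real hI (contDiffOn_deriv hI hR) hy)]
  have hκσ := sigmaOf_sq (lam := lam) hn hκ hs
  have hκσρ := sigmaOf_mul_rhoOf (s := s) (lam := lam) hn hκ
  have hκρ := rhoOf_sq (lam := lam) hn hκ
  -- the exponentials of the reduced equations in terms of one of them
  have hexp : ∀ p : Fin (n + 1) → ℝ,
      Real.exp (-2 * (α * V (Fin.tail p) + P (p 0))) =
        Real.exp (-2 * (α * V (Fin.tail p)) - 2 * R (p 0)) * Real.exp (2 * (R (p 0) - P (p 0))) :=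
    fun p => by rw [← Real.exp_add]; ring_nf
  have hexp' : ∀ p : Fin (n + 1) → ℝ,
      Real.exp (-2 * (α * V (Fin.tail p)) - 2 * (lam ^ 2 * R (p 0))) =
        Real.exp (-2 * (α * V (Fin.tail p)) - 2 * R (p 0)) *
          Real.exp (2 * ((1 - lam ^ 2) * R (p 0))) :=
    fun p => by rw [← Real.exp_add]; ring_nf
  refine ⟨D.isMetricOn, ?_, ?_, ?_⟩
  · exact (contDiffOn_const.mul (contDiffOn_comp_tail hseed.smooth)).add (contDiffOn_comp_zero hu)
  · intro p hp i j
    obtain ⟨hA, hB, -⟩ := Lambda_balance hn κ hs hpar hLam (V (Fin.tail p)) (R (p 0))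
    have g1 := h1 _ hp.1
    have g2 := h2 _ hp.1
    have hE := IsWarpData.exp_cancel (α * V (Fin.tail p) + P (p 0))
    rw [genPotential_eq hn hκ, hN]
    refine Fin.cases ?_ (fun i => ?_) i <;> refine Fin.cases ?_ (fun j => ?_) j
    · rw [ricci_derived_zero_zero hseed hε hn hI hP hR hγ hp, pd_zero_field D hp σ hseed.smooth hu,
        hdu _ hp.1, twisted_zero_zero, hA, ← hα, hexp p, hexp' p]
      rw [hexp p] at hE
      set E := Real.exp (-2 * (α * V (Fin.tail p)) - 2 * R (p 0))
      set A := Real.exp (2 * (α * V (Fin.tail p) + P (p 0)))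
      set X := Real.exp (2 * (R (p 0) - P (p 0)))
      set B := Real.exp (2 * ((1 - lam ^ 2) * R (p 0)))
      linear_combination (A * E * ((n - 1) * lam ^ 2 * (q ^ 2 * (1 - β)) -
          n * X * (deriv (deriv R) (p 0) + deriv R (p 0) ^ 2 - deriv P (p 0) * deriv R (p 0)))
          + A * E * B * (n - lam ^ 2) * (q ^ 2 * β)) * hε
        - n * A * E * g2 - deriv R (p 0) ^ 2 * hκρ - (n - 1) * lam ^ 2 * E * A * g1
        + (n - 1) * lam ^ 2 * deriv R (p 0) ^ 2 * hE - ε * A * E * B * hW1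
    · rw [ricci_twisted_zero_succ D hp, pd_zero_field D hp σ hseed.smooth hu,
        pd_succ_field D hp σ hseed.smooth hu, hdu _ hp.1, twisted_zero_succ]
      linear_combination (-deriv R (p 0) * pd j V (Fin.tail p)) * hκσρ
    · rw [ricci_twisted_succ_zero D hp, pd_zero_field D hp σ hseed.smooth hu,
        pd_succ_field D hp σ hseed.smooth hu, hdu _ hp.1, twisted_succ_zero]
      linear_combination (-deriv R (p 0) * pd i V (Fin.tail p)) * hκσρ
    · rw [ricci_derived_succ_succ hseed hε hn hI hP hR hγ hp,
        pd_succ_field D hp σ hseed.smooth hu, pd_succ_field D hp σ hseed.smooth hu,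
        twisted_succ_succ, hB, ← hα, hexp p, hexp' p, ← hκσ]
      set E := Real.exp (-2 * (α * V (Fin.tail p)) - 2 * R (p 0))
      set G := Real.exp (2 * (-γ * V (Fin.tail p)) + 2 * R (p 0))
      set B := Real.exp (2 * ((1 - lam ^ 2) * R (p 0)))
      linear_combination (-G * h (Fin.tail p) i j * ε * E) * (g2 + (n - 1) * g1)
        - G * h (Fin.tail p) i j * E * B * hW1
  · intro p hp
    obtain ⟨-, -, hC⟩ := Lambda_balance hn κ hs hpar hLam (V (Fin.tail p)) (R (p 0))
    have g1 := h1 _ hp.1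
    have g2 := h2 _ hp.1
    have hd : ∀ t, HasDerivAt (genPotential ((n : ℝ) + 1) κ ε lam q β)
        (-2 * kOf ((n : ℝ) + 1) κ lam * genPotential ((n : ℝ) + 1) κ ε lam q β t) t := by
      intro t
      have := (((hasDerivAt_id t).const_mul (-2 * kOf ((n : ℝ) + 1) κ lam)).exp).const_mul
        (W0Of ((n : ℝ) + 1) κ ε lam q β)
      refine this.congr_deriv ?_
      rw [genPotential]
      simp only [id_eq]
      ring
    refine (hd _).congr_deriv ?_
    have hk := kOf_eq (lam := lam) hn hκ
    have e1 : α + ((n : ℝ) - 2) * -γ = 3 - n := by linear_combination -hγ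
    have e2 : Real.exp (-2 * (-γ * V (Fin.tail p)) - 2 * R (p 0)) * Real.exp (-2 * V (Fin.tail p))
        = Real.exp (-2 * ((1 - γ) * V (Fin.tail p)) - 2 * R (p 0)) := by
      rw [← Real.exp_add]; ring_nf
    have e3 : 2 * kOf ((n : ℝ) + 1) κ lam * W0Of ((n : ℝ) + 1) κ ε lam q β
        = - (ρ * ε * (n - lam ^ 2) * (q ^ 2 * β)) := by
      refine mul_left_cancel₀ hn1 ?_
      linear_combination (2 * W0Of ((n : ℝ) + 1) κ ε lam q β) * hk + ρ * hW0
    rw [genPotential_eq hn hκ, box_twisted D hseed.metric hseed.smooth hp σ hu, e1,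
      hseed.box_eq hε hn hp.2, hdu _ hp.1, hddu _ hp.1, ← hα, hexp p, hexp' p]
    rw [← e2] at hC
    set E := Real.exp (-2 * (α * V (Fin.tail p)) - 2 * R (p 0))
    set B := Real.exp (2 * ((1 - lam ^ 2) * R (p 0)))
    linear_combination (-E * B) * e3 - (ε * ρ * E) * (g2 + (n - 1) * g1) + hC

end Forward

/-! ### Rectifying an autonomous equation -/

section Autonomous

/-- An autonomous equation `Y' = f(Y)` with `f > 0` smooth on an open interval `J` has a solution
that is a diffeomorphism onto `J`: the inverse of a primitive of `1 / f`. -/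
theorem exists_isCoordChange {J : Set ℝ} {f : ℝ → ℝ} (hJ : IsOpen J) (hJc : J.OrdConnected)
    (hf : ContDiffOn ℝ ∞ f J) (hpos : ∀ t ∈ J, 0 < f t) {t₀ : ℝ} (ht₀ : t₀ ∈ J) :
    ∃ (I : Set ℝ) (Y : ℝ → ℝ), IsCoordChange Y I J ∧ ∀ y ∈ I, deriv Y y = f (Y y) := by
  set G : ℝ → ℝ := fun t => ∫ r in t₀..t, (f r)⁻¹ with hG
  have hfi : ContDiffOn ℝ ∞ (fun r => (f r)⁻¹) J := hf.inv fun t ht => (hpos t ht).ne'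
  have hGd : ∀ t ∈ J, HasDerivAt G (f t)⁻¹ t := by
    intro t ht
    refine intervalIntegral.integral_hasDerivAt_right ?_
      (hfi.continuousOn.stronglyMeasurableAtFilter hJ t ht) (hfi.continuousOn.continuousAt
        (hJ.mem_nhds ht))
    exact (hfi.continuousOn.mono (hJc.uIcc_subset ht₀ ht)).intervalIntegrable
  have hGs : ContDiffOn ℝ ∞ G J := by
    rw [contDiffOn_infty_iff_deriv_of_isOpen hJ]
    exact ⟨fun t ht => (hGd t ht).differentiableAt.differentiableWithinAt,
      hfi.congr fun t ht => (hGd t ht).deriv⟩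
  have hmono : StrictMonoOn G J := by
    refine strictMonoOn_of_deriv_pos hJc.convex hGs.continuousOn fun t ht => ?_
    rw [(hGd t (interior_subset ht)).deriv]
    exact inv_pos.2 (hpos t (interior_subset ht))
  set Y := Function.invFunOn G J with hY
  have hYG : ∀ t ∈ J, Y (G t) = t := fun t ht => hmono.injOn.leftInvOn_invFunOn ht
  -- near `G t` the inverse is the one of the inverse function theorem
  have hloc : ∀ t ∈ J, ContDiffAt ℝ ∞ Y (G t) ∧ G '' J ∈ 𝓝 (G t) := by
    intro t ht
    have hne : (f t)⁻¹ ≠ 0 := (inv_pos.2 (hpos t ht)).ne'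
    have hc : ContDiffAt ℝ ∞ G t := hGs.contDiffAt (hJ.mem_nhds ht)
    have hd : HasFDerivAt G (ContinuousLinearEquiv.unitsEquivAut ℝ (Units.mk0 _ hne) : ℝ →L[ℝ] ℝ)
        t := (hGd t ht).hasFDerivAt_equiv hne
    have hn : (∞ : WithTop ℕ∞) ≠ 0 := by simp
    have hst := hc.hasStrictFDerivAt' hd hn
    have hL : ContDiffAt ℝ ∞ (hst.localInverse G _ t) (G t) := hc.to_localInverse hd hn
    have hr := hst.eventually_right_inverse
    have ht' : hst.localInverse G _ t (G t) = t := hst.localInverse_apply_image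
    have hmem : ∀ᶠ y in 𝓝 (G t), hst.localInverse G _ t y ∈ J :=
      hL.continuousAt.eventually_mem (by rw [ht']; exact hJ.mem_nhds ht)
    refine ⟨hL.congr_of_eventuallyEq ?_, ?_⟩
    · filter_upwards [hr, hmem] with y hy hyJ
      conv_lhs => rw [← hy]
      exact hYG _ hyJ
    · filter_upwards [hr, hmem] with y hy hyJ
      exact ⟨_, hyJ, hy⟩
  have hYd : ∀ t ∈ J, HasDerivAt Y (f t) (G t) := by
    intro t ht
    have h1 := ((hloc t ht).1.differentiableAt (by simp)).hasDerivAt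
    have h2 : HasDerivAt (fun r => Y (G r)) (deriv Y (G t) * (f t)⁻¹) t := h1.comp t (hGd t ht)
    have h3 : HasDerivAt (fun r => Y (G r)) 1 t :=
      (hasDerivAt_id t).congr_of_eventuallyEq
        (Filter.eventuallyEq_of_mem (hJ.mem_nhds ht) hYG)
    have h4 := h2.unique h3
    rw [mul_inv_eq_one₀ (hpos t ht).ne'] at h4
    rwa [h4] at h1
  refine ⟨G '' J, Y, ⟨?_, ?_, ?_, ?_, ?_⟩, ?_⟩
  · rw [isOpen_iff_mem_nhds]
    rintro _ ⟨t, ht, rfl⟩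
    exact (hloc t ht).2
  · exact (hJc.isPreconnected.image G hGs.continuousOn).ordConnected
  · rintro _ ⟨t, ht, rfl⟩
    exact (hloc t ht).1.contDiffWithinAt
  · refine ⟨?_, ?_, ?_⟩
    · rintro _ ⟨t, ht, rfl⟩
      rw [hYG t ht]; exact ht
    · rintro _ ⟨t, ht, rfl⟩ _ ⟨r, hr, rfl⟩ he
      rw [hYG t ht, hYG r hr] at he
      rw [he]
    · intro t ht
      exact ⟨G t, ⟨t, ht, rfl⟩, hYG t ht⟩
  · rintro _ ⟨t, ht, rfl⟩
    rw [(hYd t ht).deriv]; exact (hpos t ht).ne'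
  · rintro _ ⟨t, ht, rfl⟩
    rw [(hYd t ht).deriv, hYG t ht]

variable {lam q β : ℝ}

lemma contDiff_denom : ContDiff ℝ ∞ (denom lam q β) := by
  unfold denom; fun_prop

lemma hasDerivAt_denom (y : ℝ) : HasDerivAt (denom lam q β)
    (2 * ((1 - lam ^ 2) * q * β * Real.exp (2 * ((1 - lam ^ 2) * (q * y))))) y := by
  have h := (((((hasDerivAt_id y).const_mul q).const_mul (2 * (1 - lam ^ 2))).exp.const_mul
    β).add_const 1).sub_const β
  refine h.congr_deriv ?_
  simp only [id_eq]
  rw [show 2 * (1 - lam ^ 2) * (q * y) = 2 * ((1 - lam ^ 2) * (q * y)) by ring]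
  ring

lemma isOpen_denom_pos : IsOpen {y | 0 < denom lam q β y} :=
  isOpen_lt continuous_const contDiff_denom.continuous

lemma denom_zero : denom lam q β 0 = 1 := by simp [denom]

lemma ordConnected_denom_pos : {y | 0 < denom lam q β y}.OrdConnected := by
  have hc : Monotone (denom lam q β) ∨ Antitone (denom lam q β) := by
    rcases le_total 0 ((1 - lam ^ 2) * q) with h1 | h1 <;> rcases le_total 0 β with h2 | h2
    · left; intro a b hab
      have : (1 - lam ^ 2) * q * a ≤ (1 - lam ^ 2) * q * b := mul_le_mul_of_nonneg_left hab h1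
      have := mul_le_mul_of_nonneg_left (Real.exp_le_exp.2
        (by linarith : 2 * (1 - lam ^ 2) * (q * a) ≤ 2 * (1 - lam ^ 2) * (q * b))) h2
      unfold denom; linarith
    · right; intro a b hab
      have : (1 - lam ^ 2) * q * a ≤ (1 - lam ^ 2) * q * b := mul_le_mul_of_nonneg_left hab h1
      have := mul_le_mul_of_nonpos_left (Real.exp_le_exp.2
        (by linarith : 2 * (1 - lam ^ 2) * (q * a) ≤ 2 * (1 - lam ^ 2) * (q * b))) h2
      unfold denom; linarith
    · right; intro a b hab
      have : (1 - lam ^ 2) * q * b ≤ (1 - lam ^ 2) * q * a := mul_le_mul_of_nonpos_left hab h1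
      have := mul_le_mul_of_nonneg_left (Real.exp_le_exp.2
        (by linarith : 2 * (1 - lam ^ 2) * (q * b) ≤ 2 * (1 - lam ^ 2) * (q * a))) h2
      unfold denom; linarith
    · left; intro a b hab
      have : (1 - lam ^ 2) * q * b ≤ (1 - lam ^ 2) * q * a := mul_le_mul_of_nonpos_left hab h1
      have := mul_le_mul_of_nonpos_left (Real.exp_le_exp.2
        (by linarith : 2 * (1 - lam ^ 2) * (q * b) ≤ 2 * (1 - lam ^ 2) * (q * a))) h2
      unfold denom; linarith
  rcases hc with hc | hc
  · exact Set.ordConnected_Ioi.preimage_mono hc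
  · exact Set.ordConnected_Ioi.preimage_anti hc

end Autonomous

/-! ### The family in the coordinates of the general form and of the template -/

section Family

variable {n : ℕ} {κ ε s lam q β Lam : ℝ} {I : Set ℝ} {U : Set (Fin n → ℝ)}
  {V : (Fin n → ℝ) → ℝ} {h : (Fin n → ℝ) → Matrix (Fin n) (Fin n) ℝ}

lemma templateMetric_eq_twisted (α δ : ℝ) (μ : ℝ → ℝ) :
    templateMetric ε V h α δ μ = twisted ε α (-(α + δ)) V h μ μ := by
  funext p
  ext i j
  refine Fin.cases ?_ (fun i => ?_) i <;> refine Fin.cases ?_ (fun j => ?_) j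
  · rw [twisted_zero_zero, templateMetric, Matrix.smul_apply, orthMatrix_zero_zero, smul_eq_mul,
      mul_add, Real.exp_add]
    ring
  · simp [twisted_zero_succ, templateMetric]
  · simp [twisted_succ_zero, templateMetric]
  · rw [twisted_succ_succ, templateMetric, Matrix.smul_apply, orthMatrix_succ_succ,
      Matrix.smul_apply, smul_eq_mul, smul_eq_mul, ← Real.exp_add, ← mul_assoc, ← Real.exp_add]
    congr 2; ring

/-- The general form over `D > 0`, with `P = qY - log D / 2` and `R = qY`. -/
lemma genMetric_eq_twisted {p : Fin (n + 1) → ℝ} (hp : 0 < denom lam q β (p 0)) :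
    genMetric ε V h s lam q β p = twisted ε (alphaOf ((n : ℝ) + 1) s lam)
      (-gammaOf ((n : ℝ) + 1) s lam) V h
      (fun y => q * y - Real.log (denom lam q β y) / 2) (fun y => q * y) p := by
  ext i j
  refine Fin.cases ?_ (fun i => ?_) i <;> refine Fin.cases ?_ (fun j => ?_) j
  · rw [twisted_zero_zero, genMetric, orthMatrix_zero_zero]
    have : 2 * (alphaOf ((n : ℝ) + 1) s lam * V (Fin.tail p) +
        (q * p 0 - Real.log (denom lam q β (p 0)) / 2))
        = 2 * (alphaOf ((n : ℝ) + 1) s lam * V (Fin.tail p) + q * p 0)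
          - Real.log (denom lam q β (p 0)) := by ring
    rw [this, Real.exp_sub, Real.exp_log hp]
  · rfl
  · rfl
  · rw [twisted_succ_succ, genMetric, orthMatrix_succ_succ, Matrix.smul_apply, smul_eq_mul]
    congr 2; ring

lemma genField_eq (p : Fin (n + 1) → ℝ) : genField κ V s lam q p =
    sigmaOf n κ s lam * V (Fin.tail p) + rhoOf n κ lam * (q * p 0) := by
  rw [genField, sigmaOf, rhoOf]; ring

lemma pullY_genMetric (Y : ℝ → ℝ) (p : Fin (n + 1) → ℝ) :
    pullY Y (genMetric ε V h s lam q β) p = orthMatrix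
      (deriv Y (p 0) ^ 2 * (ε * (Real.exp (2 * (alphaOf ((n : ℝ) + 1) s lam * V (Fin.tail p)
        + q * Y (p 0))) / denom lam q β (Y (p 0)))))
      (Real.exp (-2 * (gammaOf ((n : ℝ) + 1) s lam * V (Fin.tail p)) + 2 * (q * Y (p 0))) •
        h (Fin.tail p)) := by
  have h0 : changeY Y p 0 = Y (p 0) := rfl
  have ht : Fin.tail (changeY Y p) = Fin.tail p := by simp [changeY]
  ext i j
  rw [pullY, Matrix.mul_diagonal, Matrix.diagonal_mul, genMetric, h0, ht]
  refine Fin.cases ?_ (fun i => ?_) i <;> refine Fin.cases ?_ (fun j => ?_) j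
  · simp only [orthMatrix_zero_zero, Fin.cons_zero]; ring
  · simp
  · simp
  · simp

/-- In a coordinate with `Y'² = D(Y)` the general form fits the template with `μ = qY`. -/
lemma pullY_genMetric_eq_twisted {Y : ℝ → ℝ} {p : Fin (n + 1) → ℝ}
    (hD : 0 < denom lam q β (Y (p 0))) (hY : deriv Y (p 0) ^ 2 = denom lam q β (Y (p 0))) :
    pullY Y (genMetric ε V h s lam q β) p = twisted ε (alphaOf ((n : ℝ) + 1) s lam)
      (-gammaOf ((n : ℝ) + 1) s lam) V h (fun y => q * Y y) (fun y => q * Y y) p := by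
  rw [pullY_genMetric, hY]
  ext i j
  refine Fin.cases ?_ (fun i => ?_) i <;> refine Fin.cases ?_ (fun j => ?_) j
  · rw [twisted_zero_zero, orthMatrix_zero_zero]
    field_simp
  · rfl
  · rfl
  · rw [twisted_succ_succ, orthMatrix_succ_succ, Matrix.smul_apply, smul_eq_mul]
    congr 2; ring

lemma IsScalarSolution.mono {N : ℕ} {Ω Ω' : Set (Fin N → ℝ)}
    {g : (Fin N → ℝ) → Matrix (Fin N) (Fin N) ℝ} {φ : (Fin N → ℝ) → ℝ} {W : ℝ → ℝ}
    (hs : IsScalarSolution κ Ω g φ W) (hΩ : Ω' ⊆ Ω) : IsScalarSolution κ Ω' g φ W where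
  metric :=
    { smooth := fun i j => (hs.metric.smooth i j).mono hΩ
      symm := fun p hp => hs.metric.symm p (hΩ hp)
      nondeg := fun p hp => hs.metric.nondeg p (hΩ hp) }
  smooth := hs.smooth.mono hΩ
  einstein p hp := hs.einstein p (hΩ hp)
  scalar p hp := hs.scalar p (hΩ hp)

theorem isScalarSolution_genMetric (hseed : IsSeed ε Lam U V h) (hε : ε * ε = 1) (hn : 3 ≤ n)
    (hκ : 0 < κ) (hs : s = 1 ∨ s = -1)
    (hpar : q = 0 ∨ β = 1 ∨ lam = s / Real.sqrt ((n : ℝ) + 1 - 1))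
    (hLam : Lam = LambdaOf ((n : ℝ) + 1) ε s lam q β) :
    IsScalarSolution κ (slab {Y | 0 < denom lam q β Y} U) (genMetric ε V h s lam q β)
      (genField κ V s lam q) (genPotential ((n : ℝ) + 1) κ ε lam q β) := by
  have hR : ContDiffOn ℝ ∞ (fun y => q * y) {y | 0 < denom lam q β y} := by fun_prop
  have hP : ContDiffOn ℝ ∞ (fun y => q * y - Real.log (denom lam q β y) / 2)
      {y | 0 < denom lam q β y} :=
    hR.sub ((contDiff_denom.contDiffOn.log fun y hy => ne_of_gt hy).div_const 2)
  have hR' : ∀ y, deriv (fun y => q * y) y = q := fun y => by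
    simp
  have hR'' : ∀ y, deriv (deriv fun y => q * y) y = 0 := fun y => by
    rw [funext hR']; simp
  have hexp : ∀ y, 0 < denom lam q β y →
      Real.exp (2 * (q * y - (q * y - Real.log (denom lam q β y) / 2))) = denom lam q β y := by
    intro y hy
    conv_rhs => rw [← Real.exp_log hy]
    congr 1; ring
  refine (isScalarSolution_twisted hseed hε hn hκ hs hpar hLam isOpen_denom_pos hP hR
    (fun y hy => ?_) fun y hy => ?_).congr (isOpen_slab isOpen_denom_pos hseed.isOpen)
    (fun p hp => genMetric_eq_twisted hp.1) fun p _ => genField_eq p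
  · rw [hR', hexp y hy, denom]
    congr 4; ring_nf
  · have hy' : denom lam q β y ≠ 0 := ne_of_gt hy
    have hP' : deriv (fun y => q * y - Real.log (denom lam q β y) / 2) y
        = q - 2 * ((1 - lam ^ 2) * q * β * Real.exp (2 * ((1 - lam ^ 2) * (q * y)))) /
          denom lam q β y / 2 := by
      have := ((hasDerivAt_id y).const_mul q).fun_sub
        (((hasDerivAt_denom (lam := lam) (q := q) (β := β) y).log hy').div_const 2)
      rw [mul_one] at this
      exact this.deriv
    rw [hR', hR'', hexp y hy, hP']
    field_simp
    ring

/-- In a coordinate with `Y'² = D(Y)` the general form is a derived solution of class `T`. -/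
theorem exists_isClassT (hseed : IsSeed ε Lam U V h) (hε : ε * ε = 1) (hn : 3 ≤ n)
    (hκ : 0 < κ) (hs : s = 1 ∨ s = -1) (hq : 0 < q)
    (hpar : β = 1 ∨ lam = s / Real.sqrt ((n : ℝ) + 1 - 1))
    (hLam : Lam = LambdaOf ((n : ℝ) + 1) ε s lam q β) :
    ∃ (I : Set ℝ) (Y : ℝ → ℝ), IsCoordChange Y I {Y | 0 < denom lam q β Y} ∧
      IsClassT κ ε U V h I (pullY Y (genMetric ε V h s lam q β))
        (fun p => genField κ V s lam q (changeY Y p))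
        (genPotential ((n : ℝ) + 1) κ ε lam q β) := by
  have h0 : (0 : ℝ) ∈ {y | 0 < denom lam q β y} := by simp [denom_zero]
  obtain ⟨I, Y, hY, hYd⟩ := exists_isCoordChange (f := fun y => Real.sqrt (denom lam q β y))
    isOpen_denom_pos ordConnected_denom_pos
    (contDiff_denom.contDiffOn.sqrt fun y hy => ne_of_gt hy) (fun y hy => Real.sqrt_pos.2 hy) h0
  have hD : ∀ y ∈ I, 0 < denom lam q β (Y y) := fun y hy => hY.bij.mapsTo hy
  have hYsq : ∀ y ∈ I, deriv Y y ^ 2 = denom lam q β (Y y) := fun y hy => by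
    rw [hYd y hy, Real.sq_sqrt (hD y hy).le]
  have hYdiff : ∀ y ∈ I, DifferentiableAt ℝ Y y := fun y hy =>
    differentiableAt_of_smooth_real hY.isOpen hY.smooth hy
  have hμ : ContDiffOn ℝ ∞ (fun y => q * Y y) I := contDiffOn_const.mul hY.smooth
  have hμ' : ∀ y ∈ I, deriv (fun y => q * Y y) y = q * deriv Y y := fun y hy =>
    deriv_const_mul _ (hYdiff y hy)
  have hμ'' : ∀ y ∈ I, deriv (deriv fun y => q * Y y) y = (1 - lam ^ 2) * (q ^ 2 * β) *
      Real.exp (2 * ((1 - lam ^ 2) * (q * Y y))) := by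
    intro y hy
    have e : deriv (fun y => q * Y y) =ᶠ[𝓝 y] fun y => q * Real.sqrt (denom lam q β (Y y)) :=
      Filter.eventuallyEq_of_mem (hY.isOpen.mem_nhds hy) fun z hz => by
        rw [hμ' z hz, hYd z hz]
    have hd := ((((hasDerivAt_denom (lam := lam) (q := q) (β := β) (Y y)).sqrt
      (hD y hy).ne').comp y (hYdiff y hy).hasDerivAt).const_mul q)
    rw [e.deriv_eq]
    refine hd.deriv.trans ?_
    rw [hYd y hy]
    have := (Real.sqrt_pos.2 (hD y hy)).ne'
    field_simp
  have hsol := isScalarSolution_twisted (κ := κ) (P := fun y => q * Y y) (R := fun y => q * Y y)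
    hseed hε hn hκ hs (Or.inr hpar) hLam hY.isOpen hμ hμ
    (fun y hy => by
      rw [hμ' y hy, mul_pow, hYsq y hy, sub_self, mul_zero, Real.exp_zero, denom]
      ring_nf)
    (fun y hy => by
      rw [← hμ'' y hy, sub_self, mul_zero, Real.exp_zero]
      ring)
  have hg : ∀ p ∈ slab I U, pullY Y (genMetric ε V h s lam q β) p = twisted ε
      (alphaOf ((n : ℝ) + 1) s lam) (-gammaOf ((n : ℝ) + 1) s lam) V h
      (fun y => q * Y y) (fun y => q * Y y) p := fun p hp =>
    pullY_genMetric_eq_twisted (hD _ hp.1) (hYsq _ hp.1)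
  have hφ : ∀ p : Fin (n + 1) → ℝ, genField κ V s lam q (changeY Y p) =
      sigmaOf n κ s lam * V (Fin.tail p) + rhoOf n κ lam * (q * Y (p 0)) := fun p => by
    rw [genField_eq]; simp [changeY]
  refine ⟨I, Y, hY, fun y => q * Y y, hμ, ?_, alphaOf ((n : ℝ) + 1) s lam,
    ((n : ℝ) + 1 - 4) / ((n : ℝ) + 1 - 3) * (1 - alphaOf ((n : ℝ) + 1) s lam),
    sigmaOf n κ s lam, rhoOf n κ lam, Or.inl rfl, ?_, fun p _ => hφ p, ?_⟩
  · -- the open set `D > 0` has a second point besides `0`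
    obtain ⟨y, hy, hy0⟩ := hY.bij.surjOn h0
    obtain ⟨t, ht, htne⟩ : ∃ t ∈ {y | 0 < denom lam q β y}, t ≠ 0 := by
      have h1 : {y | 0 < denom lam q β y} ∈ 𝓝[≠] (0 : ℝ) :=
        mem_nhdsWithin_of_mem_nhds (isOpen_denom_pos.mem_nhds h0)
      obtain ⟨t, ht⟩ := (Filter.inter_mem h1 self_mem_nhdsWithin :
        {y | 0 < denom lam q β y} ∩ {0}ᶜ ∈ 𝓝[≠] (0 : ℝ)) |> Filter.nonempty_of_mem
      exact ⟨t, ht.1, ht.2⟩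
    obtain ⟨y', hy', hyt⟩ := hY.bij.surjOn ht
    refine ⟨y, hy, y', hy', ?_⟩
    show q * Y y ≠ q * Y y'
    rw [hy0, hyt, mul_zero]
    exact (mul_ne_zero hq.ne' htne).symm
  · intro p hp
    rw [hg p hp, templateMetric_eq_twisted]
    rfl
  · exact hsol.congr (isOpen_slab hY.isOpen hseed.isOpen) hg fun p _ => hφ p

end Family

/-! ### Consequences of the field equations for a derived metric -/

section Converse

/-- A nondegenerate matrix of size at least two is not of the form `c v ⊗ v`. -/
lemma eq_zero_of_rank_one {n : ℕ} (hn : 2 ≤ n) {H : Matrix (Fin n) (Fin n) ℝ} (hH : H.det ≠ 0)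
    {v : Fin n → ℝ} {b c : ℝ} (he : ∀ i j, c * (v i * v j) + b * H i j = 0) : b = 0 := by
  by_contra hb
  have : Nontrivial (Fin n) := Fin.nontrivial_iff_two_le.2 hn
  apply hH
  have e : H = Matrix.vecMulVec (fun i => -(c / b) * v i) v := by
    ext i j
    rw [Matrix.vecMulVec_apply]
    field_simp
    linear_combination he i j
  rw [e, Matrix.det_vecMulVec]

lemma exists_pd_ne_zero {ι : Type} [Fintype ι] [DecidableEq ι] {U : Set (ι → ℝ)}
    {V : (ι → ℝ) → ℝ} (hU : IsOpen U) (hc : IsPreconnected U) (hV : ContDiffOn ℝ ∞ V U)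
    (hne : ¬ ∃ c, ∀ x ∈ U, V x = c) : ∃ x ∈ U, ∃ i, pd i V x ≠ 0 := by
  by_contra! h0
  refine hne (hU.exists_is_const_of_fderiv_eq_zero hc
    (fun x hx => (differentiableAt_of_smooth hU hV hx).differentiableWithinAt) fun x hx => ?_)
  have : (fderiv ℝ V x : (ι → ℝ) →ₗ[ℝ] ℝ) = 0 := by
    refine (Pi.basisFun ℝ ι).ext fun i => ?_
    simpa [pd] using h0 x hx i
  exact ContinuousLinearMap.coe_injective this

lemma exists_deriv_ne_zero {I : Set ℝ} {μ : ℝ → ℝ} (hI : IsOpen I) (hc : I.OrdConnected)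
    (hμ : ContDiffOn ℝ ∞ μ I) (hne : ∃ y ∈ I, ∃ y' ∈ I, μ y ≠ μ y') : ∃ y ∈ I, deriv μ y ≠ 0 := by
  by_contra! h0
  obtain ⟨y, hy, y', hy', hyy⟩ := hne
  exact hyy (hI.is_const_of_deriv_eq_zero hc.isPreconnected
    (fun y hy => (differentiableAt_of_smooth_real hI hμ hy).differentiableWithinAt) h0 hy hy')

variable {n : ℕ} {κ ε Lam α γ σ ρ : ℝ} {I : Set ℝ} {U : Set (Fin n → ℝ)} {V : (Fin n → ℝ) → ℝ}
  {h : (Fin n → ℝ) → Matrix (Fin n) (Fin n) ℝ} {μ : ℝ → ℝ} {W : ℝ → ℝ} {p : Fin (n + 1) → ℝ}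
  (hs : IsSeed ε Lam U V h) (hε : ε * ε = 1) (hn : 3 ≤ n) (hI : IsOpen I)
  (hμ : ContDiffOn ℝ ∞ μ I)
  (hsol : IsScalarSolution κ (slab I U) (twisted ε α (-γ) V h μ μ)
    (fun p => σ * V (Fin.tail p) + ρ * μ (p 0)) W)
include hs hε hn hI hμ hsol

/-- If the Hessian of `V` is not of the exceptional form, its coefficient in the Einstein equation
has to vanish. -/
lemma gamma_eq_of_generic (hgen : IsGenericSeed U V h) (hne : I.Nonempty) :
    ((n : ℝ) - 2) * γ = α + (n - 3) := by
  by_contra hγ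
  obtain ⟨y, hy⟩ := hne
  apply hgen
  have D := isWarpData_twisted hε hI hs.isOpen hs.smooth hs.metric hμ hμ α (-γ)
  have hu : ContDiffOn ℝ ∞ (fun y => ρ * μ y) I := contDiffOn_const.mul hμ
  set K : ℝ := (3 - n) - (α + ((n : ℝ) - 2) * -γ) with hK
  have hK0 : K ≠ 0 := fun h0 => hγ (by linear_combination h0 + hK)
  refine ⟨(κ * σ ^ 2 - (5 - n) - (((n : ℝ) - 2) * (-γ) ^ 2 + 2 * α * -γ - α ^ 2)) / K,
    fun x => (κ * (2 / (((n + 1 : ℕ) : ℝ) - 2) * Real.exp (2 * (-γ * V x) + 2 * μ y) *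
        W (σ * V x + ρ * μ y)) - 4 * Lam / (n - 1) * Real.exp (-2 * V x)
      + -γ * (box h V x + (α + ((n : ℝ) - 2) * -γ) * gradInner h V V x)
      + ε * Real.exp (2 * ((-γ - α) * V x) + 2 * (μ y - μ y)) *
        (deriv (deriv μ) y + n * deriv μ y ^ 2 - deriv μ y * deriv μ y)) / K,
    fun x hx i j => ?_⟩
  have hp : (Fin.cons y x : Fin (n + 1) → ℝ) ∈ slab I U := ⟨by simpa using hy, by simpa using hx⟩
  have e := hsol.einstein _ hp i.succ j.succ
  rw [ricci_twisted_succ_succ D hs.metric hs.smooth hp, pd_succ_field D hp σ hs.smooth hu,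
    pd_succ_field D hp σ hs.smooth hu, twisted_succ_succ] at e
  simp only [Fin.tail_cons, Fin.cons_zero] at e
  rw [hs.ricci_eq hε hn hx] at e
  have key : K * hess h V i j x = (κ * (2 / (((n + 1 : ℕ) : ℝ) - 2) *
        Real.exp (2 * (-γ * V x) + 2 * μ y) * W (σ * V x + ρ * μ y))
        - 4 * Lam / (n - 1) * Real.exp (-2 * V x)
      + -γ * (box h V x + (α + ((n : ℝ) - 2) * -γ) * gradInner h V V x)
      + ε * Real.exp (2 * ((-γ - α) * V x) + 2 * (μ y - μ y)) *
        (deriv (deriv μ) y + n * deriv μ y ^ 2 - deriv μ y * deriv μ y)) * h x i j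
      + (κ * σ ^ 2 - (5 - n) - (((n : ℝ) - 2) * (-γ) ^ 2 + 2 * α * -γ - α ^ 2)) *
        (pd i V x * pd j V x) := by
    linear_combination e
  rw [← mul_div_cancel_left₀ (hess h V i j x) hK0, key]
  ring

variable (hγ : ((n : ℝ) - 2) * γ = α + (n - 3)) (hp : p ∈ slab I U)

omit hs hε hn hsol in
lemma deriv_const_mul_of_smooth {y : ℝ} (hy : y ∈ I) :
    deriv (fun y => ρ * μ y) y = ρ * deriv μ y :=
  deriv_const_mul _ (differentiableAt_of_smooth_real hI hμ hy)

include hp in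
omit hn in
/-- The `dy dxⁱ` equations. -/
lemma reduced_mixed (i : Fin n) : (n - 1) * deriv μ (p 0) * (α * pd i V (Fin.tail p)) =
    κ * (ρ * deriv μ (p 0) * (σ * pd i V (Fin.tail p))) := by
  have D := isWarpData_twisted hε hI hs.isOpen hs.smooth hs.metric hμ hμ α (-γ)
  have hu : ContDiffOn ℝ ∞ (fun y => ρ * μ y) I := contDiffOn_const.mul hμ
  have e := hsol.einstein _ hp 0 i.succ
  rw [ricci_twisted_zero_succ D hp, pd_zero_field D hp σ hs.smooth hu,
    pd_succ_field D hp σ hs.smooth hu, twisted_zero_succ,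
    deriv_const_mul_of_smooth hI hμ hp.1] at e
  linear_combination e

include hγ hp

/-- The `dy²` equation. -/
lemma reduced_time : 2 * α * Lam / (n - 1) *
      Real.exp (-2 * ((1 - γ) * V (Fin.tail p)) - 2 * μ (p 0))
    - n * (ε * Real.exp (-2 * (α * V (Fin.tail p) + μ (p 0)))) * deriv (deriv μ) (p 0) =
    κ * (ε * Real.exp (-2 * (α * V (Fin.tail p) + μ (p 0))) * (ρ * deriv μ (p 0)) ^ 2 +
      2 / (n - 1) * W (σ * V (Fin.tail p) + ρ * μ (p 0))) := by
  have D := isWarpData_twisted hε hI hs.isOpen hs.smooth hs.metric hμ hμ α (-γ)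
  have hu : ContDiffOn ℝ ∞ (fun y => ρ * μ y) I := contDiffOn_const.mul hμ
  have e := hsol.einstein _ hp 0 0
  have hN : 2 / (((n + 1 : ℕ) : ℝ) - 2) = 2 / (n - 1) := by
    push_cast; rw [show (n : ℝ) + 1 - 2 = n - 1 by ring]
  rw [ricci_derived_zero_zero hs hε hn hI hμ hμ hγ hp, pd_zero_field D hp σ hs.smooth hu,
    twisted_zero_zero, deriv_const_mul_of_smooth hI hμ hp.1, hN] at e
  have hE := IsWarpData.exp_cancel (α * V (Fin.tail p) + μ (p 0))
  have hA : ε * Real.exp (2 * (α * V (Fin.tail p) + μ (p 0))) ≠ 0 := D.lapse_ne p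
  refine mul_left_cancel₀ hA ?_
  linear_combination e - κ * (ρ * deriv μ (p 0)) ^ 2 * (hε + ε * ε * hE)

/-- The `dxⁱ dxʲ` equations split into the part along `dV ⊗ dV` and the part along the
metric. -/
lemma reduced_space (i j : Fin n) :
    (((n : ℝ) - 1) * (1 - α ^ 2) / (n - 2) - κ * σ ^ 2) *
        (pd i V (Fin.tail p) * pd j V (Fin.tail p)) +
      Real.exp (2 * (-γ * V (Fin.tail p)) + 2 * μ (p 0)) *
        (2 * (2 - γ) * Lam / (n - 1) *
            Real.exp (-2 * ((1 - γ) * V (Fin.tail p)) - 2 * μ (p 0))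
          - ε * Real.exp (-2 * (α * V (Fin.tail p) + μ (p 0))) *
            (deriv (deriv μ) (p 0) + (n - 1) * deriv μ (p 0) ^ 2)
          - κ * (2 / (n - 1)) * W (σ * V (Fin.tail p) + ρ * μ (p 0))) *
      h (Fin.tail p) i j = 0 := by
  have D := isWarpData_twisted hε hI hs.isOpen hs.smooth hs.metric hμ hμ α (-γ)
  have hu : ContDiffOn ℝ ∞ (fun y => ρ * μ y) I := contDiffOn_const.mul hμ
  have e := hsol.einstein _ hp i.succ j.succ
  have hN : 2 / (((n + 1 : ℕ) : ℝ) - 2) = 2 / (n - 1) := by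
    push_cast; rw [show (n : ℝ) + 1 - 2 = n - 1 by ring]
  rw [ricci_derived_succ_succ hs hε hn hI hμ hμ hγ hp, pd_succ_field D hp σ hs.smooth hu,
    pd_succ_field D hp σ hs.smooth hu, twisted_succ_succ, hN] at e
  linear_combination e

/-- The part of the `dxⁱ dxʲ` equations along the metric: as `h` has rank at least two, it cannot
be balanced by the part along `dV ⊗ dV`. -/
lemma reduced_trace : 2 * (2 - γ) * Lam / (n - 1) *
      Real.exp (-2 * ((1 - γ) * V (Fin.tail p)) - 2 * μ (p 0))
    - ε * Real.exp (-2 * (α * V (Fin.tail p) + μ (p 0))) *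
      (deriv (deriv μ) (p 0) + (n - 1) * deriv μ (p 0) ^ 2) =
    κ * (2 / (n - 1)) * W (σ * V (Fin.tail p) + ρ * μ (p 0)) := by
  have e := eq_zero_of_rank_one (by omega) (hs.metric.nondeg _ hp.2)
    (reduced_space hs hε hn hI hμ hsol hγ hp)
  rw [mul_eq_zero, or_iff_right (Real.exp_pos _).ne'] at e
  linarith

omit hp in
/-- The part of the `dxⁱ dxʲ` equations along `dV ⊗ dV`. -/
lemma sigma_sq_of_nonconstant (hne : I.Nonempty) (hV : ¬ ∃ c, ∀ x ∈ U, V x = c) :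
    κ * σ ^ 2 = ((n : ℝ) - 1) * (1 - α ^ 2) / (n - 2) := by
  obtain ⟨y, hy⟩ := hne
  obtain ⟨x, hx, i, hi⟩ := exists_pd_ne_zero hs.isOpen hs.connected.isPreconnected hs.smooth hV
  have hp : (Fin.cons y x : Fin (n + 1) → ℝ) ∈ slab I U := ⟨by simpa using hy, by simpa using hx⟩
  have e := reduced_space hs hε hn hI hμ hsol hγ hp i i
  rw [reduced_trace hs hε hn hI hμ hsol hγ hp, sub_self, mul_zero, zero_mul, add_zero,
    mul_eq_zero] at e
  simp only [Fin.tail_cons] at e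
  rcases e with e | e
  · linarith
  · exact absurd (mul_self_eq_zero.1 e) hi

/-- Eliminating the potential leaves a second-order equation for `μ`. -/
lemma reduced_ode : ε * Real.exp (-2 * (α * V (Fin.tail p) + μ (p 0))) *
      ((n - 1) * deriv (deriv μ) (p 0) - (n - 1) * deriv μ (p 0) ^ 2
        + κ * ρ ^ 2 * deriv μ (p 0) ^ 2) =
    -(2 * (2 - γ - α) * Lam / (n - 1) *
      Real.exp (-2 * ((1 - γ) * V (Fin.tail p)) - 2 * μ (p 0))) := by
  have e1 := reduced_trace hs hε hn hI hμ hsol hγ hp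
  have e2 := reduced_time hs hε hn hI hμ hsol hγ hp
  linear_combination e1 - e2

omit hn hγ hp in
lemma mixed_of_nonconstant (hc : I.OrdConnected) (hne : ∃ y ∈ I, ∃ y' ∈ I, μ y ≠ μ y')
    (hV : ¬ ∃ c, ∀ x ∈ U, V x = c) : (n - 1) * α = κ * (σ * ρ) := by
  obtain ⟨y, hy, hy0⟩ := exists_deriv_ne_zero hI hc hμ hne
  obtain ⟨x, hx, i, hi⟩ := exists_pd_ne_zero hs.isOpen hs.connected.isPreconnected hs.smooth hV
  have hp : (Fin.cons y x : Fin (n + 1) → ℝ) ∈ slab I U := ⟨by simpa using hy, by simpa using hx⟩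
  have e := reduced_mixed hs hε hI hμ hsol hp i
  simp only [Fin.tail_cons, Fin.cons_zero] at e
  refine mul_right_cancel₀ (mul_ne_zero hy0 hi) ?_
  linear_combination e

end Converse

/-! ### Recovering the parameters -/

section Recover

variable {n : ℕ} {κ ε Lam α γ σ ρ s lam q β : ℝ}

/-- The constants of a derived solution determine `s` and `λ`. -/
lemma recover_parameters (hn : 3 ≤ n) (hκ : 0 < κ) (hs : s = 1 ∨ s = -1) (hsσ : 0 ≤ s * σ)
    (h1 : κ * σ ^ 2 = ((n : ℝ) - 1) * (1 - α ^ 2) / (n - 2)) (h2 : (n - 1) * α = κ * (σ * ρ))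
    (hρ : rhoOf n κ lam = ρ) : sigmaOf n κ s lam = σ ∧ alphaOf ((n : ℝ) + 1) s lam = α := by
  have hn' : (3 : ℝ) ≤ n := by exact_mod_cast hn
  have hn1 : (n : ℝ) - 1 ≠ 0 := by linarith
  have hn2 : (n : ℝ) - 2 ≠ 0 := by linarith
  have hr : (n : ℝ) - 2 + lam ^ 2 ≠ 0 := by nlinarith [sq_nonneg lam]
  have hκρ := rhoOf_sq (lam := lam) hn hκ
  rw [hρ] at hκρ
  rw [eq_div_iff hn2] at h1
  have e1 : (1 - α ^ 2) * (n - 2 + lam ^ 2) = n - 2 := by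
    refine mul_left_cancel₀ (pow_ne_zero 2 hn1) ?_
    linear_combination -((n : ℝ) - 2) * ((n - 1) * α + κ * (σ * ρ)) * h2
      - κ * ρ ^ 2 * h1 - (n - 1) * (1 - α ^ 2) * hκρ
  have e2 : κ * σ ^ 2 * (n - 2 + lam ^ 2) = n - 1 := by
    refine mul_left_cancel₀ hn2 ?_
    linear_combination (n - 2 + lam ^ 2) * h1 + (n - 1) * e1
  have e3 : κ * sigmaOf n κ s lam ^ 2 * (n - 2 + lam ^ 2) = n - 1 := by
    have h3 := sigmaOf_sq (lam := lam) hn hκ hs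
    have h4 := one_sub_alphaOf_sq (lam := lam) hn hs
    rw [eq_div_iff hn2] at h3
    refine mul_left_cancel₀ hn2 ?_
    linear_combination (n - 2 + lam ^ 2) * h3 + (n - 1) * h4
  have e4 : (s * sigmaOf n κ s lam) ^ 2 = (s * σ) ^ 2 := by
    rw [mul_pow, mul_pow, pow_two s, sign_mul_self hs]
    refine mul_left_cancel₀ (mul_ne_zero hκ.ne' hr) ?_
    linear_combination e3 - e2
  have e5 : 0 ≤ s * sigmaOf n κ s lam := by
    have : s * sigmaOf n κ s lam = s * s * (Real.sqrt (((n : ℝ) + 1 - 2) / κ) *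
        (1 / Real.sqrt ((n : ℝ) + 1 - 3 + lam ^ 2))) := by rw [sigmaOf]; ring
    rw [this, sign_mul_self hs]
    positivity
  have e6 : s * sigmaOf n κ s lam = s * σ := by
    rwa [sq_eq_sq₀ e5 hsσ] at e4
  have hs0 : s ≠ 0 := by rcases hs with rfl | rfl <;> norm_num
  have e7 := mul_left_cancel₀ hs0 e6
  refine ⟨e7, mul_left_cancel₀ hn1 ?_⟩
  rw [← sigmaOf_mul_rhoOf hn hκ, e7, hρ, h2]

lemma exists_sign (σ : ℝ) : ∃ s : ℝ, (s = 1 ∨ s = -1) ∧ 0 ≤ s * σ := by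
  rcases le_total 0 σ with hσ | hσ
  · exact ⟨1, Or.inl rfl, by linarith⟩
  · exact ⟨-1, Or.inr rfl, by linarith⟩

lemma exists_rhoOf_eq (hn : 3 ≤ n) (hκ : 0 < κ) (ρ : ℝ) : ∃ lam, rhoOf n κ lam = ρ := by
  have := (sqrt_coupling_pos hn hκ).ne'
  exact ⟨ρ / Real.sqrt (((n : ℝ) + 1 - 2) / κ), by rw [rhoOf]; field_simp⟩

lemma eq_gammaOf (hn : 3 ≤ n) (hγ : ((n : ℝ) - 2) * γ = α + (n - 3))
    (hα : alphaOf ((n : ℝ) + 1) s lam = α) : gammaOf ((n : ℝ) + 1) s lam = γ := by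
  have hn' : (3 : ℝ) ≤ n := by exact_mod_cast hn
  have hn2 : (n : ℝ) - 2 ≠ 0 := by linarith
  refine mul_left_cancel₀ hn2 ?_
  rw [gammaOf_eq hn, hγ, hα]

/-- The energy integral of `μ'' = w (μ'² - c)`. -/
lemma exists_first_integral {I : Set ℝ} {μ : ℝ → ℝ} {w c : ℝ} (hI : IsOpen I)
    (hc : I.OrdConnected) (hμ : ContDiffOn ℝ ∞ μ I)
    (hode : ∀ y ∈ I, deriv (deriv μ) y = w * (deriv μ y ^ 2 - c)) :
    ∃ M, ∀ y ∈ I, deriv μ y ^ 2 = M * Real.exp (2 * (w * μ y)) + c := by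
  have hd : ∀ y ∈ I, HasDerivAt (fun y => (deriv μ y ^ 2 - c) * Real.exp (-2 * (w * μ y))) 0 y := by
    intro y hy
    have h1 := (differentiableAt_of_smooth_real hI hμ hy).hasDerivAt
    have h2 := (differentiableAt_of_smooth_real hI (contDiffOn_deriv hI hμ) hy).hasDerivAt
    refine (((h2.fun_pow 2).sub_const c).fun_mul (((h1.const_mul w).const_mul (-2)).exp)).congr_deriv
      ?_
    rw [hode y hy]
    ring
  obtain ⟨M, hM⟩ := hI.exists_is_const_of_deriv_eq_zero hc.isPreconnected
    (fun y hy => (hd y hy).differentiableAt.differentiableWithinAt) (fun y hy => (hd y hy).deriv)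
  refine ⟨M, fun y hy => ?_⟩
  rw [← hM y hy]
  have := IsWarpData.exp_cancel (w * μ y)
  linear_combination (-(deriv μ y ^ 2 - c)) * this

variable {I : Set ℝ} {U : Set (Fin n → ℝ)} {V : (Fin n → ℝ) → ℝ}
  {h : (Fin n → ℝ) → Matrix (Fin n) (Fin n) ℝ} {μ : ℝ → ℝ}
  {g : (Fin (n + 1) → ℝ) → Matrix (Fin (n + 1)) (Fin (n + 1)) ℝ} {φ : (Fin (n + 1) → ℝ) → ℝ}
  {W : ℝ → ℝ}

/-- A derived solution in terms of `twisted`, with the relation between `α` and `γ = α + δ`. -/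
lemma derived_twisted {δ : ℝ} (hseed : IsSeed ε Lam U V h) (hε : ε * ε = 1) (hn : 3 ≤ n)
    (hI : IsOpen I) (hne : I.Nonempty) (hμ : ContDiffOn ℝ ∞ μ I)
    (hδ : δ = ((n : ℝ) + 1 - 4) / ((n : ℝ) + 1 - 3) * (1 - α) ∨ IsGenericSeed U V h)
    (hg : ∀ p ∈ slab I U, g p = templateMetric ε V h α δ μ p)
    (hφ : ∀ p ∈ slab I U, φ p = σ * V (Fin.tail p) + ρ * μ (p 0))
    (hsol : IsScalarSolution κ (slab I U) g φ W) :
    IsScalarSolution κ (slab I U) (twisted ε α (-(α + δ)) V h μ μ)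
      (fun p => σ * V (Fin.tail p) + ρ * μ (p 0)) W ∧
    ((n : ℝ) - 2) * (α + δ) = α + (n - 3) := by
  have hsol' : IsScalarSolution κ (slab I U) (twisted ε α (-(α + δ)) V h μ μ)
      (fun p => σ * V (Fin.tail p) + ρ * μ (p 0)) W :=
    hsol.congr (isOpen_slab hI hseed.isOpen)
      (fun p hp => by rw [hg p hp, templateMetric_eq_twisted]) fun p hp => (hφ p hp).symm
  refine ⟨hsol', ?_⟩
  rcases hδ with hδ | hgen
  · have hn' : (3 : ℝ) ≤ n := by exact_mod_cast hn
    have hn2 : (n : ℝ) + 1 - 3 ≠ 0 := by linarith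
    rw [hδ]
    field_simp
    ring
  · exact gamma_eq_of_generic hseed hε hn hI hμ hsol' hgen hne

end Recover

/-! ### Classification of the derived solutions -/

section Classification

variable {n : ℕ} {κ ε Lam s lam : ℝ} {I : Set ℝ} {U : Set (Fin n → ℝ)} {V : (Fin n → ℝ) → ℝ}
  {h : (Fin n → ℝ) → Matrix (Fin n) (Fin n) ℝ} {μ : ℝ → ℝ} {W : ℝ → ℝ}

lemma twisted_congr {a c : ℝ} {P P' R R' : ℝ → ℝ} {p : Fin (n + 1) → ℝ} (hP : P (p 0) = P' (p 0))
    (hR : R (p 0) = R' (p 0)) : twisted ε a c V h P R p = twisted ε a c V h P' R' p := by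
  simp only [twisted, warped, hP, hR]

lemma twisted_add_const (a c m : ℝ) (P R : ℝ → ℝ) (p : Fin (n + 1) → ℝ) :
    twisted ε a c V h (fun y => P y + m) (fun y => R y + m) p =
      Real.exp (2 * m) • twisted ε a c V h P R p := by
  ext i j
  rw [Matrix.smul_apply, smul_eq_mul]
  refine Fin.cases ?_ (fun i => ?_) i <;> refine Fin.cases ?_ (fun j => ?_) j
  · rw [twisted_zero_zero, twisted_zero_zero, mul_left_comm, ← Real.exp_add]
    congr 2; ring
  · simp [twisted_zero_succ]
  · simp [twisted_succ_zero]
  · rw [twisted_succ_succ, twisted_succ_succ, ← mul_assoc (Real.exp (2 * m)), ← Real.exp_add]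
    congr 2; ring

/-- A vacuum seed with constant `V` has `Λ = 0`. -/
lemma IsSeed.not_const (hseed : IsSeed ε Lam U V h) (hε : ε * ε = 1) (hn : 3 ≤ n)
    (hL : Lam ≠ 0) : ¬ ∃ c, ∀ x ∈ U, V x = c := by
  rintro ⟨c, hc⟩
  have hn' : (3 : ℝ) ≤ n := by exact_mod_cast hn
  have hn1 : (n : ℝ) - 1 ≠ 0 := by linarith
  obtain ⟨x, hx⟩ := hseed.connected.nonempty
  have hVc : ∀ z ∈ U, V =ᶠ[𝓝 z] fun _ => c := fun z hz =>
    Filter.eventuallyEq_of_mem (hseed.isOpen.mem_nhds hz) hc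
  have e0 : ∀ z ∈ U, ∀ i, pd i V z = 0 := fun z hz i => by rw [pd_congr (hVc z hz)]; simp
  have e1 : ∀ i j, pd i (pd j V) x = 0 := fun i j => by
    rw [pd_congr (Filter.eventuallyEq_of_mem (hseed.isOpen.mem_nhds hx) fun z hz => e0 z hz j)]
    simp
  have e2 := hseed.box_eq hε hn hx
  simp only [box, hess, e0 x hx, e1, gradInner, mul_zero, Finset.sum_const_zero, sub_zero,
    add_zero] at e2
  have e3 : -(2 * Lam / ((n : ℝ) - 1)) * Real.exp (-2 * V x) ≠ 0 :=
    mul_ne_zero (neg_ne_zero.2 (div_ne_zero (mul_ne_zero two_ne_zero hL) hn1)) (Real.exp_pos _).ne'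
  exact e3 e2.symm

/-- In class `S` the `dy²` equation and the `dxⁱ dxʲ` equations are compatible only for `Λ = 0`, and
then the potential vanishes on the range of the scalar field. -/
theorem classS_converse {g : (Fin (n + 1) → ℝ) → Matrix (Fin (n + 1)) (Fin (n + 1)) ℝ}
    {φ : (Fin (n + 1) → ℝ) → ℝ} (hseed : IsSeed ε Lam U V h) (hε : ε * ε = 1) (hn : 3 ≤ n)
    (hκ : 0 < κ) (hI : IsOpen I) (hne : I.Nonempty) (hS : IsClassS κ ε U V h I g φ W)
    (hφc : ¬ ∃ c : ℝ, ∀ p ∈ slab I U, φ p = c) :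
    Lam = 0 ∧ ∃ s lam : ℝ, (s = 1 ∨ s = -1) ∧ ∀ β : ℝ,
      Lam = LambdaOf ((n : ℝ) + 1) ε s lam 0 β ∧
      ∀ p ∈ slab I U,
        g p = genMetric ε V h s lam 0 β p ∧
        φ p = genField κ V s lam 0 p ∧
        W (φ p) = genPotential ((n : ℝ) + 1) κ ε lam 0 β (φ p) := by
  have hn' : (3 : ℝ) ≤ n := by exact_mod_cast hn
  have hn1 : (n : ℝ) - 1 ≠ 0 := by linarith
  have hn2 : (n : ℝ) - 2 ≠ 0 := by linarith
  obtain ⟨α, δ, σ, ρ, hδ, hg, hφ, hsol⟩ := hS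
  obtain ⟨hsol', hγ⟩ := derived_twisted hseed hε hn hI hne contDiffOn_const hδ hg hφ hsol
  have hφ' : ∀ p ∈ slab I U, φ p = σ * V (Fin.tail p) := fun p hp => by rw [hφ p hp]; simp
  have hσ0 : σ ≠ 0 := fun h0 => hφc ⟨0, fun p hp => by rw [hφ' p hp, h0, zero_mul]⟩
  have hV : ¬ ∃ c, ∀ x ∈ U, V x = c := fun ⟨c, hc⟩ =>
    hφc ⟨σ * c, fun p hp => by rw [hφ' p hp, hc _ hp.2]⟩
  have hσ2 := sigma_sq_of_nonconstant hseed hε hn hI contDiffOn_const hsol' hγ hne hV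
  have e1 : ∀ p ∈ slab I U, 2 * α * Lam / (n - 1) *
      Real.exp (-2 * ((1 - (α + δ)) * V (Fin.tail p))) = κ * (2 / (n - 1) * W (φ p)) := by
    intro p hp
    have := reduced_time hseed hε hn hI contDiffOn_const hsol' hγ hp
    rw [hφ' p hp]
    simpa using this
  have e2 : ∀ p ∈ slab I U, 2 * (2 - (α + δ)) * Lam / (n - 1) *
      Real.exp (-2 * ((1 - (α + δ)) * V (Fin.tail p))) = κ * (2 / (n - 1)) * W (φ p) := by
    intro p hp
    have := reduced_trace hseed hε hn hI contDiffOn_const hsol' hγ hp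
    rw [hφ' p hp]
    simpa using this
  have hα : 1 - α ≠ 0 := by
    intro h0
    have : κ * σ ^ 2 = 0 := by
      rw [hσ2, show 1 - α ^ 2 = (1 - α) * (1 + α) by ring, h0]; simp
    exact (mul_ne_zero hκ.ne' (pow_ne_zero 2 hσ0)) this
  have hL : Lam = 0 := by
    obtain ⟨y, hy⟩ := hne
    obtain ⟨x, hx⟩ := hseed.connected.nonempty
    have hp : (Fin.cons y x : Fin (n + 1) → ℝ) ∈ slab I U :=
      ⟨by simpa using hy, by simpa using hx⟩
    have e3 : Lam * ((n - 1) * (1 - α)) * Real.exp (-2 * ((1 - (α + δ)) * V x)) = 0 := by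
      have e4 := e1 _ hp
      have e5 := e2 _ hp
      simp only [Fin.tail_cons] at e4 e5
      have e6 : 2 * (2 - (α + δ) - α) * Lam / (n - 1) *
          Real.exp (-2 * ((1 - (α + δ)) * V x)) = 0 := by linear_combination e5 - e4
      have e7 : ((n : ℝ) - 2) * (2 - (α + δ) - α) = (n - 1) * (1 - α) := by linear_combination -hγ
      rw [← e7]
      have e8 := (mul_eq_zero.1 e6).resolve_right (Real.exp_pos _).ne'
      rw [div_eq_zero_iff, or_iff_left hn1] at e8
      linear_combination (((n : ℝ) - 2) / 2 * Real.exp (-2 * ((1 - (α + δ)) * V x))) * e8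
    have e9 := (mul_eq_zero.1 e3).resolve_right (Real.exp_pos _).ne'
    exact (mul_eq_zero.1 e9).resolve_right (mul_ne_zero hn1 hα)
  have hW : ∀ p ∈ slab I U, W (φ p) = 0 := by
    intro p hp
    have e4 := e2 p hp
    rw [hL, mul_zero, zero_div, zero_mul, eq_comm, mul_eq_zero] at e4
    exact e4.resolve_left (mul_ne_zero hκ.ne' (div_ne_zero two_ne_zero hn1))
  obtain ⟨s, hs, hsσ⟩ := exists_sign σ
  obtain ⟨lam, hlam⟩ := exists_rhoOf_eq hn hκ ((n - 1) * α / (κ * σ))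
  obtain ⟨hσ', hα'⟩ := recover_parameters hn hκ hs hsσ hσ2 (by field_simp) hlam
  have hγ' := eq_gammaOf hn hγ hα'
  refine ⟨hL, s, lam, hs, fun β => ⟨?_, fun p hp => ⟨?_, ?_, ?_⟩⟩⟩
  · rw [hL, LambdaOf_of_mul_eq_zero _ (by ring)]
  · have hD : denom lam 0 β (p 0) = 1 := by simp [denom]
    rw [hg p hp, templateMetric_eq_twisted, genMetric_eq_twisted (by rw [hD]; exact one_pos), hα',
      hγ']
    exact twisted_congr (by simp [hD]) (by simp)
  · rw [hφ' p hp, genField_eq, hσ', zero_mul, mul_zero, add_zero]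
  · rw [hW p hp, genPotential, W0Of]; simp

/-- For `Λ = 0` the equation `μ'' = (1 - λ²) μ'²` forces `μ'² = q² e^{2(1-λ²)μ}`, so that
`Y = μ / q` is the coordinate of the general form with `b = 1`. -/
theorem classT_flat (hseed : IsSeed ε 0 U V h) (hε : ε * ε = 1) (hn : 3 ≤ n)
    (hκ : 0 < κ) (hI : IsOpen I) (hIc : I.OrdConnected) (hμ : ContDiffOn ℝ ∞ μ I)
    (hne : ∃ y ∈ I, ∃ y' ∈ I, μ y ≠ μ y')
    (hsol : IsScalarSolution κ (slab I U)
      (twisted ε (alphaOf ((n : ℝ) + 1) s lam) (-gammaOf ((n : ℝ) + 1) s lam) V h μ μ)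
      (fun p => sigmaOf n κ s lam * V (Fin.tail p) + rhoOf n κ lam * μ (p 0)) W) :
    ∃ (q : ℝ) (Y : ℝ → ℝ), 0 < q ∧ IsCoordChange Y I (Y '' I) ∧
      ∀ p ∈ slab I U, 0 < denom lam q 1 (Y (p 0)) ∧
        twisted ε (alphaOf ((n : ℝ) + 1) s lam) (-gammaOf ((n : ℝ) + 1) s lam) V h μ μ p =
          pullY Y (genMetric ε V h s lam q 1) p ∧
        sigmaOf n κ s lam * V (Fin.tail p) + rhoOf n κ lam * μ (p 0) =
          genField κ V s lam q (changeY Y p) ∧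
        W (sigmaOf n κ s lam * V (Fin.tail p) + rhoOf n κ lam * μ (p 0)) =
          genPotential ((n : ℝ) + 1) κ ε lam q 1
            (sigmaOf n κ s lam * V (Fin.tail p) + rhoOf n κ lam * μ (p 0)) := by
  have hn' : (3 : ℝ) ≤ n := by exact_mod_cast hn
  have hn1 : (n : ℝ) - 1 ≠ 0 := by linarith
  have hγ := gammaOf_eq hn s lam
  have hκρ := rhoOf_sq (lam := lam) hn hκ
  have hε0 : ε ≠ 0 := fun h0 => by simp [h0] at hε
  obtain ⟨x₀, hx₀⟩ := hseed.connected.nonempty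
  have hode : ∀ y ∈ I, deriv (deriv μ) y = (1 - lam ^ 2) * (deriv μ y ^ 2 - 0) := by
    intro y hy
    have hp : (Fin.cons y x₀ : Fin (n + 1) → ℝ) ∈ slab I U :=
      ⟨by simpa using hy, by simpa using hx₀⟩
    have e := reduced_ode hseed hε hn hI hμ hsol hγ hp
    simp only [Fin.tail_cons, Fin.cons_zero, mul_zero, zero_div, zero_mul, neg_zero] at e
    have e1 := (mul_eq_zero.1 e).resolve_left (mul_ne_zero hε0 (Real.exp_pos _).ne')
    refine mul_left_cancel₀ hn1 ?_
    linear_combination e1 - deriv μ y ^ 2 * hκρ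
  obtain ⟨M, hM⟩ := exists_first_integral hI hIc hμ hode
  have hMpos : 0 < M := by
    obtain ⟨y, hy, hy0⟩ := exists_deriv_ne_zero hI hIc hμ hne
    have e := hM y hy
    rw [add_zero] at e
    exact pos_of_mul_pos_left (e ▸ (sq_pos_of_ne_zero hy0)) (Real.exp_pos _).le
  set q := Real.sqrt M with hq
  have hq0 : 0 < q := Real.sqrt_pos.2 hMpos
  have hqM : q ^ 2 = M := Real.sq_sqrt hMpos.le
  have hd1 : ∀ y, denom lam q 1 y = Real.exp (2 * ((1 - lam ^ 2) * (q * y))) := fun y => by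
    rw [denom]; ring_nf
  have hqY : ∀ y, q * (μ y / q) = μ y := fun y => by field_simp
  have hYd : ∀ y ∈ I, deriv (fun y => μ y / q) y = deriv μ y / q := fun y _ =>
    deriv_div_const _
  have hYsq : ∀ y ∈ I, deriv (fun y => μ y / q) y ^ 2 = denom lam q 1 (μ y / q) := fun y hy => by
    rw [hYd y hy, div_pow, hM y hy, hd1, hqY, ← hqM]
    field_simp
    ring
  have hYne : ∀ y ∈ I, deriv (fun y => μ y / q) y ≠ 0 := fun y hy h0 => by
    have := hYsq y hy
    rw [h0, hd1] at this
    have := Real.exp_pos (2 * ((1 - lam ^ 2) * (q * (μ y / q))))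
    simp_all
  have hYsm : ContDiffOn ℝ ∞ (fun y => μ y / q) I := hμ.div_const q
  refine ⟨q, fun y => μ y / q, hq0, ⟨hI, hIc, hYsm, ?_, hYne⟩, fun p hp => ⟨?_, ?_, ?_, ?_⟩⟩
  · refine Set.InjOn.bijOn_image fun a ha b hb hab => ?_
    -- by Rolle's theorem `Y` is injective, as `Y'` has no zero
    by_contra hne'
    wlog hlt : a < b generalizing a b
    · exact this b hb a ha hab.symm (Ne.symm hne') (lt_of_le_of_ne (not_lt.1 hlt) (Ne.symm hne'))
    obtain ⟨c, hc, hc0⟩ := exists_deriv_eq_zero hlt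
      (hYsm.continuousOn.mono (hIc.out ha hb)) hab
    exact hYne c (hIc.out ha hb (Set.Ioo_subset_Icc_self hc)) hc0
  · rw [hd1]; exact Real.exp_pos _
  · rw [pullY_genMetric_eq_twisted (by rw [hd1]; exact Real.exp_pos _) (hYsq _ hp.1)]
    exact twisted_congr (hqY _).symm (hqY _).symm
  · rw [genField_eq]
    simp [changeY, hqY]
  · have e := reduced_trace hseed hε hn hI hμ hsol hγ hp
    rw [mul_zero, zero_div, zero_mul, zero_sub, hode _ hp.1, hM _ hp.1, ← hqM] at e
    rw [genPotential_eq hn hκ]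
    have hW0 := W0Of_eq (n := n) (ε := ε) (lam := lam) (q := q) (β := 1) hκ
    have e1 : Real.exp (-2 * (alphaOf ((n : ℝ) + 1) s lam * V (Fin.tail p)) -
        2 * (lam ^ 2 * μ (p 0))) = Real.exp (-2 * (alphaOf ((n : ℝ) + 1) s lam * V (Fin.tail p)
          + μ (p 0))) * Real.exp (2 * ((1 - lam ^ 2) * μ (p 0))) := by
      rw [← Real.exp_add]; ring_nf
    rw [e1]
    set T := Real.exp (-2 * (alphaOf ((n : ℝ) + 1) s lam * V (Fin.tail p) + μ (p 0)))
    set B := Real.exp (2 * ((1 - lam ^ 2) * μ (p 0)))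
    set w := W (sigmaOf n κ s lam * V (Fin.tail p) + rhoOf n κ lam * μ (p 0))
    have e2 : κ * (2 / ((n : ℝ) - 1)) * w * (n - 1) = 2 * κ * w := by field_simp
    refine mul_left_cancel₀ (mul_ne_zero two_ne_zero hκ.ne') ?_
    linear_combination (-(n - 1) : ℝ) * e - e2 - T * B * hW0

/-- For `Λ ≠ 0` the `x`-dependence of the reduced equation leaves only `α = 1 / (N - 2)`, that is
`λ = s / √(N-1)`. -/
lemma special_of_Lambda_ne_zero (hseed : IsSeed ε Lam U V h) (hε : ε * ε = 1) (hn : 3 ≤ n)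
    (hI : IsOpen I) (hne : I.Nonempty) (hμ : ContDiffOn ℝ ∞ μ I) (hL : Lam ≠ 0)
    (hs : s = 1 ∨ s = -1)
    (hsol : IsScalarSolution κ (slab I U)
      (twisted ε (alphaOf ((n : ℝ) + 1) s lam) (-gammaOf ((n : ℝ) + 1) s lam) V h μ μ)
      (fun p => sigmaOf n κ s lam * V (Fin.tail p) + rhoOf n κ lam * μ (p 0)) W) :
    lam = s / Real.sqrt ((n : ℝ) + 1 - 1) := by
  have hn' : (3 : ℝ) ≤ n := by exact_mod_cast hn
  have hn1 : (n : ℝ) - 1 ≠ 0 := by linarith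
  have hn2 : (n : ℝ) - 2 ≠ 0 := by linarith
  have hV := hseed.not_const hε hn hL
  have hγ := gammaOf_eq hn s lam
  have hα1 := alphaOf_lt_one (lam := lam) hn hs
  have hα2 := alphaOf_sq (lam := lam) hn hs
  have hαpos : alphaOf ((n : ℝ) + 1) s lam = s * lam / Real.sqrt ((n : ℝ) + 1 - 3 + lam ^ 2) := by
    rw [alphaOf]; ring
  have hr := sqrt_param_pos hn lam
  set α := alphaOf ((n : ℝ) + 1) s lam
  set γ := gammaOf ((n : ℝ) + 1) s lam
  obtain ⟨y, hy⟩ := hne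
  -- the reduced equation at fixed `y` reads `A e^{-2αV} = B e^{-2(1-γ)V}` with `B ≠ 0`
  obtain ⟨A, B, hB, hAB⟩ : ∃ A B : ℝ, B ≠ 0 ∧ ∀ x ∈ U,
      A * Real.exp (-2 * (α * V x)) = B * Real.exp (-2 * ((1 - γ) * V x)) := by
    refine ⟨ε * Real.exp (-2 * μ y) * ((n - 1) * deriv (deriv μ) y - (n - 1) * deriv μ y ^ 2
        + κ * rhoOf n κ lam ^ 2 * deriv μ y ^ 2),
      -(2 * (2 - γ - α) * Lam / (n - 1) * Real.exp (-2 * μ y)), ?_, fun x hx => ?_⟩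
    · have e7 : ((n : ℝ) - 2) * (2 - γ - α) = (n - 1) * (1 - α) := by linear_combination -hγ
      have e8 : 2 - γ - α ≠ 0 := by
        intro h0
        rw [h0, mul_zero] at e7
        exact (mul_ne_zero hn1 (by linarith : (1 - α) ≠ 0)) e7.symm
      exact neg_ne_zero.2 (mul_ne_zero (div_ne_zero (mul_ne_zero (mul_ne_zero two_ne_zero e8) hL)
        hn1) (Real.exp_pos _).ne')
    · have hp : (Fin.cons y x : Fin (n + 1) → ℝ) ∈ slab I U :=
        ⟨by simpa using hy, by simpa using hx⟩
      have e := reduced_ode hseed hε hn hI hμ hsol hγ hp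
      simp only [Fin.tail_cons, Fin.cons_zero] at e
      rw [mul_add (-2 : ℝ), Real.exp_add, sub_eq_add_neg _ (2 * μ y), Real.exp_add,
        ← neg_mul 2] at e
      linear_combination e
  have hexp : ∀ x ∈ U, A = B * Real.exp (2 * ((α - (1 - γ)) * V x)) := by
    intro x hx
    have e := hAB x hx
    have e1 : Real.exp (-2 * ((1 - γ) * V x)) = Real.exp (2 * ((α - (1 - γ)) * V x)) *
        Real.exp (-2 * (α * V x)) := by rw [← Real.exp_add]; ring_nf
    rw [e1, ← mul_assoc B] at e
    exact mul_right_cancel₀ (Real.exp_pos _).ne' e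
  have hαγ : α - (1 - γ) = 0 := by
    by_contra h0
    obtain ⟨x₀, hx₀⟩ := hseed.connected.nonempty
    refine hV ⟨V x₀, fun x hx => ?_⟩
    have e := (hexp x hx).symm.trans (hexp x₀ hx₀)
    have e1 := Real.exp_injective (mul_left_cancel₀ hB e)
    exact mul_left_cancel₀ h0 (mul_left_cancel₀ two_ne_zero e1)
  have hα : (n - 1) * α = 1 := by linear_combination (n - 2) * hαγ - hγ
  have hl : n * lam ^ 2 = 1 := by
    refine mul_left_cancel₀ hn2 ?_
    linear_combination ((n - 1) * α + 1) * (n - 2 + lam ^ 2) * hα - (n - 1) ^ 2 * hα2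
  have hsl : 0 ≤ s * lam := by
    have : 0 < α := by
      by_contra h0
      nlinarith
    rw [hαpos] at this
    exact (div_pos_iff_of_pos_right hr).1 this |>.le
  have hsq : (s * lam * Real.sqrt n) ^ 2 = 1 ^ 2 := by
    rw [mul_pow, mul_pow, pow_two s, sign_mul_self hs, Real.sq_sqrt (by linarith)]
    linarith
  rw [sq_eq_sq₀ (by positivity) zero_le_one] at hsq
  rw [show (n : ℝ) + 1 - 1 = n by ring, eq_div_iff (Real.sqrt_pos.2 (by linarith)).ne']
  linear_combination s * hsq - lam * Real.sqrt n * sign_mul_self hs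

/-- For `Λ ≠ 0` the energy integral is `μ'² = M e^{2(1-λ²)μ} + c` with `c ≠ 0` fixed by `Λ`. The
shift `m` of `μ` is chosen such that `q² = M e^{2(1-λ²)m} + c` is positive; `m = 0` is
possible precisely if `M + c > 0`. -/
theorem classT_Lambda (hseed : IsSeed ε Lam U V h) (hε : ε * ε = 1) (hn : 3 ≤ n)
    (hκ : 0 < κ) (hI : IsOpen I) (hIc : I.OrdConnected) (hμ : ContDiffOn ℝ ∞ μ I)
    (hne : ∃ y ∈ I, ∃ y' ∈ I, μ y ≠ μ y') (hL : Lam ≠ 0) (hs : s = 1 ∨ s = -1)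
    (hlam : lam = s / Real.sqrt ((n : ℝ) + 1 - 1))
    (hsol : IsScalarSolution κ (slab I U)
      (twisted ε (alphaOf ((n : ℝ) + 1) s lam) (-gammaOf ((n : ℝ) + 1) s lam) V h μ μ)
      (fun p => sigmaOf n κ s lam * V (Fin.tail p) + rhoOf n κ lam * μ (p 0)) W) :
    ∃ (q β m : ℝ) (Y : ℝ → ℝ), 0 < q ∧ β ≠ 1 ∧
      Lam = LambdaOf ((n : ℝ) + 1) ε s lam q β ∧
      (β - 1 < β * Real.exp (-2 * (1 - lam ^ 2) * m) → m = 0) ∧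
      ContDiffOn ℝ ∞ Y I ∧ {y | y ∈ I ∧ deriv Y y = 0}.Subsingleton ∧
      ∀ p ∈ slab I U,
        sigmaOf n κ s lam * V (Fin.tail p) + rhoOf n κ lam * μ (p 0) =
          genField κ V s lam q (changeY Y p) + Real.sqrt (((n : ℝ) + 1 - 2) / κ) * lam * m ∧
        W (sigmaOf n κ s lam * V (Fin.tail p) + rhoOf n κ lam * μ (p 0)) = Real.exp (-2 * m) *
          genPotential ((n : ℝ) + 1) κ ε lam q β
            (sigmaOf n κ s lam * V (Fin.tail p) + rhoOf n κ lam * μ (p 0)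
              - Real.sqrt (((n : ℝ) + 1 - 2) / κ) * lam * m) ∧
        (deriv Y (p 0) ≠ 0 → 0 < denom lam q β (Y (p 0)) ∧
          twisted ε (alphaOf ((n : ℝ) + 1) s lam) (-gammaOf ((n : ℝ) + 1) s lam) V h μ μ p =
            Real.exp (2 * m) • pullY Y (genMetric ε V h s lam q β) p) := by
  have hn' : (3 : ℝ) ≤ n := by exact_mod_cast hn
  have hn0 : (n : ℝ) ≠ 0 := by linarith
  have hn1 : (n : ℝ) - 1 ≠ 0 := by linarith
  have hγ := gammaOf_eq hn s lam
  have hκρ := rhoOf_sq (lam := lam) hn hκ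
  have hε0 : ε ≠ 0 := fun h0 => by simp [h0] at hε
  have hα := special_alphaOf hn hs hlam
  have hl := special_lam_sq hn hs hlam
  have hγα : 1 - gammaOf ((n : ℝ) + 1) s lam = alphaOf ((n : ℝ) + 1) s lam := by
    refine mul_left_cancel₀ (by linarith : (n : ℝ) - 2 ≠ 0) ?_
    linear_combination -hγ - hα
  obtain ⟨x₀, hx₀⟩ := hseed.connected.nonempty
  set w := 1 - lam ^ 2 with hw
  have hnw : n * w = n - 1 := by rw [hw]; linear_combination -hl
  have hw0 : w ≠ 0 := fun h0 => hn1 (by rw [← hnw, h0, mul_zero])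
  set c := 2 * ε * Lam * n / (n - 1) ^ 3 with hc
  have hc0 : c ≠ 0 := div_ne_zero (mul_ne_zero (mul_ne_zero (mul_ne_zero two_ne_zero hε0) hL) hn0)
    (pow_ne_zero 3 hn1)
  have hcL : c * (n - 1) ^ 3 = 2 * ε * Lam * n := by rw [hc]; field_simp
  -- `Λ`-terms of the reduced equations in terms of `c`
  have hcL' : 2 * Lam / (n - 1) = ε * (n - 1) * (w * c) := by
    rw [div_eq_iff hn1]
    refine mul_left_cancel₀ hn0 ?_
    linear_combination (-2 * Lam * n) * hε - ε * hcL - ε * (n - 1) ^ 2 * c * hnw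
  have hEq : ∀ v r : ℝ, Real.exp (-2 * (alphaOf ((n : ℝ) + 1) s lam * v) - 2 * r) =
      Real.exp (-2 * (alphaOf ((n : ℝ) + 1) s lam * v + r)) := fun v r => by ring_nf
  have hode : ∀ y ∈ I, deriv (deriv μ) y = w * (deriv μ y ^ 2 - c) := by
    intro y hy
    have hp : (Fin.cons y x₀ : Fin (n + 1) → ℝ) ∈ slab I U :=
      ⟨by simpa using hy, by simpa using hx₀⟩
    have e := reduced_ode hseed hε hn hI hμ hsol hγ hp
    simp only [Fin.tail_cons, Fin.cons_zero, hγα, hEq] at e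
    have e2 : 2 - gammaOf ((n : ℝ) + 1) s lam - alphaOf ((n : ℝ) + 1) s lam = 1 := by linarith
    rw [e2, mul_one, hcL'] at e
    refine mul_left_cancel₀ hn1 (mul_left_cancel₀ (mul_ne_zero hε0 (Real.exp_pos
      (-2 * (alphaOf ((n : ℝ) + 1) s lam * V x₀ + μ y))).ne') ?_)
    rw [hw] at e ⊢
    linear_combination e - ε * Real.exp (-2 * (alphaOf ((n : ℝ) + 1) s lam * V x₀ + μ y)) *
      deriv μ y ^ 2 * hκρ
  obtain ⟨M, hM⟩ := exists_first_integral hI hIc hμ hode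
  obtain ⟨m, hm, hm0⟩ : ∃ m, 0 < M * Real.exp (2 * (w * m)) + c ∧ (0 < M + c → m = 0) := by
    by_cases hMc : 0 < M + c
    · exact ⟨0, by simpa using hMc, fun _ => rfl⟩
    · obtain ⟨y, hy, hy0⟩ := exists_deriv_ne_zero hI hIc hμ hne
      exact ⟨μ y, by rw [← hM y hy]; positivity, fun h0 => absurd h0 hMc⟩
  set q := Real.sqrt (M * Real.exp (2 * (w * m)) + c) with hq
  have hq0 : 0 < q := Real.sqrt_pos.2 hm
  have hq2 : q ^ 2 = M * Real.exp (2 * (w * m)) + c := Real.sq_sqrt hm.le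
  set β := M * Real.exp (2 * (w * m)) / q ^ 2 with hβ
  have hqβ : q ^ 2 * β = M * Real.exp (2 * (w * m)) := by rw [hβ]; field_simp
  have hqc : q ^ 2 * (1 - β) = c := by linear_combination hq2 - hqβ
  have hqY : ∀ y, q * ((μ y - m) / q) = μ y - m := fun y => by field_simp
  have hYd : ∀ y, deriv (fun y => (μ y - m) / q) y = deriv μ y / q := fun y => by
    rw [deriv_div_const, deriv_sub_const]
  have hYsq : ∀ y ∈ I, deriv (fun y => (μ y - m) / q) y ^ 2 = denom lam q β ((μ y - m) / q) := by
    intro y hy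
    have e1 : Real.exp (2 * (w * m)) * Real.exp (2 * w * (μ y - m)) = Real.exp (2 * (w * μ y)) := by
      rw [← Real.exp_add]; ring_nf
    rw [hYd, div_pow, div_eq_iff (pow_ne_zero 2 hq0.ne'), hM y hy, denom, hqY, ← hw]
    linear_combination -M * e1 - Real.exp (2 * w * (μ y - m)) * hqβ - hqc
  refine ⟨q, β, m, fun y => (μ y - m) / q, hq0, ?_, ?_, ?_, (hμ.sub contDiffOn_const).div_const q,
    ?_, fun p hp => ⟨?_, ?_, fun hY0 => ?_⟩⟩
  · intro h1
    rw [h1, sub_self, mul_zero] at hqc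
    exact hc0 hqc.symm
  · have e := special_LambdaOf (ε := ε) (q := q) (β := β) hn hs hlam
    rw [hqc] at e
    refine mul_left_cancel₀ (mul_ne_zero two_ne_zero hn0) ?_
    linear_combination (-2 * Lam * n) * hε - ε * hcL - e
  · intro hlt
    refine hm0 ?_
    have e1 : Real.exp (2 * (w * m)) * Real.exp (-2 * w * m) = 1 := by
      rw [← Real.exp_add]; ring_nf; exact Real.exp_zero
    have e2 := mul_lt_mul_of_pos_left hlt (pow_pos hq0 2)
    have e3 : q ^ 2 * (β * Real.exp (-2 * w * m)) = M := by
      linear_combination Real.exp (-2 * w * m) * hqβ + M * e1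
    linarith
  · -- at a zero of `μ'` the constant `M` is non-zero, hence `μ''` has constant sign
    rintro a ⟨ha, ha0⟩ b ⟨hb, hb0⟩
    rw [hYd, div_eq_zero_iff, or_iff_left hq0.ne'] at ha0 hb0
    have hMne : M ≠ 0 := by
      rintro rfl
      have := hM a ha
      rw [ha0] at this
      simp only [zero_mul, zero_add] at this
      exact hc0 (by rw [← this]; norm_num)
    by_contra hab
    wlog hlt : a < b generalizing a b
    · exact this hb hb0 ha ha0 (Ne.symm hab) (lt_of_le_of_ne (not_lt.1 hlt) (Ne.symm hab))
    obtain ⟨t, ht, ht0⟩ := exists_deriv_eq_zero hlt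
      ((contDiffOn_deriv hI hμ).continuousOn.mono (hIc.out ha hb)) (ha0.trans hb0.symm)
    have htI := hIc.out ha hb (Set.Ioo_subset_Icc_self ht)
    rw [hode t htI, hM t htI, add_sub_cancel_right] at ht0
    exact mul_ne_zero hw0 (mul_ne_zero hMne (Real.exp_pos _).ne') ht0
  · rw [genField_eq]
    simp only [changeY, Fin.cons_zero, Fin.tail_cons, hqY, rhoOf]
    ring
  · have e := reduced_trace hseed hε hn hI hμ hsol hγ hp
    rw [hγα, hEq, hode _ hp.1, hM _ hp.1] at e
    have e0 : sigmaOf n κ s lam * V (Fin.tail p) + rhoOf n κ lam * μ (p 0)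
        - Real.sqrt (((n : ℝ) + 1 - 2) / κ) * lam * m =
        sigmaOf n κ s lam * V (Fin.tail p) + rhoOf n κ lam * (μ (p 0) - m) := by
      rw [rhoOf]; ring
    rw [e0, genPotential_eq hn hκ]
    have hW0 := W0Of_eq (n := n) (ε := ε) (lam := lam) (q := q) (β := β) hκ
    rw [hqβ] at hW0
    have e1 : Real.exp (2 * (w * m)) * (Real.exp (-2 * m) *
        Real.exp (-2 * (alphaOf ((n : ℝ) + 1) s lam * V (Fin.tail p)) -
        2 * (lam ^ 2 * (μ (p 0) - m)))) = Real.exp (-2 * (alphaOf ((n : ℝ) + 1) s lam *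
          V (Fin.tail p) + μ (p 0))) * Real.exp (2 * (w * μ (p 0))) := by
      rw [← Real.exp_add, ← Real.exp_add, ← Real.exp_add, hw]; ring_nf
    have e2 : 2 * (2 - gammaOf ((n : ℝ) + 1) s lam) * Lam / (n - 1) =
        (1 + alphaOf ((n : ℝ) + 1) s lam) * (2 * Lam / (n - 1)) := by
      rw [← hγα]; ring
    rw [e2, hcL'] at e
    have e3 : (n - 1) * (1 + alphaOf ((n : ℝ) + 1) s lam) = n := by linear_combination hα
    set T := Real.exp (-2 * (alphaOf ((n : ℝ) + 1) s lam * V (Fin.tail p) + μ (p 0)))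
    set w' := W (sigmaOf n κ s lam * V (Fin.tail p) + rhoOf n κ lam * μ (p 0))
    have e4 : 2 * κ * w' = -ε * ((n - 1) * (n - lam ^ 2)) * (T * (M * Real.exp (2 * (w * μ (p 0))))) := by
      have e5 : κ * (2 / ((n : ℝ) - 1)) * w' * (n - 1) = 2 * κ * w' := by field_simp
      rw [← e5, ← e]
      rw [hw] at hnw ⊢
      linear_combination ε * (n - 1) * (1 - lam ^ 2) * c * T * e3 + ε * (n - 1) * c * T * hnw
    refine mul_left_cancel₀ (mul_ne_zero two_ne_zero hκ.ne') ?_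
    rw [e4]
    linear_combination (-Real.exp (-2 * m) *
      Real.exp (-2 * (alphaOf ((n : ℝ) + 1) s lam * V (Fin.tail p)) -
        2 * (lam ^ 2 * (μ (p 0) - m)))) * hW0 + ε * ((n - 1) * (n - lam ^ 2)) * M * e1
  · have hD : 0 < denom lam q β ((μ (p 0) - m) / q) := by
      rw [← hYsq _ hp.1]; exact sq_pos_of_ne_zero hY0
    refine ⟨hD, ?_⟩
    rw [pullY_genMetric_eq_twisted hD (hYsq _ hp.1), ← twisted_add_const]
    exact twisted_congr (by simp only [hqY]; ring) (by simp only [hqY]; ring)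

end Classification

section Parameters

variable {n : ℕ} {κ ε Lam : ℝ} {I : Set ℝ} {U : Set (Fin n → ℝ)} {V : (Fin n → ℝ) → ℝ}
  {h : (Fin n → ℝ) → Matrix (Fin n) (Fin n) ℝ}
  {g : (Fin (n + 1) → ℝ) → Matrix (Fin (n + 1)) (Fin (n + 1)) ℝ} {φ : (Fin (n + 1) → ℝ) → ℝ}
  {W : ℝ → ℝ}

/-- For non-constant `V` the constants of a class `T` solution are those of the general form. -/
lemma exists_parameters (hseed : IsSeed ε Lam U V h) (hε : ε * ε = 1) (hn : 3 ≤ n)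
    (hκ : 0 < κ) (hI : IsOpen I) (hIc : I.OrdConnected) (hV : ¬ ∃ c, ∀ x ∈ U, V x = c)
    (hT : IsClassT κ ε U V h I g φ W) :
    ∃ s lam : ℝ, (s = 1 ∨ s = -1) ∧ ∃ μ : ℝ → ℝ, ContDiffOn ℝ ∞ μ I ∧
      (∃ y ∈ I, ∃ y' ∈ I, μ y ≠ μ y') ∧
      (∀ p ∈ slab I U, g p = twisted ε (alphaOf ((n : ℝ) + 1) s lam)
        (-gammaOf ((n : ℝ) + 1) s lam) V h μ μ p) ∧
      (∀ p ∈ slab I U, φ p = sigmaOf n κ s lam * V (Fin.tail p) + rhoOf n κ lam * μ (p 0)) ∧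
      IsScalarSolution κ (slab I U)
        (twisted ε (alphaOf ((n : ℝ) + 1) s lam) (-gammaOf ((n : ℝ) + 1) s lam) V h μ μ)
        (fun p => sigmaOf n κ s lam * V (Fin.tail p) + rhoOf n κ lam * μ (p 0)) W := by
  obtain ⟨μ, hμ, hne, α, δ, σ, ρ, hδ, hg, hφ, hsol⟩ := hT
  obtain ⟨y, hy, -⟩ := id hne
  obtain ⟨hsol', hγ⟩ := derived_twisted hseed hε hn hI ⟨y, hy⟩ hμ hδ hg hφ hsol
  have h1 := sigma_sq_of_nonconstant hseed hε hn hI hμ hsol' hγ ⟨y, hy⟩ hV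
  have h2 := mixed_of_nonconstant hseed hε hI hμ hsol' hIc hne hV
  obtain ⟨s, hs, hsσ⟩ := exists_sign σ
  obtain ⟨lam, hlam⟩ := exists_rhoOf_eq hn hκ ρ
  obtain ⟨hσ, hα⟩ := recover_parameters hn hκ hs hsσ h1 h2 hlam
  refine ⟨s, lam, hs, μ, hμ, hne, ?_⟩
  rw [eq_gammaOf hn hγ hα, hα, hσ, hlam]
  exact ⟨fun p hp => by rw [hg p hp, templateMetric_eq_twisted], hφ, hsol'⟩

/-- If `V` vanishes, the constants multiplying `V` may be chosen at will. -/
lemma exists_parameters_flat (hseed : IsSeed ε 0 U V h) (hε : ε * ε = 1) (hn : 3 ≤ n)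
    (hκ : 0 < κ) (hI : IsOpen I) (hIc : I.OrdConnected)
    (hV : ∀ c : ℝ, (∀ x ∈ U, V x = c) → c = 0) (hT : IsClassT κ ε U V h I g φ W) :
    ∃ s lam : ℝ, (s = 1 ∨ s = -1) ∧ ∃ μ : ℝ → ℝ, ContDiffOn ℝ ∞ μ I ∧
      (∃ y ∈ I, ∃ y' ∈ I, μ y ≠ μ y') ∧
      (∀ p ∈ slab I U, g p = twisted ε (alphaOf ((n : ℝ) + 1) s lam)
        (-gammaOf ((n : ℝ) + 1) s lam) V h μ μ p) ∧
      (∀ p ∈ slab I U, φ p = sigmaOf n κ s lam * V (Fin.tail p) + rhoOf n κ lam * μ (p 0)) ∧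
      IsScalarSolution κ (slab I U)
        (twisted ε (alphaOf ((n : ℝ) + 1) s lam) (-gammaOf ((n : ℝ) + 1) s lam) V h μ μ)
        (fun p => sigmaOf n κ s lam * V (Fin.tail p) + rhoOf n κ lam * μ (p 0)) W := by
  by_cases hc : ∃ c, ∀ x ∈ U, V x = c
  · obtain ⟨c, hc⟩ := hc
    have hV0 : ∀ x ∈ U, V x = 0 := fun x hx => by rw [hc x hx, hV c hc]
    obtain ⟨μ, hμ, hne, α, δ, σ, ρ, -, hg, hφ, hsol⟩ := hT
    obtain ⟨lam, hlam⟩ := exists_rhoOf_eq hn hκ ρ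
    have hg' : ∀ p ∈ slab I U, g p = twisted ε (alphaOf ((n : ℝ) + 1) 1 lam)
        (-gammaOf ((n : ℝ) + 1) 1 lam) V h μ μ p := fun p hp => by
      rw [hg p hp, templateMetric_eq_twisted]
      simp only [twisted, warped, conformal, hV0 _ hp.2, mul_zero]
    have hφ' : ∀ p ∈ slab I U,
        φ p = sigmaOf n κ 1 lam * V (Fin.tail p) + rhoOf n κ lam * μ (p 0) := fun p hp => by
      rw [hφ p hp, hV0 _ hp.2, hlam, mul_zero, mul_zero]
    exact ⟨1, lam, Or.inl rfl, μ, hμ, hne, hg', hφ', hsol.congr (isOpen_slab hI hseed.isOpen)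
      (fun p hp => (hg' p hp).symm) fun p hp => (hφ' p hp).symm⟩
  · exact exists_parameters hseed hε hn hκ hI hIc hc hT

end Parameters

end EinsteinScalar

theorem theorem2 (n : ℕ) (hn : 3 ≤ n) (κ : ℝ) (hκ : 0 < κ) (ε : ℝ) (hε : ε = 1 ∨ ε = -1)
    (Lam : ℝ) (U : Set (Fin n → ℝ)) (V : (Fin n → ℝ) → ℝ)
    (h : (Fin n → ℝ) → Matrix (Fin n) (Fin n) ℝ)
    (hseed : EinsteinScalar.IsSeed ε Lam U V h) :
    -- every member of the family solves the field equations
    (∀ s lam q β : ℝ, (s = 1 ∨ s = -1) → 0 ≤ q →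
      (q = 0 ∨ β = 1 ∨ lam = s / Real.sqrt ((n : ℝ) + 1 - 1)) →
      Lam = EinsteinScalar.LambdaOf ((n : ℝ) + 1) ε s lam q β →
      EinsteinScalar.IsScalarSolution κ
        (EinsteinScalar.slab {Y | 0 < EinsteinScalar.denom lam q β Y} U)
        (EinsteinScalar.genMetric ε V h s lam q β) (EinsteinScalar.genField κ V s lam q)
        (EinsteinScalar.genPotential ((n : ℝ) + 1) κ ε lam q β)) ∧
    -- class S: the members with q = 0 are of class S
    (∀ s lam β : ℝ, (s = 1 ∨ s = -1) →
      Lam = EinsteinScalar.LambdaOf ((n : ℝ) + 1) ε s lam 0 β →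
      ∀ I : Set ℝ, IsOpen I → I.OrdConnected → I.Nonempty →
      Lam = 0 ∧ EinsteinScalar.IsClassS κ ε U V h I
        (EinsteinScalar.genMetric ε V h s lam 0 β) (EinsteinScalar.genField κ V s lam 0)
        (EinsteinScalar.genPotential ((n : ℝ) + 1) κ ε lam 0 β)) ∧
    -- class S: there are no others
    (∀ (I : Set ℝ) (g : (Fin (n + 1) → ℝ) → Matrix (Fin (n + 1)) (Fin (n + 1)) ℝ)
        (φ : (Fin (n + 1) → ℝ) → ℝ) (W : ℝ → ℝ),
      IsOpen I → I.OrdConnected → I.Nonempty →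
      EinsteinScalar.IsClassS κ ε U V h I g φ W →
      (¬ ∃ c : ℝ, ∀ p ∈ EinsteinScalar.slab I U, φ p = c) →
      Lam = 0 ∧ ∃ s lam : ℝ, (s = 1 ∨ s = -1) ∧ ∀ β : ℝ,
        Lam = EinsteinScalar.LambdaOf ((n : ℝ) + 1) ε s lam 0 β ∧
        ∀ p ∈ EinsteinScalar.slab I U,
          g p = EinsteinScalar.genMetric ε V h s lam 0 β p ∧
          φ p = EinsteinScalar.genField κ V s lam 0 p ∧
          W (φ p) = EinsteinScalar.genPotential ((n : ℝ) + 1) κ ε lam 0 β (φ p)) ∧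
    -- class T with vanishing cosmological constant of the seed: the members with b = 1, q > 0
    (∀ s lam q : ℝ, (s = 1 ∨ s = -1) → 0 < q →
      Lam = EinsteinScalar.LambdaOf ((n : ℝ) + 1) ε s lam q 1 →
      Lam = 0 ∧ ∃ (I : Set ℝ) (Y : ℝ → ℝ),
        EinsteinScalar.IsCoordChange Y I {Y | 0 < EinsteinScalar.denom lam q 1 Y} ∧
        EinsteinScalar.IsClassT κ ε U V h I
          (EinsteinScalar.pullY Y (EinsteinScalar.genMetric ε V h s lam q 1))
          (fun p => EinsteinScalar.genField κ V s lam q (EinsteinScalar.changeY Y p))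
          (EinsteinScalar.genPotential ((n : ℝ) + 1) κ ε lam q 1)) ∧
    -- there are no others
    (∀ (I : Set ℝ) (g : (Fin (n + 1) → ℝ) → Matrix (Fin (n + 1)) (Fin (n + 1)) ℝ)
        (φ : (Fin (n + 1) → ℝ) → ℝ) (W : ℝ → ℝ),
      IsOpen I → I.OrdConnected → Lam = 0 →
      (∀ c : ℝ, (∀ x ∈ U, V x = c) → c = 0) →
      EinsteinScalar.IsClassT κ ε U V h I g φ W →
      ∃ (s lam q : ℝ) (Y : ℝ → ℝ), (s = 1 ∨ s = -1) ∧ 0 < q ∧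
        Lam = EinsteinScalar.LambdaOf ((n : ℝ) + 1) ε s lam q 1 ∧
        EinsteinScalar.IsCoordChange Y I (Y '' I) ∧
        ∀ p ∈ EinsteinScalar.slab I U,
          0 < EinsteinScalar.denom lam q 1 (Y (p 0)) ∧
          g p = EinsteinScalar.pullY Y (EinsteinScalar.genMetric ε V h s lam q 1) p ∧
          φ p = EinsteinScalar.genField κ V s lam q (EinsteinScalar.changeY Y p) ∧
          W (φ p) = EinsteinScalar.genPotential ((n : ℝ) + 1) κ ε lam q 1 (φ p)) ∧
    -- class T with non-zero cosmological constant of the seed: the members with b² ≠ 1, q > 0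
    (∀ s lam q β : ℝ, (s = 1 ∨ s = -1) → 0 < q → β ≠ 1 →
      lam = s / Real.sqrt ((n : ℝ) + 1 - 1) →
      Lam = EinsteinScalar.LambdaOf ((n : ℝ) + 1) ε s lam q β →
      Lam ≠ 0 ∧ ∃ (I : Set ℝ) (Y : ℝ → ℝ),
        EinsteinScalar.IsCoordChange Y I {Y | 0 < EinsteinScalar.denom lam q β Y} ∧
        EinsteinScalar.IsClassT κ ε U V h I
          (EinsteinScalar.pullY Y (EinsteinScalar.genMetric ε V h s lam q β))
          (fun p => EinsteinScalar.genField κ V s lam q (EinsteinScalar.changeY Y p))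
          (EinsteinScalar.genPotential ((n : ℝ) + 1) κ ε lam q β)) ∧
    -- there are no others, up to the scaling symmetry of the field equations with parameter m
    (∀ (I : Set ℝ) (g : (Fin (n + 1) → ℝ) → Matrix (Fin (n + 1)) (Fin (n + 1)) ℝ)
        (φ : (Fin (n + 1) → ℝ) → ℝ) (W : ℝ → ℝ),
      IsOpen I → I.OrdConnected → Lam ≠ 0 →
      EinsteinScalar.IsClassT κ ε U V h I g φ W →
      ∃ (s lam q β m : ℝ) (Y : ℝ → ℝ), (s = 1 ∨ s = -1) ∧ 0 < q ∧ β ≠ 1 ∧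
        lam = s / Real.sqrt ((n : ℝ) + 1 - 1) ∧
        Lam = EinsteinScalar.LambdaOf ((n : ℝ) + 1) ε s lam q β ∧
        (β - 1 < β * Real.exp (-2 * (1 - lam ^ 2) * m) → m = 0) ∧
        ContDiffOn ℝ ∞ Y I ∧
        {y | y ∈ I ∧ deriv Y y = 0}.Subsingleton ∧
        ∀ p ∈ EinsteinScalar.slab I U,
          φ p = EinsteinScalar.genField κ V s lam q (EinsteinScalar.changeY Y p) +
            Real.sqrt (((n : ℝ) + 1 - 2) / κ) * lam * m ∧
          W (φ p) = Real.exp (-2 * m) *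
            EinsteinScalar.genPotential ((n : ℝ) + 1) κ ε lam q β
              (φ p - Real.sqrt (((n : ℝ) + 1 - 2) / κ) * lam * m) ∧
          (deriv Y (p 0) ≠ 0 →
            0 < EinsteinScalar.denom lam q β (Y (p 0)) ∧
            g p = Real.exp (2 * m) •
              EinsteinScalar.pullY Y (EinsteinScalar.genMetric ε V h s lam q β) p)) := by
  have hεε := EinsteinScalar.sign_mul_self hε
  refine ⟨?_, ?_, ?_, ?_, ?_, ?_, ?_⟩
  · intro s lam q β hs _ hpar hLam
    exact EinsteinScalar.isScalarSolution_genMetric hseed hεε hn hκ hs hpar hLam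
  · intro s lam β hs hLam I _ _ _
    have hD : ∀ y, EinsteinScalar.denom lam 0 β y = 1 := fun y => by simp [EinsteinScalar.denom]
    refine ⟨by rw [hLam, EinsteinScalar.LambdaOf_of_mul_eq_zero _ (by ring)],
      EinsteinScalar.alphaOf ((n : ℝ) + 1) s lam,
      ((n : ℝ) + 1 - 4) / ((n : ℝ) + 1 - 3) * (1 - EinsteinScalar.alphaOf ((n : ℝ) + 1) s lam),
      EinsteinScalar.sigmaOf n κ s lam, 0, Or.inl rfl, fun p _ => ?_, fun p _ => ?_, ?_⟩
    · rw [EinsteinScalar.genMetric_eq_twisted (by rw [hD]; exact one_pos),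
        EinsteinScalar.templateMetric_eq_twisted]
      exact EinsteinScalar.twisted_congr (by simp [hD]) (by simp)
    · rw [EinsteinScalar.genField_eq]; ring
    · refine (EinsteinScalar.isScalarSolution_genMetric hseed hεε hn hκ hs (Or.inl rfl)
        hLam).mono fun p hp => ⟨?_, hp.2⟩
      show 0 < EinsteinScalar.denom lam 0 β (p 0)
      rw [hD]; exact one_pos
  · intro I g φ W hI _ hne hS hφ
    exact EinsteinScalar.classS_converse hseed hεε hn hκ hI hne hS hφ
  · intro s lam q hs hq hLam
    exact ⟨by rw [hLam, EinsteinScalar.LambdaOf_of_mul_eq_zero _ (by ring)],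
      EinsteinScalar.exists_isClassT hseed hεε hn hκ hs hq (Or.inl rfl) hLam⟩
  · intro I g φ W hI hIc hLam hV hT
    subst hLam
    obtain ⟨s, lam, hs, hsol⟩ := EinsteinScalar.exists_parameters_flat hseed hεε hn hκ hI hIc hV hT
    obtain ⟨μ, hμ, hne, hg, hφ, hsol⟩ := hsol
    obtain ⟨q, Y, hq, hY, hp⟩ :=
      EinsteinScalar.classT_flat hseed hεε hn hκ hI hIc hμ hne hsol
    refine ⟨s, lam, q, Y, hs, hq,
      (EinsteinScalar.LambdaOf_of_mul_eq_zero _ (by ring)).symm, hY, fun p hpI => ?_⟩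
    rw [hg p hpI, hφ p hpI]
    exact hp p hpI
  · intro s lam q β hs hq hβ hlam hLam
    refine ⟨fun h0 => ?_,
      EinsteinScalar.exists_isClassT hseed hεε hn hκ hs hq (Or.inr hlam) hLam⟩
    have hn' : (3 : ℝ) ≤ n := by exact_mod_cast hn
    have e := EinsteinScalar.special_LambdaOf (ε := ε) (q := q) (β := β) hn hs hlam
    rw [← hLam, h0, mul_zero, eq_comm] at e
    have h1 : ε ≠ 0 := fun h => by simp [h] at hεε
    exact mul_ne_zero (mul_ne_zero h1 (pow_ne_zero 3 (by linarith : (n : ℝ) - 1 ≠ 0)))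
      (mul_ne_zero (pow_ne_zero 2 hq.ne') (sub_ne_zero.2 hβ.symm)) e
  · intro I g φ W hI hIc hLam hT
    obtain ⟨s, lam, hs, μ, hμ, hne, hg, hφ, hsol⟩ :=
      EinsteinScalar.exists_parameters hseed hεε hn hκ hI hIc (hseed.not_const hεε hn hLam) hT
    obtain ⟨y, hy, -⟩ := id hne
    have hlam := EinsteinScalar.special_of_Lambda_ne_zero hseed hεε hn hI ⟨y, hy⟩ hμ hLam hs hsol
    obtain ⟨q, β, m, Y, hq, hβ, hL, hm, hY, hY0, hp⟩ :=
      EinsteinScalar.classT_Lambda hseed hεε hn hκ hI hIc hμ hne hLam hs hlam hsol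
    refine ⟨s, lam, q, β, m, Y, hs, hq, hβ, hlam, hL, hm, hY, hY0, fun p hpI => ?_⟩
    rw [hg p hpI, hφ p hpI]
    exact hp p hpI
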